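/- Let $n\ge 1$ and let $x:\Sigma^n\to\mathbf R^N$ be a smooth, connected, complete (for the induced metric) immersed shrinker, i.e. $\mathbf H=\tfrac12 x^{\perp}$ with $\mathbf H=-\operatorname{tr}A$, where $A(v,w)=(D_v w)^{\perp}$ is the second fundamental form. Put $f=|x|^2/4$ and assume that the entropy $\lambda(\Sigma)=\sup_{c>0,\,x_0\in\mathbf R^N}F(c\,\Sigma+x_0)$, $F(\Sigma)=(4\pi)^{-n/2}\int_\Sigma e^{-f}$, is finite. Let $\mathcal L\phi=\Delta\phi-\tfrac12\nabla_{x^T}\phi$ be the drift Laplacian and let $\mu_0\le\mu_1\le\mu_2\le\dots$ be its eigenvalues, counted with multiplicity: $\mu$ is an eigenvalue with eigenfunction $\phi\neq0$ if $\phi$ is smooth, $\int_\Sigma\phi^2e^{-f}<\infty$ and $\mathcal L\phi+\mu\phi=0$. Precisely, $\mu_m$ is the infimum of those $c\in\mathbf R$ for which there are $m+1$ linearly independent eigenfunctions with eigenvalues $\le c$. Let also $$\hat\mu_m=\inf_{W}\ \sup_{0\ne\phi\in W}\frac{\int_\Sigma|\nabla\phi|^2e^{-f}}{\int_\Sigma\phi^2e^{-f}},$$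 where $W$ runs over the $(m+1)$-dimensional subspaces of $C_c^\infty(\Sigma)$, be the variational (Courant–Fischer) form of the $m$-th eigenvalue. For smooth normal fields $u$ let $Lu=\mathcal L u+\tfrac12u+\sum_{k,\ell}\langle u,A_{k\ell}\rangle A_{k\ell}$, where $\mathcal L u=\Delta^{\perp}u-\tfrac12\nabla^{\perp}_{x^T}u$, and for compactly supported $u$ let $\delta^2(u)=-(4\pi)^{-n/2}\int_\Sigma\langle u,Lu\rangle e^{-f}$ be the second variation of $F$. Call a smooth compactly supported normal field $u$ admissible if $\int_\Sigma\langle u,\mathbf H\rangle e^{-f}=0$ and $\int_\Sigma\langle u,V^{\perp}\rangle e^{-f}=0$ for all $V\in\mathbf R^N$. The shrinker is $F$-stable if $\delta^2(u)\ge0$ for all admissible $u$, and its $F$-index is the supremum of the dimensions of the finite-dimensional linear spaces of admissible fields on which $\delta^2$ is negative definite. **Theorem.** 1. If $\Sigma$ is $F$-stable and $N\ge 2n$, then $\mu_{2nN}\ge\tfrac14$ and $\hat\mu_{2nN}\ge\tfrac14$. 2. If $\Sigma$ has finite $F$-index $I$, then for every integer $k$ with $1\le k\le N-n$ $$\mu_{m}\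 \ge\ \frac{k}{2(n+k)}\quad\text{and}\quad \hat\mu_m\ \ge\ \frac{k}{2(n+k)},\qquad m=(n+k)\Bigl(N+I-\tfrac12(n+k-3)\Bigr)\in\mathbf N .$$ -/

import Mathlib

open scoped Manifold ContDiff ENNReal Topology InnerProductSpace
open MeasureTheory

noncomputable section

namespace GaussianShrinker

/-- Euclidean space `ℝ^d` with its standard inner product. -/
abbrev Euc (d : ℕ) : Type := EuclideanSpace ℝ (Fin d)

/-- The standard basis vector `E_i` of `ℝ^N`. -/
def stdVec {N : ℕ} (i : Fin N) : Euc N := EuclideanSpace.single i (1 : ℝ)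

/-- `f⁺ = (f* f)⁻¹ f*`. For injective `f` it is the left inverse of `f` that vanishes on the
orthogonal complement of the range of `f`; see `pinv_apply_self` and `apply_pinv`. -/
def pinv {n N : ℕ} (f : Euc n →L[ℝ] Euc N) : Euc N →L[ℝ] Euc n :=
  ((ContinuousLinearMap.adjoint f) ∘L f).inverse ∘L (ContinuousLinearMap.adjoint f)

theorem adjoint_comp_self_inverse {n N : ℕ} (f : Euc n →L[ℝ] Euc N) (hf : Function.Injective f)
    (v : Euc n) :
    ((ContinuousLinearMap.adjoint f) ∘L f).inverse ((ContinuousLinearMap.adjoint f) (f v)) = v := by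
  set g := (ContinuousLinearMap.adjoint f) ∘L f with hg
  have hinj : Function.Injective g := by
    rw [injective_iff_map_eq_zero]
    intro w hw
    have h1 : ⟪g w, w⟫_ℝ = ‖f w‖ ^ 2 := by
      simp [hg, ContinuousLinearMap.adjoint_inner_left]
    rw [hw, inner_zero_left] at h1
    have h2 : f w = 0 := by
      have := pow_eq_zero_iff (two_ne_zero) |>.1 h1.symm
      exact norm_eq_zero.1 this
    exact hf (by simpa using h2)
  let e : Euc n ≃L[ℝ] Euc n :=
    (LinearEquiv.ofInjectiveEndo (g : Euc n →ₗ[ℝ] Euc n) hinj).toContinuousLinearEquiv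
  have he : g = (e : Euc n →L[ℝ] Euc n) := by
    ext w
    rfl
  change g.inverse (g v) = v
  rw [he, ContinuousLinearMap.inverse_equiv]
  exact e.symm_apply_apply v

theorem pinv_apply_self {n N : ℕ} (f : Euc n →L[ℝ] Euc N) (hf : Function.Injective f)
    (v : Euc n) : pinv f (f v) = v :=
  adjoint_comp_self_inverse f hf v

theorem apply_pinv {n N : ℕ} (f : Euc n →L[ℝ] Euc N) (hf : Function.Injective f) (w : Euc N) :
    f (pinv f w) = (LinearMap.range (f : Euc n →ₗ[ℝ] Euc N)).starProjection w := by
  obtain ⟨v, hv⟩ : ∃ v, f v = (LinearMap.range (f : Euc n →ₗ[ℝ] Euc N)).starProjection w := by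
    have := Submodule.starProjection_apply_mem (LinearMap.range (f : Euc n →ₗ[ℝ] Euc N)) w
    exact this
  have h : ContinuousLinearMap.adjoint f w = ContinuousLinearMap.adjoint f (f v) := by
    refine ext_inner_right ℝ fun u => ?_
    rw [ContinuousLinearMap.adjoint_inner_left, ContinuousLinearMap.adjoint_inner_left, hv,
      ← sub_eq_zero, ← inner_sub_left]
    exact Submodule.starProjection_inner_eq_zero w _ (LinearMap.mem_range_self _ u)
  have h2 : pinv f w = v := by
    change ((ContinuousLinearMap.adjoint f) ∘L f).inverse (ContinuousLinearMap.adjoint f w) = v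
    rw [h]
    exact adjoint_comp_self_inverse f hf v
  rw [h2, hv]

section PointwiseGeometry

variable {n N : ℕ} {M : Type*} [TopologicalSpace M] [ChartedSpace (Euc n) M]

/-- The differential `dx_p : T_p M → ℝ^N` of a map `x : M → ℝ^N`. -/
def dmap (x : M → Euc N) (p : M) : Euc n →L[ℝ] Euc N :=
  mfderiv (𝓡 n) 𝓘(ℝ, Euc N) x p

/-- The tangent plane `dx_p (T_p M) ⊆ ℝ^N` of the immersed manifold at `p`. -/
def tangentPlane (x : M → Euc N) (p : M) : Submodule ℝ (Euc N) :=
  LinearMap.range (dmap (n := n) x p : Euc n →ₗ[ℝ] Euc N)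

/-- The tangential part `w^T` at `p` of a vector `w` of `ℝ^N`. -/
def tanPart (x : M → Euc N) (p : M) (w : Euc N) : Euc N :=
  (tangentPlane (n := n) x p).starProjection w

/-- The normal part `w^⊥` at `p` of a vector `w` of `ℝ^N`. -/
def norPart (x : M → Euc N) (p : M) (w : Euc N) : Euc N :=
  w - tanPart (n := n) x p w

/-- The derivative `D_{w^T} u` at `p` of a (vector valued) function `u` on `M` in the direction of
the tangential part of `w`: the tangent vector of `M` which `dx_p` maps to `w^T` is
`(dx_p)⁺ w`. -/
def tanDeriv {F : Type*} [NormedAddCommGroup F] [NormedSpace ℝ F]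
    (x : M → Euc N) (u : M → F) (w : Euc N) (p : M) : F :=
  (mfderiv (𝓡 n) 𝓘(ℝ, F) u p : Euc n →L[ℝ] F) (pinv (dmap (n := n) x p) w)

/-- The second fundamental form `A(v^T, w^T) = (D_{v^T} w^T)^⊥` at `p`, as a bilinear form on `ℝ^N`
which vanishes when one of its arguments is normal. -/
def secondFF (x : M → Euc N) (p : M) (v w : Euc N) : Euc N :=
  norPart (n := n) x p
    (tanDeriv (n := n) x (fun q => tanPart (n := n) x q w) v p)

/-- The mean curvature vector `H = - tr A`. The bilinear form `A` vanishes on normal vectors, so that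
its trace may be taken over the standard basis of `ℝ^N`. The sign is the one for which spheres
have an outward pointing `H`. -/
def meanCurv (x : M → Euc N) (p : M) : Euc N :=
  - ∑ i : Fin N, secondFF (n := n) x p (stdVec i) (stdVec i)

/-- The drift Laplacian `ℒ φ = Δ φ - (1/2) ∇_{x^T} φ` on functions. The Laplacian of the induced
metric is the divergence of the gradient, `Δ φ = ∑ i, D_{E_i^T} D_{E_i^T} φ`, because
`D_{E_i^T} φ` is the `i`-th component of `∇ φ` in `ℝ^N` and the divergence of a tangential field `Y`
is `∑ i, ⟪D_{E_i^T} Y, E_i⟫`. -/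
def driftLaplacian (x : M → Euc N) (φ : M → ℝ) (p : M) : ℝ :=
  (∑ i : Fin N, tanDeriv (n := n) x
      (fun q => tanDeriv (n := n) x φ (stdVec i) q) (stdVec i) p)
    - (1 / 2 : ℝ) * tanDeriv (n := n) x φ (x p) p

/-- `|∇ φ|²` for the induced metric. -/
def gradSq (x : M → Euc N) (φ : M → ℝ) (p : M) : ℝ :=
  ∑ i : Fin N, (tanDeriv (n := n) x φ (stdVec i) p) ^ 2

/-- The normal connection `∇^⊥_{w^T} u = (D_{w^T} u)^⊥` on normal fields `u`. -/
def norDeriv (x : M → Euc N) (u : M → Euc N) (w : Euc N) (p : M) : Euc N :=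
  norPart (n := n) x p (tanDeriv (n := n) x u w p)

/-- The drift Laplacian `ℒ u = Δ^⊥ u - (1/2) ∇^⊥_{x^T} u` on normal fields. Here
`Δ^⊥ u = ∑ i, ∇^⊥_{E_i^T} ∇^⊥_{E_i^T} u`; this is the trace of the second covariant derivative of
`u`, because `∑ i, (D_{E_i^T} E_i^T)^T = 0`. -/
def normalDriftLaplacian (x : M → Euc N) (u : M → Euc N) (p : M) : Euc N :=
  (∑ i : Fin N, norDeriv (n := n) x
      (fun q => norDeriv (n := n) x u (stdVec i) q) (stdVec i) p)
    - (1 / 2 : ℝ) • norDeriv (n := n) x u (x p) p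

/-- The second variation operator `L u = ℒ u + u / 2 + ∑ ⟪u, A_kl⟫ A_kl` on normal fields. The last
sum does not depend on the orthonormal basis of `ℝ^N`. -/
def jacobiOp (x : M → Euc N) (u : M → Euc N) (p : M) : Euc N :=
  normalDriftLaplacian (n := n) x u p + (1 / 2 : ℝ) • u p
    + ∑ i : Fin N, ∑ j : Fin N,
        ⟪u p, secondFF (n := n) x p (stdVec i) (stdVec j)⟫_ℝ •
          secondFF (n := n) x p (stdVec i) (stdVec j)

/-- `x : M → ℝ^N` is an immersed shrinker: a smooth immersion with `H = x^⊥ / 2`. -/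
structure IsShrinker (x : M → Euc N) : Prop where
  smooth : ContMDiff (𝓡 n) 𝓘(ℝ, Euc N) ∞ x
  immersive : ∀ p : M, Function.Injective (dmap (n := n) x p)
  equation : ∀ p : M, meanCurv (n := n) x p = (1 / 2 : ℝ) • norPart (n := n) x p (x p)

/-- The distance on `M` of the induced metric: the infimum of the lengths of `C¹` paths, where a
tangent vector `v` at `p` has length `|dx_p v|`. -/
def intrinsicEDist (x : M → Euc N) (p q : M) : ℝ≥0∞ :=
  letI : ∀ r : M, ENorm (TangentSpace (𝓡 n) r) := fun r => ⟨fun v => ‖dmap (n := n) x r v‖ₑ⟩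
  Manifold.riemannianEDist (𝓡 n) p q

/-- The induced metric is complete: its Cauchy sequences converge in `M`. -/
def IsCompleteImm (x : M → Euc N) : Prop :=
  ∀ a : ℕ → M,
    (∀ ε : ℝ≥0∞, 0 < ε → ∃ K : ℕ, ∀ i ≥ K, ∀ j ≥ K, intrinsicEDist (n := n) x (a i) (a j) < ε) →
      ∃ p : M, Filter.Tendsto a Filter.atTop (𝓝 p)

end PointwiseGeometry

section Integration

variable {n N : ℕ} {M : Type*} [TopologicalSpace M] [ChartedSpace (Euc n) M]
  [MeasurableSpace M] [BorelSpace M]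

/-- The volume density `√(det ⟪∂_i X, ∂_j X⟫)` of `X = x ∘ e⁻¹` in a chart `e`. -/
def chartDensity (x : M → Euc N) (e : OpenPartialHomeomorph M (Euc n)) (y : Euc n) : ℝ :=
  Real.sqrt (Matrix.det (Matrix.of fun i j : Fin n =>
    ⟪fderiv ℝ (x ∘ e.symm) y (stdVec i), fderiv ℝ (x ∘ e.symm) y (stdVec j)⟫_ℝ))

/-- The Riemannian volume of the induced metric on the domain of a chart `e`, extended by zero. -/
def chartVolume (x : M → Euc N) (e : OpenPartialHomeomorph M (Euc n)) : Measure M :=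
  (((volume : Measure (Euc n)).restrict e.target).withDensity
    (fun y => ENNReal.ofReal (chartDensity x e y))).map e.symm

/-- The Riemannian volume measure of the induced metric: the smallest measure on `M` that dominates
the Riemannian volumes of the domains of the charts. (The latter agree on overlaps, and countably
many charts cover `M`, so this is the measure which restricts to `√(det g) dy` in each chart.) -/
def riemVolume (x : M → Euc N) : Measure M :=
  ⨆ p : M, chartVolume x (chartAt (Euc n) p)

/-- The normalized Gaussian measure `(4π)^{-n/2} e^{-|x|²/4} dvol` on `M`. -/
def gaussMeasure (x : M → Euc N) : Measure M :=
  (riemVolume (n := n) x).withDensity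
    (fun p => ENNReal.ofReal ((4 * Real.pi) ^ (-(n : ℝ) / 2) * Real.exp (-‖x p‖ ^ 2 / 4)))

/-- The Gaussian area `F`. -/
def gaussArea (x : M → Euc N) : ℝ≥0∞ := gaussMeasure (n := n) x Set.univ

/-- The entropy: the supremum of `F(c Σ + x₀)` over all `c > 0` and `x₀ ∈ ℝ^N`. -/
def entropy (x : M → Euc N) : ℝ≥0∞ :=
  ⨆ (c : ℝ) (_ : 0 < c) (x₀ : Euc N), gaussArea (n := n) (fun p => c • x p + x₀)

/-- The second variation `δ²(u) = -(4π)^{-n/2} ∫ ⟪u, L u⟫ e^{-|x|²/4}` of `F`. -/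
def secondVariation (x : M → Euc N) (u : M → Euc N) : ℝ :=
  - ∫ p, ⟪u p, jacobiOp (n := n) x u p⟫_ℝ ∂(gaussMeasure (n := n) x)

/-- The smooth compactly supported normal fields which are orthogonal, in the Gaussian `L²` inner
product, to `H` and to all translations `V^⊥`, `V ∈ ℝ^N`. -/
structure IsAllowable (x : M → Euc N) (u : M → Euc N) : Prop where
  smooth : ContMDiff (𝓡 n) 𝓘(ℝ, Euc N) ∞ u
  compact : HasCompactSupport u
  normal : ∀ p : M, tanPart (n := n) x p (u p) = 0
  orth_meanCurv : ∫ p, ⟪u p, meanCurv (n := n) x p⟫_ℝ ∂(gaussMeasure (n := n) x) = 0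
  orth_translation : ∀ V : Euc N,
    ∫ p, ⟪u p, norPart (n := n) x p V⟫_ℝ ∂(gaussMeasure (n := n) x) = 0

/-- `F`-stability: the second variation is nonnegative perpendicular to `H` and to translations. -/
def FStable (x : M → Euc N) : Prop :=
  ∀ u : M → Euc N, IsAllowable (n := n) x u → 0 ≤ secondVariation (n := n) x u

/-- A finite-dimensional space of normal fields, perpendicular to `H` and to translations, on which
the second variation is negative definite. -/
structure IsNegativeSpace (x : M → Euc N) (W : Submodule ℝ (M → Euc N)) : Prop where
  finite : FiniteDimensional ℝ W
  allowable : ∀ u ∈ W, IsAllowable (n := n) x u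
  negative : ∀ u ∈ W, u ≠ 0 → secondVariation (n := n) x u < 0

/-- The `F`-index: the largest dimension (possibly infinite) of a space of normal fields,
perpendicular to `H` and to translations, on which the second variation is negative definite. -/
def FIndex (x : M → Euc N) : ℕ∞ :=
  ⨆ (W : Submodule ℝ (M → Euc N)) (_ : IsNegativeSpace (n := n) x W),
    ((Module.finrank ℝ W : ℕ) : ℕ∞)

/-- `φ` is a (smooth) Gaussian `L²` solution of `ℒ φ + μ φ = 0`. -/
structure IsEigenfunction (x : M → Euc N) (μ : ℝ) (φ : M → ℝ) : Prop where
  smooth : ContMDiff (𝓡 n) 𝓘(ℝ, ℝ) ∞ φ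
  memLp : MemLp φ 2 (gaussMeasure (n := n) x)
  equation : ∀ p : M, driftLaplacian (n := n) x φ p + μ * φ p = 0

/-- The `m`-th eigenvalue `μ_m` (`m = 0, 1, 2, …`) of the drift Laplacian, counted with multiplicity:
the smallest `c` for which there are `m + 1` linearly independent `L²` eigenfunctions with
eigenvalues at most `c`. -/
def driftEigenvalue (x : M → Euc N) (m : ℕ) : EReal :=
  ⨅ (c : ℝ) (_ : ∃ (ν : Fin (m + 1) → ℝ) (φ : Fin (m + 1) → M → ℝ),
      LinearIndependent ℝ φ ∧ ∀ i, ν i ≤ c ∧ IsEigenfunction (n := n) x (ν i) (φ i)),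
    (c : EReal)

/-- The `m`-th Courant-Fischer (min-max) value of the drift Laplacian (`m = 0, 1, 2, …`): the
infimum over all `(m + 1)`-dimensional spaces of smooth compactly supported functions of the largest
Rayleigh quotient `∫ |∇ φ|² e^{-f} / ∫ φ² e^{-f}` in the space. -/
def driftMinMax (x : M → Euc N) (m : ℕ) : EReal :=
  ⨅ (W : Submodule ℝ (M → ℝ)) (_ : Module.finrank ℝ W = m + 1)
    (_ : ∀ φ ∈ W, ContMDiff (𝓡 n) 𝓘(ℝ, ℝ) ∞ φ ∧ HasCompactSupport φ),
    ⨆ (φ : M → ℝ) (_ : φ ∈ W) (_ : φ ≠ 0),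
      (((∫ p, gradSq (n := n) x φ p ∂(gaussMeasure (n := n) x)) /
        (∫ p, (φ p) ^ 2 ∂(gaussMeasure (n := n) x)) : ℝ) : EReal)

end Integration

end GaussianShrinker

end

open scoped Manifold ContDiff ENNReal Topology InnerProductSpace
open MeasureTheory
set_option linter.unusedSectionVars false

noncomputable section

/-! The test fields are `φ V^⊥`, with `V` a constant vector of `ℝ^N` and `φ` a compactly supported
function. On a shrinker the translation fields satisfy `L V^⊥ = V^⊥ / 2` (`norPart_lapProj`, a
consequence of the traced Codazzi equation and of `H = x^⊥ / 2`). Green's formula for the Gaussian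
measure then gives `δ²(φ V^⊥) = ∫ (|∇φ|² - φ²/2) |V^⊥|²` (`secondVariation_smul_norPart`). Take `V =
E_j` for the first `K = n + k` basis vectors. The trace of the tangential projection is `n`, so `k ≤
∑ |E_j^⊥|² ≤ n + k` pointwise. If all `K` second variations are nonnegative, summation gives `(n +
k) ∫ |∇φ|² ≥ (k/2) ∫ φ²`, which is the Rayleigh bound `k / (2(n + k))`.

Nonnegativity is bought with finitely many linear conditions on `φ` (`exists_constraints`).
Orthogonality to translations asks that `∫ φ ⟪E_j^⊥, E_i⟫ = 0`; this is symmetric in `i` and `j`, so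
`K N - K (K - 1) / 2` conditions suffice. Orthogonality to `H` costs `K` more. Orthogonality, for
the second variation form, to a maximal negative space of dimension `I` costs `K I`, and forces
nonnegativity because otherwise that space could be enlarged. The total is `K (N + I - (K - 3) / 2)
= m`.

A Rayleigh bound under at most `m` linear conditions bounds the min-max value of index `m` by
counting dimensions (`le_driftMinMax`). For `L²` eigenfunctions the conditions do not apply
directly, as they are defined on compactly supported functions. So linear combinations are truncated
by cutoffs with gradients tending to zero, and a limit of normalized coefficients is taken
(`le_driftEigenvalue`). Such cutoffs exist by completeness: the supremum of the compactly supported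
functions with gradient at most one must be infinite, by Ekeland's principle and a local gluing
(`cutoffSup_eq_top`).

For stable shrinkers `I = 0` and `k = n` give the value `1/4`, and the count is at most `2nN` when
`n ≥ 2`. It is one too large when `n = 1`. A curve, however, has a parallel unit normal `ν`
(`exists_parallel_normal`), and the fields `φ ν` give the bound `1/2` with only `N + 1` conditions.

Throughout, calculus is extrinsic: with `P` the projection onto the tangent plane, everything is
expressed by derivatives `D_{w^T}` for constant `w` and by the derivative `dproj` of `P`. -/

namespace GaussianShrinker

/-! ### Pseudo-inverses and traces over the standard basis -/

section LinearAlgebra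

variable {n N : ℕ}

/-- The injective `f` sends both sides to the orthogonal projection of `w` onto the common range of
`f` and `f ∘L T`. This is why tangential derivatives can be computed in any chart. -/
theorem pinv_comp_equiv (f : Euc n →L[ℝ] Euc N) (hf : Function.Injective f)
    (T : Euc n ≃L[ℝ] Euc n) (w : Euc N) :
    T (pinv (f ∘L (T : Euc n →L[ℝ] Euc n)) w) = pinv f w := by
  have hfT : Function.Injective (f ∘L (T : Euc n →L[ℝ] Euc n)) := hf.comp T.injective
  apply hf
  have h1 := apply_pinv _ hfT w
  have h2 : LinearMap.range ((f ∘L (T : Euc n →L[ℝ] Euc n) : Euc n →L[ℝ] Euc N) :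
      Euc n →ₗ[ℝ] Euc N) = LinearMap.range (f : Euc n →ₗ[ℝ] Euc N) := by
    ext v
    constructor
    · rintro ⟨u, rfl⟩
      exact ⟨T u, rfl⟩
    · rintro ⟨u, rfl⟩
      exact ⟨T.symm u, by simp⟩
  rw [apply_pinv _ hf w]
  simp only [h2] at h1
  exact h1

/-- The adjoint as a real-linear continuous map. -/
def adjointCLM (n N : ℕ) : (Euc n →L[ℝ] Euc N) →L[ℝ] (Euc N →L[ℝ] Euc n) :=
  LinearMap.toContinuousLinearMap
    { toFun := fun f => ContinuousLinearMap.adjoint f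
      map_add' := fun f g => map_add _ f g
      map_smul' := fun c f => by simp }

/-- The Gram operator `f* f` of an injective map as a continuous linear equivalence. -/
theorem exists_gram_equiv (f : Euc n →L[ℝ] Euc N) (hf : Function.Injective f) :
    ∃ e : Euc n ≃L[ℝ] Euc n, (e : Euc n →L[ℝ] Euc n) = (ContinuousLinearMap.adjoint f) ∘L f := by
  have hinj : Function.Injective ((ContinuousLinearMap.adjoint f) ∘L f) := by
    intro v w hvw
    have h1 := adjoint_comp_self_inverse f hf v
    have h2 := adjoint_comp_self_inverse f hf w
    have h3 : (ContinuousLinearMap.adjoint f) (f v) = (ContinuousLinearMap.adjoint f) (f w) := hvw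
    rw [h3, h2] at h1
    exact h1.symm
  exact ⟨(LinearEquiv.ofInjectiveEndo (((ContinuousLinearMap.adjoint f) ∘L f :
    Euc n →L[ℝ] Euc n) : Euc n →ₗ[ℝ] Euc n) hinj).toContinuousLinearEquiv, by ext v; rfl⟩

/-- Inversion is smooth at invertible operators, and `f* f` is invertible for injective `f`. The
smoothness of `proj` and of all tangential derivatives rests on this. -/
theorem contDiffAt_pinv (f : Euc n →L[ℝ] Euc N) (hf : Function.Injective f) :
    ContDiffAt ℝ ∞ (pinv : (Euc n →L[ℝ] Euc N) → (Euc N →L[ℝ] Euc n)) f := by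
  obtain ⟨e, he⟩ := exists_gram_equiv f hf
  have h1 : ContDiffAt ℝ ∞ (fun g : Euc n →L[ℝ] Euc N => adjointCLM n N g ∘L g) f :=
    (adjointCLM n N).contDiff.contDiffAt.clm_comp contDiffAt_id
  have h2 : ContDiffAt ℝ ∞ (ContinuousLinearMap.inverse : (Euc n →L[ℝ] Euc n) → _)
      (adjointCLM n N f ∘L f) := by
    have := contDiffAt_map_inverse (𝕜 := ℝ) (n := ∞) e
    rw [he] at this
    exact this
  have h3 : ContDiffAt ℝ ∞ (fun g : Euc n →L[ℝ] Euc N => (adjointCLM n N g ∘L g).inverse) f :=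
    ContDiffAt.comp (g := ContinuousLinearMap.inverse) f h2 h1
  exact h3.clm_comp (adjointCLM n N).contDiff.contDiffAt

theorem stdVec_sum (w : Euc N) : ∑ i, w i • stdVec i = w := by
  have := (EuclideanSpace.basisFun (Fin N) ℝ).sum_repr w
  simpa [stdVec] using this

theorem inner_stdVec (i : Fin N) (w : Euc N) : ⟪stdVec i, w⟫_ℝ = w i := by
  simp [stdVec, EuclideanSpace.inner_single_left]

theorem inner_stdVec_right (i : Fin N) (w : Euc N) : ⟪w, stdVec i⟫_ℝ = w i := by
  rw [real_inner_comm, inner_stdVec]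

theorem sum_inner_stdVec_smul (w : Euc N) : ∑ i, ⟪stdVec i, w⟫_ℝ • stdVec i = w := by
  simp only [inner_stdVec]
  exact stdVec_sum w

/-- A symmetric map may be moved from one slot of a trace to the other. -/
theorem sum_bilin_symm_swap {G : Type*} [AddCommGroup G] [Module ℝ G]
    (β : Euc N →ₗ[ℝ] Euc N →ₗ[ℝ] G) (S : Euc N →ₗ[ℝ] Euc N)
    (hS : ∀ v w, ⟪S v, w⟫_ℝ = ⟪v, S w⟫_ℝ) :
    ∑ i, β (S (stdVec i)) (stdVec i) = ∑ i, β (stdVec i) (S (stdVec i)) := by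
  have h1 : ∀ i, β (S (stdVec i)) (stdVec i) =
      ∑ j, ⟪stdVec j, S (stdVec i)⟫_ℝ • β (stdVec j) (stdVec i) := by
    intro i
    conv_lhs => rw [← sum_inner_stdVec_smul (S (stdVec i))]
    simp
  have h2 : ∀ i, β (stdVec i) (S (stdVec i)) =
      ∑ j, ⟪stdVec j, S (stdVec i)⟫_ℝ • β (stdVec i) (stdVec j) := by
    intro i
    conv_lhs => rw [← sum_inner_stdVec_smul (S (stdVec i))]
    simp
  simp_rw [h1, h2]
  rw [Finset.sum_comm]
  refine Finset.sum_congr rfl fun i _ => Finset.sum_congr rfl fun j _ => ?_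
  rw [← hS, real_inner_comm]

end LinearAlgebra

/-! ### Tangential derivatives read in charts -/

section Chart

variable {n N : ℕ} {M : Type*} [TopologicalSpace M] [ChartedSpace (Euc n) M]
variable [IsManifold (𝓡 n) ∞ M]
variable {F : Type*} [NormedAddCommGroup F] [NormedSpace ℝ F]

/-- The factor `T` is the differential of the chart and does not depend on `u`, so it cancels when
`u` is differentiated along a vector given through `dx`. -/
theorem mfderiv_eq_chart {u : M → F} {p : M} (q : M) (hp : p ∈ (chartAt (Euc n) q).source)
    (hu : MDifferentiableAt (𝓡 n) 𝓘(ℝ, F) u p) :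
    ∃ T : Euc n ≃L[ℝ] Euc n,
      (T : Euc n →L[ℝ] Euc n) = mfderiv (𝓡 n) (𝓡 n) (chartAt (Euc n) q) p ∧
      (mfderiv (𝓡 n) 𝓘(ℝ, F) u p : Euc n →L[ℝ] F) =
        fderiv ℝ (u ∘ (chartAt (Euc n) q).symm) (chartAt (Euc n) q p) ∘L
          (T : Euc n →L[ℝ] Euc n) := by
  set e := chartAt (Euc n) q with he
  have : IsManifold (𝓡 n) 1 M := IsManifold.of_le (n := ∞) (by exact_mod_cast le_top)
  have hd : e.MDifferentiable (𝓡 n) (𝓡 n) := mdifferentiable_chart q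
  refine ⟨hd.mfderiv hp, rfl, ?_⟩
  have h1 : MDifferentiableAt (𝓡 n) 𝓘(ℝ, F) (u ∘ e.symm) (e p) := by
    refine MDifferentiableAt.comp (I' := 𝓡 n) (e p) ?_ (hd.mdifferentiableAt_symm (e.map_source hp))
    rw [e.left_inv hp]; exact hu
  have h2 : u =ᶠ[𝓝 p] (u ∘ e.symm) ∘ e := by
    filter_upwards [e.open_source.mem_nhds hp] with r hr
    simp [e.left_inv hr]
  rw [h2.mfderiv_eq, mfderiv_comp p h1 (hd.mdifferentiableAt hp), mfderiv_eq_fderiv]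
  rfl

variable {x : M → Euc N}

/-- The map `x` read in a chart around `q`. -/
abbrev chartRep {G : Type*} (u : M → G) (q : M) : Euc n → G := u ∘ (chartAt (Euc n) q).symm

theorem contDiffOn_chartRep {u : M → F} (hu : ContMDiff (𝓡 n) 𝓘(ℝ, F) ∞ u) (q : M) :
    ContDiffOn ℝ ∞ (chartRep (n := n) u q) (chartAt (Euc n) q).target := by
  rw [← contMDiffOn_iff_contDiffOn]
  exact hu.comp_contMDiffOn (contMDiffOn_chart_symm (I := 𝓡 n) (n := ∞))

theorem contDiffAt_chartRep {u : M → F} (hu : ContMDiff (𝓡 n) 𝓘(ℝ, F) ∞ u) (q : M) {y : Euc n}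
    (hy : y ∈ (chartAt (Euc n) q).target) : ContDiffAt ℝ ∞ (chartRep (n := n) u q) y :=
  (contDiffOn_chartRep hu q).contDiffAt ((chartAt (Euc n) q).open_target.mem_nhds hy)

theorem contMDiff_of_chartRep {u : M → F}
    (h : ∀ q, ContDiffAt ℝ ∞ (chartRep (n := n) u q) (chartAt (Euc n) q q)) :
    ContMDiff (𝓡 n) 𝓘(ℝ, F) ∞ u := by
  intro q
  set e := chartAt (Euc n) q with he
  have h1 : ContMDiffAt (𝓡 n) 𝓘(ℝ, F) ∞ (chartRep (n := n) u q ∘ e) q :=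
    ContMDiffAt.comp (I' := 𝓡 n) q (h q).contMDiffAt
      ((contMDiffOn_chart (I := 𝓡 n) (n := ∞)).contMDiffAt
        (e.open_source.mem_nhds (mem_chart_source _ q)))
  refine h1.congr_of_eventuallyEq ?_
  filter_upwards [e.open_source.mem_nhds (mem_chart_source _ q)] with r hr
  simp [e, (chartAt (Euc n) q).left_inv hr]

theorem mdiffAt_of_contMDiff {u : M → F} (hu : ContMDiff (𝓡 n) 𝓘(ℝ, F) ∞ u) (p : M) :
    MDifferentiableAt (𝓡 n) 𝓘(ℝ, F) u p := (hu p).mdifferentiableAt (by simp)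

/-- The structure of a smooth immersion. -/
structure IsImm (x : M → Euc N) : Prop where
  smooth : ContMDiff (𝓡 n) 𝓘(ℝ, Euc N) ∞ x
  immersive : ∀ p : M, Function.Injective (dmap (n := n) x p)

theorem IsShrinker.isImm (hx : IsShrinker (n := n) x) : IsImm (n := n) x :=
  ⟨hx.smooth, hx.immersive⟩

theorem IsImm.injective_chart (hx : IsImm (n := n) x) {p : M} (q : M)
    (hp : p ∈ (chartAt (Euc n) q).source) :
    Function.Injective (fderiv ℝ (chartRep (n := n) x q) (chartAt (Euc n) q p)) := by
  obtain ⟨T, -, hT⟩ := mfderiv_eq_chart q hp (mdiffAt_of_contMDiff hx.smooth p)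
  have h := hx.immersive p
  unfold dmap at h
  intro v w hvw
  have h3 : T.symm v = T.symm w := by
    apply h
    rw [hT]
    simpa using hvw
  exact T.symm.injective h3

theorem IsImm.injective_chart' (hx : IsImm (n := n) x) (q : M) {y : Euc n}
    (hy : y ∈ (chartAt (Euc n) q).target) :
    Function.Injective (fderiv ℝ (chartRep (n := n) x q) y) := by
  have := hx.injective_chart q ((chartAt (Euc n) q).map_target hy)
  rwa [(chartAt (Euc n) q).right_inv hy] at this

/-- The tangential derivative computed in an arbitrary chart. -/
theorem IsImm.tanDeriv_chart (hx : IsImm (n := n) x) {u : M → F} {p : M}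
    (hu : MDifferentiableAt (𝓡 n) 𝓘(ℝ, F) u p) (q : M)
    (hp : p ∈ (chartAt (Euc n) q).source) (w : Euc N) :
    tanDeriv (n := n) x u w p = fderiv ℝ (chartRep (n := n) u q) (chartAt (Euc n) q p)
      (pinv (fderiv ℝ (chartRep (n := n) x q) (chartAt (Euc n) q p)) w) := by
  obtain ⟨T, hT', hT⟩ := mfderiv_eq_chart q hp (mdiffAt_of_contMDiff hx.smooth p)
  obtain ⟨T₂, hT₂', hT₂⟩ := mfderiv_eq_chart q hp hu
  have hTT : T₂ = T := by
    apply ContinuousLinearEquiv.ext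
    funext v
    have : (T₂ : Euc n →L[ℝ] Euc n) v = (T : Euc n →L[ℝ] Euc n) v := by rw [hT', hT₂']
    exact this
  subst hTT
  unfold tanDeriv dmap
  rw [hT₂, hT]
  change fderiv ℝ _ _ (T₂ _) = _
  rw [pinv_comp_equiv _ (hx.injective_chart q hp)]

theorem IsImm.tanDeriv_chartRep (hx : IsImm (n := n) x) {u : M → F}
    (hu : ContMDiff (𝓡 n) 𝓘(ℝ, F) ∞ u) (q : M) (w : Euc N) {y : Euc n}
    (hy : y ∈ (chartAt (Euc n) q).target) :
    chartRep (n := n) (tanDeriv (n := n) x u w) q y = fderiv ℝ (chartRep (n := n) u q) y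
      (pinv (fderiv ℝ (chartRep (n := n) x q) y) w) := by
  have := hx.tanDeriv_chart (mdiffAt_of_contMDiff hu _) q ((chartAt (Euc n) q).map_target hy) w
  rwa [(chartAt (Euc n) q).right_inv hy] at this

end Chart


/-! ### First-order calculus of the tangential projection -/

section Calculus

variable {n N : ℕ} {M : Type*} [TopologicalSpace M] [ChartedSpace (Euc n) M]
variable [IsManifold (𝓡 n) ∞ M]
variable {F G H : Type*} [NormedAddCommGroup F] [NormedSpace ℝ F]
  [NormedAddCommGroup G] [NormedSpace ℝ G] [NormedAddCommGroup H] [NormedSpace ℝ H]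

/-- Smoothness of a vector valued function. -/
abbrev Smooth (n : ℕ) {M : Type*} [TopologicalSpace M] [ChartedSpace (Euc n) M]
    {F : Type*} [NormedAddCommGroup F] [NormedSpace ℝ F] (u : M → F) : Prop :=
  ContMDiff (𝓡 n) 𝓘(ℝ, F) ∞ u

theorem Smooth.comp_contDiff {u : M → F} (hu : Smooth n u) {g : F → G} (hg : ContDiff ℝ ∞ g) :
    Smooth n (fun p => g (u p)) :=
  hg.contMDiff.comp hu

theorem Smooth.clm {u : M → F} (hu : Smooth n u) (A : F →L[ℝ] G) : Smooth n (fun p => A (u p)) :=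
  hu.comp_contDiff A.contDiff

theorem Smooth.bilin {u : M → F} {v : M → G} (hu : Smooth n u) (hv : Smooth n v)
    (B : F →L[ℝ] G →L[ℝ] H) : Smooth n (fun p => B (u p) (v p)) :=
  (B.isBoundedBilinearMap.contDiff).contMDiff.comp (hu.prodMk_space hv)

theorem Smooth.inner {u v : M → Euc N} (hu : Smooth n u) (hv : Smooth n v) :
    Smooth n (fun p => ⟪u p, v p⟫_ℝ) :=
  hu.bilin hv (innerSL ℝ)

theorem Smooth.mul {u v : M → ℝ} (hu : Smooth n u) (hv : Smooth n v) :
    Smooth n (fun p => u p * v p) :=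
  hu.bilin hv (ContinuousLinearMap.mul ℝ ℝ)

theorem Smooth.smul {u : M → ℝ} {v : M → F} (hu : Smooth n u) (hv : Smooth n v) :
    Smooth n (fun p => u p • v p) :=
  hu.bilin hv (ContinuousLinearMap.lsmul ℝ ℝ)

theorem Smooth.clm_apply {A : M → F →L[ℝ] G} {v : M → F} (hA : Smooth n A) (hv : Smooth n v) :
    Smooth n (fun p => A p (v p)) :=
  hA.bilin hv (ContinuousLinearMap.id ℝ (F →L[ℝ] G))

theorem Smooth.sum {ι : Type*} {u : ι → M → F} {s : Finset ι} (hu : ∀ i ∈ s, Smooth n (u i)) :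
    Smooth n (fun p => ∑ i ∈ s, u i p) :=
  contMDiff_finsetSum hu

theorem Smooth.coord {u : M → Euc N} (hu : Smooth n u) (i : Fin N) : Smooth n (fun p => u p i) :=
  hu.clm (EuclideanSpace.proj i)

variable {x : M → Euc N}

/-- The orthogonal projection of `ℝ^N` onto the tangent plane. -/
def proj (x : M → Euc N) (p : M) : Euc N →L[ℝ] Euc N := (tangentPlane (n := n) x p).starProjection

theorem tanPart_eq (p : M) (w : Euc N) : tanPart (n := n) x p w = proj (n := n) x p w := rfl

theorem norPart_eq (p : M) (w : Euc N) : norPart (n := n) x p w = w - proj (n := n) x p w := rfl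

theorem proj_proj (p : M) (w : Euc N) :
    proj (n := n) x p (proj (n := n) x p w) = proj (n := n) x p w :=
  Submodule.starProjection_eq_self_iff.2 (Submodule.starProjection_apply_mem _ _)

theorem inner_proj (p : M) (v w : Euc N) :
    ⟪proj (n := n) x p v, w⟫_ℝ = ⟪v, proj (n := n) x p w⟫_ℝ :=
  Submodule.inner_starProjection_left_eq_right _ v w

theorem norm_proj_le (p : M) (w : Euc N) : ‖proj (n := n) x p w‖ ≤ ‖w‖ :=
  Submodule.norm_starProjection_apply_le _ w

theorem proj_sub_proj (p : M) (w : Euc N) :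
    proj (n := n) x p (w - proj (n := n) x p w) = 0 := by
  rw [map_sub, proj_proj, sub_self]

theorem norPart_norPart (p : M) (w : Euc N) :
    norPart (n := n) x p (norPart (n := n) x p w) = norPart (n := n) x p w := by
  simp [norPart_eq, proj_proj]

theorem inner_norPart (p : M) (v w : Euc N) :
    ⟪norPart (n := n) x p v, w⟫_ℝ = ⟪v, norPart (n := n) x p w⟫_ℝ := by
  simp only [norPart_eq, inner_sub_left, inner_sub_right, inner_proj]

/-- `apply_pinv` writes the projection as `f ∘ f⁺`, and the change from `dx` to the chart
differential cancels by `pinv_comp_equiv`. -/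
theorem proj_chart (hx : IsImm (n := n) x) {p : M} (q : M)
    (hp : p ∈ (chartAt (Euc n) q).source) :
    proj (n := n) x p = fderiv ℝ (chartRep (n := n) x q) (chartAt (Euc n) q p) ∘L
      pinv (fderiv ℝ (chartRep (n := n) x q) (chartAt (Euc n) q p)) := by
  obtain ⟨T, hT', hT⟩ := mfderiv_eq_chart q hp (mdiffAt_of_contMDiff hx.smooth p)
  have hd : dmap (n := n) x p = fderiv ℝ (chartRep (n := n) x q) (chartAt (Euc n) q p) ∘L
      (T : Euc n →L[ℝ] Euc n) := hT
  ext1 w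
  have h1 := apply_pinv (dmap (n := n) x p) (hx.immersive p) w
  have h2 : proj (n := n) x p w = dmap (n := n) x p (pinv (dmap (n := n) x p) w) := h1.symm
  rw [h2]
  rw [hd]
  simp only [ContinuousLinearMap.comp_apply, ContinuousLinearEquiv.coe_coe]
  rw [pinv_comp_equiv _ (hx.injective_chart q hp)]

theorem contDiffAt_fderiv_chartRep {u : M → F} (hu : Smooth n u) (q : M) {y : Euc n}
    (hy : y ∈ (chartAt (Euc n) q).target) :
    ContDiffAt ℝ ∞ (fderiv ℝ (chartRep (n := n) u q)) y :=
  (contDiffAt_chartRep hu q hy).fderiv_right (m := ∞) (by simp)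

theorem contDiffAt_pinv_chartRep (hx : IsImm (n := n) x) (q : M) {y : Euc n}
    (hy : y ∈ (chartAt (Euc n) q).target) :
    ContDiffAt ℝ ∞ (fun z => pinv (fderiv ℝ (chartRep (n := n) x q) z)) y :=
  (contDiffAt_pinv _ (hx.injective_chart' q hy)).comp y (contDiffAt_fderiv_chartRep hx.smooth q hy)

theorem eventually_mem_target (q : M) {y : Euc n} (hy : y ∈ (chartAt (Euc n) q).target) :
    ∀ᶠ z in 𝓝 y, z ∈ (chartAt (Euc n) q).target :=
  (chartAt (Euc n) q).open_target.mem_nhds hy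

theorem smooth_proj (hx : IsImm (n := n) x) : Smooth n (proj (n := n) x) := by
  refine contMDiff_of_chartRep fun q => ?_
  have hy := mem_chart_target (Euc n) q
  refine ((contDiffAt_fderiv_chartRep hx.smooth q hy).clm_comp
    (contDiffAt_pinv_chartRep hx q hy)).congr_of_eventuallyEq ?_
  filter_upwards [eventually_mem_target q hy] with z hz
  have := proj_chart hx q ((chartAt (Euc n) q).map_target hz)
  rwa [(chartAt (Euc n) q).right_inv hz] at this

theorem smooth_proj_apply (hx : IsImm (n := n) x) (w : Euc N) :
    Smooth n (fun p => proj (n := n) x p w) :=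
  (smooth_proj hx).clm_apply contMDiff_const

theorem smooth_norPart (hx : IsImm (n := n) x) {u : M → Euc N} (hu : Smooth n u) :
    Smooth n (fun p => norPart (n := n) x p (u p)) :=
  hu.sub ((smooth_proj hx).clm_apply hu)

theorem smooth_tanDeriv (hx : IsImm (n := n) x) {u : M → F} (hu : Smooth n u) (w : Euc N) :
    Smooth n (tanDeriv (n := n) x u w) := by
  refine contMDiff_of_chartRep fun q => ?_
  have hy := mem_chart_target (Euc n) q
  refine ((contDiffAt_fderiv_chartRep hu q hy).clm_apply
    ((contDiffAt_pinv_chartRep hx q hy).clm_apply (contDiffAt_const (c := w)))).congr_of_eventuallyEq ?_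
  filter_upwards [eventually_mem_target q hy] with z hz
  exact hx.tanDeriv_chartRep hu q w hz

/-- The derivative as a linear map of the direction. -/
def tanDerivL (x : M → Euc N) (u : M → F) (p : M) : Euc N →L[ℝ] F :=
  (mfderiv (𝓡 n) 𝓘(ℝ, F) u p : Euc n →L[ℝ] F) ∘L pinv (dmap (n := n) x p)

theorem tanDerivL_apply (u : M → F) (w : Euc N) (p : M) :
    tanDerivL (n := n) x u p w = tanDeriv (n := n) x u w p := rfl

theorem tanDeriv_add_right (u : M → F) (v w : Euc N) (p : M) :
    tanDeriv (n := n) x u (v + w) p = tanDeriv (n := n) x u v p + tanDeriv (n := n) x u w p := by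
  exact (tanDerivL (n := n) x u p).map_add v w

theorem tanDeriv_smul_right (u : M → F) (c : ℝ) (w : Euc N) (p : M) :
    tanDeriv (n := n) x u (c • w) p = c • tanDeriv (n := n) x u w p := by
  exact (tanDerivL (n := n) x u p).map_smul c w

theorem tanDeriv_eq_sum (u : M → F) (w : Euc N) (p : M) :
    tanDeriv (n := n) x u w p = ∑ i, w i • tanDeriv (n := n) x u (stdVec i) p := by
  conv_lhs => rw [← tanDerivL_apply, ← stdVec_sum w]
  simp [tanDerivL_apply]

theorem pinv_proj (hx : IsImm (n := n) x) (p : M) (w : Euc N) :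
    pinv (dmap (n := n) x p) (proj (n := n) x p w) = pinv (dmap (n := n) x p) w := by
  have h1 : proj (n := n) x p w = dmap (n := n) x p (pinv (dmap (n := n) x p) w) :=
    (apply_pinv (dmap (n := n) x p) (hx.immersive p) w).symm
  rw [h1, pinv_apply_self _ (hx.immersive p)]

theorem tanDeriv_proj_dir (hx : IsImm (n := n) x) (u : M → F) (w : Euc N) (p : M) :
    tanDeriv (n := n) x u (proj (n := n) x p w) p = tanDeriv (n := n) x u w p := by
  unfold tanDeriv
  rw [pinv_proj hx]

theorem tanDeriv_of_normal (hx : IsImm (n := n) x) (u : M → F) {w : Euc N} {p : M}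
    (hw : proj (n := n) x p w = 0) : tanDeriv (n := n) x u w p = 0 := by
  rw [← tanDeriv_proj_dir hx, hw]
  exact (tanDerivL (n := n) x u p).map_zero

theorem tanDeriv_self (hx : IsImm (n := n) x) (w : Euc N) (p : M) :
    tanDeriv (n := n) x x w p = proj (n := n) x p w :=
  apply_pinv (dmap (n := n) x p) (hx.immersive p) w

theorem differentiableAt_chartRep {u : M → F} (hu : Smooth n u) (q : M) {y : Euc n}
    (hy : y ∈ (chartAt (Euc n) q).target) : DifferentiableAt ℝ (chartRep (n := n) u q) y :=
  (contDiffAt_chartRep hu q hy).differentiableAt (by simp)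

theorem tanDeriv_comp (hx : IsImm (n := n) x) {u : M → F} (hu : Smooth n u) {g : F → G}
    (hg : ContDiff ℝ ∞ g) (w : Euc N) (p : M) :
    tanDeriv (n := n) x (fun q => g (u q)) w p = fderiv ℝ g (u p) (tanDeriv (n := n) x u w p) := by
  have hp := mem_chart_source (Euc n) p
  have hy := mem_chart_target (Euc n) p
  rw [hx.tanDeriv_chart (mdiffAt_of_contMDiff (hu.comp_contDiff hg) p) p hp,
    hx.tanDeriv_chart (mdiffAt_of_contMDiff hu p) p hp]
  have h1 : chartRep (n := n) (fun q => g (u q)) p = g ∘ chartRep (n := n) u p := rfl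
  have h2 : chartRep (n := n) u p (chartAt (Euc n) p p) = u p := by
    simp [chartRep, (chartAt (Euc n) p).left_inv hp]
  rw [h1, fderiv_comp _ (hg.differentiable (by simp) _) (differentiableAt_chartRep hu p hy), h2]
  rfl

theorem tanDeriv_clm (hx : IsImm (n := n) x) {u : M → F} (hu : Smooth n u) (A : F →L[ℝ] G)
    (w : Euc N) (p : M) :
    tanDeriv (n := n) x (fun q => A (u q)) w p = A (tanDeriv (n := n) x u w p) := by
  rw [tanDeriv_comp hx hu A.contDiff]
  simp

theorem tanDeriv_bilin (hx : IsImm (n := n) x) {u : M → F} {v : M → G} (hu : Smooth n u)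
    (hv : Smooth n v) (B : F →L[ℝ] G →L[ℝ] H) (w : Euc N) (p : M) :
    tanDeriv (n := n) x (fun q => B (u q) (v q)) w p =
      B (tanDeriv (n := n) x u w p) (v p) + B (u p) (tanDeriv (n := n) x v w p) := by
  have hp := mem_chart_source (Euc n) p
  have hy := mem_chart_target (Euc n) p
  rw [hx.tanDeriv_chart (mdiffAt_of_contMDiff (hu.bilin hv B) p) p hp,
    hx.tanDeriv_chart (mdiffAt_of_contMDiff hu p) p hp,
    hx.tanDeriv_chart (mdiffAt_of_contMDiff hv p) p hp]
  have h1 : chartRep (n := n) (fun q => B (u q) (v q)) p =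
    fun y => B (chartRep (n := n) u p y) (chartRep (n := n) v p y) := rfl
  have h2 : chartRep (n := n) u p (chartAt (Euc n) p p) = u p := by
    simp [chartRep, (chartAt (Euc n) p).left_inv hp]
  have h3 : chartRep (n := n) v p (chartAt (Euc n) p p) = v p := by
    simp [chartRep, (chartAt (Euc n) p).left_inv hp]
  rw [h1, ContinuousLinearMap.fderiv_of_bilinear B (differentiableAt_chartRep hu p hy)
    (differentiableAt_chartRep hv p hy), h2, h3]
  simp [add_comm]

theorem tanDeriv_mul (hx : IsImm (n := n) x) {u v : M → ℝ} (hu : Smooth n u)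
    (hv : Smooth n v) (w : Euc N) (p : M) :
    tanDeriv (n := n) x (fun q => u q * v q) w p =
      tanDeriv (n := n) x u w p * v p + u p * tanDeriv (n := n) x v w p :=
  tanDeriv_bilin hx hu hv (ContinuousLinearMap.mul ℝ ℝ) w p

theorem tanDeriv_smul (hx : IsImm (n := n) x) {u : M → ℝ} {v : M → F} (hu : Smooth n u)
    (hv : Smooth n v) (w : Euc N) (p : M) :
    tanDeriv (n := n) x (fun q => u q • v q) w p =
      tanDeriv (n := n) x u w p • v p + u p • tanDeriv (n := n) x v w p :=
  tanDeriv_bilin hx hu hv (ContinuousLinearMap.lsmul ℝ ℝ) w p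

theorem tanDeriv_inner (hx : IsImm (n := n) x) {u v : M → Euc N} (hu : Smooth n u)
    (hv : Smooth n v) (w : Euc N) (p : M) :
    tanDeriv (n := n) x (fun q => ⟪u q, v q⟫_ℝ) w p =
      ⟪tanDeriv (n := n) x u w p, v p⟫_ℝ + ⟪u p, tanDeriv (n := n) x v w p⟫_ℝ :=
  tanDeriv_bilin hx hu hv (innerSL ℝ) w p

theorem tanDeriv_clm_apply (hx : IsImm (n := n) x) {A : M → F →L[ℝ] G} {v : M → F}
    (hA : Smooth n A) (hv : Smooth n v) (w : Euc N) (p : M) :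
    tanDeriv (n := n) x (fun q => A q (v q)) w p =
      tanDeriv (n := n) x A w p (v p) + A p (tanDeriv (n := n) x v w p) :=
  tanDeriv_bilin hx hA hv (ContinuousLinearMap.id ℝ (F →L[ℝ] G)) w p

theorem tanDeriv_const (c : F) (w : Euc N) (p : M) :
    tanDeriv (n := n) x (fun _ => c) w p = 0 := by
  simp only [tanDeriv, mfderiv_const]
  rfl

theorem tanDeriv_add {u v : M → F} (hu : Smooth n u) (hv : Smooth n v) (w : Euc N) (p : M) :
    tanDeriv (n := n) x (fun q => u q + v q) w p =
      tanDeriv (n := n) x u w p + tanDeriv (n := n) x v w p := by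
  have := mfderiv_add (mdiffAt_of_contMDiff hu p) (mdiffAt_of_contMDiff hv p)
  simp only [tanDeriv]
  change (mfderiv (𝓡 n) 𝓘(ℝ, F) (u + v) p : Euc n →L[ℝ] F) _ = _
  rw [this]
  rfl

theorem tanDeriv_sub {u v : M → F} (hu : Smooth n u) (hv : Smooth n v) (w : Euc N) (p : M) :
    tanDeriv (n := n) x (fun q => u q - v q) w p =
      tanDeriv (n := n) x u w p - tanDeriv (n := n) x v w p := by
  have := mfderiv_sub (mdiffAt_of_contMDiff hu p) (mdiffAt_of_contMDiff hv p)
  simp only [tanDeriv]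
  change (mfderiv (𝓡 n) 𝓘(ℝ, F) (u - v) p : Euc n →L[ℝ] F) _ = _
  rw [this]
  rfl

theorem tanDeriv_const_smul (hx : IsImm (n := n) x) {u : M → F} (hu : Smooth n u) (c : ℝ)
    (w : Euc N) (p : M) :
    tanDeriv (n := n) x (fun q => c • u q) w p = c • tanDeriv (n := n) x u w p := by
  exact tanDeriv_clm hx hu (c • ContinuousLinearMap.id ℝ F) w p

theorem tanDeriv_sum {ι : Type*} {u : ι → M → F} (s : Finset ι)
    (hu : ∀ i ∈ s, Smooth n (u i)) (w : Euc N) (p : M) :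
    tanDeriv (n := n) x (fun q => ∑ i ∈ s, u i q) w p =
      ∑ i ∈ s, tanDeriv (n := n) x (u i) w p := by
  classical
  induction s using Finset.induction_on with
  | empty => simp [tanDeriv_const]
  | insert a s ha ih =>
    simp only [Finset.sum_insert ha]
    rw [tanDeriv_add (hu a (Finset.mem_insert_self _ _))
      (Smooth.sum fun i hi => hu i (Finset.mem_insert_of_mem hi)),
      ih fun i hi => hu i (Finset.mem_insert_of_mem hi)]

theorem tanDeriv_congr {u v : M → F} {p : M} (h : u =ᶠ[𝓝 p] v) (w : Euc N) :
    tanDeriv (n := n) x u w p = tanDeriv (n := n) x v w p := by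
  have h1 := h.mfderiv_eq (I := 𝓡 n) (I' := 𝓘(ℝ, F))
  unfold tanDeriv
  rw [h1]
  rfl

theorem tanDeriv_eq_zero_of_notMem_tsupport {u : M → F} {p : M} (h : p ∉ tsupport u)
    (w : Euc N) : tanDeriv (n := n) x u w p = 0 := by
  rw [tanDeriv_congr (notMem_tsupport_iff_eventuallyEq.1 h)]
  exact tanDeriv_const 0 w p

theorem tsupport_tanDeriv_subset (u : M → F) (w : Euc N) :
    tsupport (tanDeriv (n := n) x u w) ⊆ tsupport u := by
  refine closure_minimal (fun p hp => ?_) (isClosed_tsupport u)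
  by_contra h
  exact hp (tanDeriv_eq_zero_of_notMem_tsupport h w)

theorem hasCompactSupport_tanDeriv {u : M → F} (hu : HasCompactSupport u) (w : Euc N) :
    HasCompactSupport (tanDeriv (n := n) x u w) :=
  hu.of_isClosed_subset (isClosed_tsupport _) (tsupport_tanDeriv_subset u w)

/-- The derivative of the tangential projection. -/
def dproj (x : M → Euc N) (v : Euc N) (p : M) : Euc N →L[ℝ] Euc N :=
  tanDeriv (n := n) x (proj (n := n) x) v p

theorem smooth_dproj (hx : IsImm (n := n) x) (v : Euc N) : Smooth n (dproj (n := n) x v) :=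
  smooth_tanDeriv hx (smooth_proj hx) v

theorem dproj_proj_dir (hx : IsImm (n := n) x) (v : Euc N) (p : M) :
    dproj (n := n) x (proj (n := n) x p v) p = dproj (n := n) x v p :=
  tanDeriv_proj_dir hx _ v p

theorem dproj_of_normal (hx : IsImm (n := n) x) {v : Euc N} {p : M}
    (hv : proj (n := n) x p v = 0) : dproj (n := n) x v p = 0 :=
  tanDeriv_of_normal hx _ hv

theorem tanDeriv_proj_apply (hx : IsImm (n := n) x) (v w : Euc N) (p : M) :
    tanDeriv (n := n) x (fun q => proj (n := n) x q w) v p = dproj (n := n) x v p w := by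
  rw [tanDeriv_clm_apply hx (smooth_proj hx) contMDiff_const, tanDeriv_const]
  simp [dproj]

theorem secondFF_eq (hx : IsImm (n := n) x) (v w : Euc N) (p : M) :
    secondFF (n := n) x p v w = norPart (n := n) x p (dproj (n := n) x v p w) := by
  unfold secondFF
  simp only [tanPart_eq]
  rw [tanDeriv_proj_apply hx]

/-- The identity `⟪P a, b⟫ = ⟪a, P b⟫` is differentiated with `a` and `b` constant. -/
theorem inner_dproj (hx : IsImm (n := n) x) (v a b : Euc N) (p : M) :
    ⟪dproj (n := n) x v p a, b⟫_ℝ = ⟪a, dproj (n := n) x v p b⟫_ℝ := by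
  have h1 := tanDeriv_inner hx (smooth_proj_apply hx a) (contMDiff_const (c := b)) v p
  have h2 := tanDeriv_inner hx (contMDiff_const (c := a)) (smooth_proj_apply hx b) v p
  simp only [inner_proj] at h1
  rw [h2] at h1
  simp only [tanDeriv_const, tanDeriv_proj_apply hx, inner_zero_left, map_zero,
    inner_zero_right] at h1
  linarith

/-- The derivative of `P ∘ P = P`. -/
theorem dproj_proj_add (hx : IsImm (n := n) x) (v w : Euc N) (p : M) :
    dproj (n := n) x v p (proj (n := n) x p w) + proj (n := n) x p (dproj (n := n) x v p w) =
      dproj (n := n) x v p w := by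
  have h1 := tanDeriv_clm_apply hx (smooth_proj hx) (smooth_proj_apply hx w) v p
  simp only [proj_proj] at h1
  rw [tanDeriv_proj_apply hx] at h1
  exact h1.symm

/-- By the derivative of `P ∘ P = P`, the operator `dproj` exchanges tangential and normal vectors.
This is one half of the exchange and the next lemma is the other. -/
theorem proj_dproj_of_tangent (hx : IsImm (n := n) x) (v : Euc N) {w : Euc N} {p : M}
    (hw : proj (n := n) x p w = w) : proj (n := n) x p (dproj (n := n) x v p w) = 0 := by
  have := dproj_proj_add hx v w p
  rw [hw] at this
  simpa using this

theorem proj_dproj_of_normal (hx : IsImm (n := n) x) (v : Euc N) {w : Euc N} {p : M}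
    (hw : proj (n := n) x p w = 0) :
    proj (n := n) x p (dproj (n := n) x v p w) = dproj (n := n) x v p w := by
  have := dproj_proj_add hx v w p
  rw [hw] at this
  simpa using this

/-- The coordinate Hessian is separated from the derivative of the pseudo-inverse, so that the
former cancels in commutators. -/
theorem tanDeriv_tanDeriv_chart (hx : IsImm (n := n) x) {u : M → F} (hu : Smooth n u) (q : M)
    (a b : Euc N) {p : M} (hp : p ∈ (chartAt (Euc n) q).source) :
    tanDeriv (n := n) x (tanDeriv (n := n) x u b) a p =
      fderiv ℝ (fderiv ℝ (chartRep (n := n) u q)) (chartAt (Euc n) q p)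
          (pinv (fderiv ℝ (chartRep (n := n) x q) (chartAt (Euc n) q p)) a)
          (pinv (fderiv ℝ (chartRep (n := n) x q) (chartAt (Euc n) q p)) b) +
        fderiv ℝ (chartRep (n := n) u q) (chartAt (Euc n) q p)
          (fderiv ℝ (fun z => pinv (fderiv ℝ (chartRep (n := n) x q) z)) (chartAt (Euc n) q p)
            (pinv (fderiv ℝ (chartRep (n := n) x q) (chartAt (Euc n) q p)) a) b) := by
  have hy := (chartAt (Euc n) q).map_source hp
  have hPd := (contDiffAt_pinv_chartRep hx q hy).differentiableAt (by simp)
  rw [hx.tanDeriv_chart (mdiffAt_of_contMDiff (smooth_tanDeriv hx hu b) p) q hp]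
  have h1 : chartRep (n := n) (tanDeriv (n := n) x u b) q =ᶠ[𝓝 (chartAt (Euc n) q p)]
      fun z => fderiv ℝ (chartRep (n := n) u q) z
        (pinv (fderiv ℝ (chartRep (n := n) x q) z) b) := by
    filter_upwards [eventually_mem_target q hy] with z hz
    exact hx.tanDeriv_chartRep hu q b hz
  rw [h1.fderiv_eq, fderiv_clm_apply
    ((contDiffAt_fderiv_chartRep hu q hy).differentiableAt (by simp))
    (hPd.clm_apply (differentiableAt_const b)), fderiv_clm_apply hPd (differentiableAt_const b),
    fderiv_const_apply]
  simp only [ContinuousLinearMap.comp_zero, zero_add, add_apply,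
    ContinuousLinearMap.comp_apply, ContinuousLinearMap.flip_apply]
  rw [add_comm]

/-- After the Hessians cancel, `u` is differentiated along a coordinate vector that does not depend
on `u`: the bracket of `v^T` and `w^T`. -/
theorem tanDeriv_comm_chart (hx : IsImm (n := n) x) {u : M → F} (hu : Smooth n u) (q : M)
    (v w : Euc N) {p : M} (hp : p ∈ (chartAt (Euc n) q).source) :
    tanDeriv (n := n) x (tanDeriv (n := n) x u w) v p -
      tanDeriv (n := n) x (tanDeriv (n := n) x u v) w p =
    fderiv ℝ (chartRep (n := n) u q) (chartAt (Euc n) q p)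
      (fderiv ℝ (fun z => pinv (fderiv ℝ (chartRep (n := n) x q) z)) (chartAt (Euc n) q p)
        (pinv (fderiv ℝ (chartRep (n := n) x q) (chartAt (Euc n) q p)) v) w -
       fderiv ℝ (fun z => pinv (fderiv ℝ (chartRep (n := n) x q) z)) (chartAt (Euc n) q p)
        (pinv (fderiv ℝ (chartRep (n := n) x q) (chartAt (Euc n) q p)) w) v) := by
  have hy := (chartAt (Euc n) q).map_source hp
  have hsymm := ((contDiffAt_chartRep hu q hy).isSymmSndFDerivAt
    (by simpa using (ENat.LEInfty.out : (2 : ℕ∞ω) ≤ (∞ : ℕ∞ω)))).eq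
  rw [tanDeriv_tanDeriv_chart hx hu q v w hp, tanDeriv_tanDeriv_chart hx hu q w v hp, hsymm,
    map_sub]
  abel

/-- The commutator of two coordinate derivatives. -/
theorem tanDeriv_comm (hx : IsImm (n := n) x) {g : M → F} (hg : Smooth n g) (v w : Euc N) (p : M) :
    tanDeriv (n := n) x (tanDeriv (n := n) x g w) v p -
      tanDeriv (n := n) x (tanDeriv (n := n) x g v) w p =
    tanDeriv (n := n) x g (dproj (n := n) x v p w - dproj (n := n) x w p v) p := by
  have hp := mem_chart_source (Euc n) p
  have hself : ∀ a, tanDeriv (n := n) x x a = fun q => proj (n := n) x q a := fun a => by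
    funext q; exact tanDeriv_self hx a q
  -- The bracket is identified by applying the chart formula to `x` itself, whose tangential
  -- derivatives are the projections.
  have h3 := tanDeriv_comm_chart hx hx.smooth p v w hp
  rw [hself, hself, tanDeriv_proj_apply hx, tanDeriv_proj_apply hx] at h3
  rw [tanDeriv_comm_chart hx hg p v w hp, h3, hx.tanDeriv_chart (mdiffAt_of_contMDiff hg p) p hp,
    pinv_apply_self _ (hx.injective_chart p hp)]

/-- `dproj x v w - dproj x w v` is tangential. -/
theorem proj_dproj_sub (hx : IsImm (n := n) x) (v w : Euc N) (p : M) :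
    proj (n := n) x p (dproj (n := n) x v p w - dproj (n := n) x w p v) =
      dproj (n := n) x v p w - dproj (n := n) x w p v := by
  have hself : ∀ a, tanDeriv (n := n) x x a = fun q => proj (n := n) x q a := fun a => by
    funext q; exact tanDeriv_self hx a q
  -- For `g = x` the right side of the commutator formula is a projection, and the left side is the
  -- vector itself.
  have h := tanDeriv_comm hx hx.smooth v w p
  rw [hself, hself, tanDeriv_proj_apply hx, tanDeriv_proj_apply hx, tanDeriv_self hx] at h
  exact h.symm

/-- The second fundamental form is symmetric. -/
theorem norPart_dproj_comm (hx : IsImm (n := n) x) (v w : Euc N) (p : M) :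
    norPart (n := n) x p (dproj (n := n) x v p w) =
      norPart (n := n) x p (dproj (n := n) x w p v) := by
  have h := proj_dproj_sub hx v w p
  rw [map_sub] at h
  rw [norPart_eq, norPart_eq, ← sub_eq_zero]
  rw [← sub_eq_zero] at h
  rw [← neg_eq_zero, ← h]
  abel

end Calculus


/-! ### Traced Codazzi equation and translations as eigenfields of `L` -/

section Simons

variable {n N : ℕ} {M : Type*} [TopologicalSpace M] [ChartedSpace (Euc n) M]
variable [IsManifold (𝓡 n) ∞ M]
variable {x : M → Euc N}

theorem norPart_sub (p : M) (v w : Euc N) :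
    norPart (n := n) x p (v - w) = norPart (n := n) x p v - norPart (n := n) x p w := by
  simp only [norPart_eq, map_sub]; abel

theorem norPart_add (p : M) (v w : Euc N) :
    norPart (n := n) x p (v + w) = norPart (n := n) x p v + norPart (n := n) x p w := by
  simp only [norPart_eq, map_add]; abel

theorem norPart_neg (p : M) (v : Euc N) :
    norPart (n := n) x p (-v) = -norPart (n := n) x p v := by
  simp only [norPart_eq, map_neg]; abel

theorem norPart_smul (p : M) (c : ℝ) (v : Euc N) :
    norPart (n := n) x p (c • v) = c • norPart (n := n) x p v := by
  simp only [norPart_eq, map_smul, smul_sub]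

/-- The normal projection as a linear map. -/
def norProj (x : M → Euc N) (p : M) : Euc N →ₗ[ℝ] Euc N where
  toFun := norPart (n := n) x p
  map_add' := norPart_add p
  map_smul' := norPart_smul p

@[simp] theorem norProj_apply (p : M) (v : Euc N) :
    norProj (n := n) x p v = norPart (n := n) x p v := rfl

theorem norPart_sum {ι : Type*} (s : Finset ι) (p : M) (v : ι → Euc N) :
    norPart (n := n) x p (∑ i ∈ s, v i) = ∑ i ∈ s, norPart (n := n) x p (v i) :=
  map_sum (norProj (n := n) x p) v s

theorem norPart_of_tangent {p : M} {v : Euc N} (hv : proj (n := n) x p v = v) :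
    norPart (n := n) x p v = 0 := by rw [norPart_eq, hv, sub_self]

theorem norPart_of_normal {p : M} {v : Euc N} (hv : proj (n := n) x p v = 0) :
    norPart (n := n) x p v = v := by rw [norPart_eq, hv, sub_zero]

theorem proj_norPart (p : M) (v : Euc N) : proj (n := n) x p (norPart (n := n) x p v) = 0 :=
  proj_sub_proj p v

theorem proj_add_norPart (p : M) (v : Euc N) :
    proj (n := n) x p v + norPart (n := n) x p v = v := by rw [norPart_eq]; abel

theorem tanDeriv_norPart (hx : IsImm (n := n) x) {u : M → Euc N} (hu : Smooth n u) (w : Euc N)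
    (p : M) :
    tanDeriv (n := n) x (fun q => norPart (n := n) x q (u q)) w p =
      norPart (n := n) x p (tanDeriv (n := n) x u w p) - dproj (n := n) x w p (u p) := by
  simp only [norPart_eq]
  rw [tanDeriv_sub hu ((smooth_proj hx).clm_apply hu), tanDeriv_clm_apply hx (smooth_proj hx) hu]
  simp only [dproj]
  abel

/-- `dproj` as a bilinear map. -/
def dprojB (x : M → Euc N) (p : M) : Euc N →ₗ[ℝ] Euc N →ₗ[ℝ] Euc N :=
  LinearMap.mk₂ ℝ (fun v w => dproj (n := n) x v p w)
    (fun v v' w => by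
      simp only [dproj, tanDeriv_add_right]; rfl)
    (fun c v w => by
      simp only [dproj, tanDeriv_smul_right]; rfl)
    (fun v w w' => map_add _ w w') (fun c v w => map_smul _ c w)

@[simp] theorem dprojB_apply (p : M) (v w : Euc N) :
    dprojB (n := n) x p v w = dproj (n := n) x v p w := rfl

/-- Used repeatedly as follows: `P` is inserted for free in the direction slot of `dproj`, and moved
to the other slot, where it makes the terms vanish; or it is moved the opposite way. -/
theorem sum_swap_proj {G : Type*} [AddCommGroup G] [Module ℝ G]
    (β : Euc N →ₗ[ℝ] Euc N →ₗ[ℝ] G) (p : M) :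
    ∑ i, β (proj (n := n) x p (stdVec i)) (stdVec i) =
      ∑ i, β (stdVec i) (proj (n := n) x p (stdVec i)) :=
  sum_bilin_symm_swap β (proj (n := n) x p : Euc N →ₗ[ℝ] Euc N) (fun v w => inner_proj p v w)

theorem norPart_dproj_dproj_of_tangent (hx : IsImm (n := n) x) (a b : Euc N) {v : Euc N} {p : M}
    (hv : proj (n := n) x p v = v) :
    norPart (n := n) x p (dproj (n := n) x a p (dproj (n := n) x b p v)) = 0 :=
  norPart_of_tangent (proj_dproj_of_normal hx a (proj_dproj_of_tangent hx b hv))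

theorem norPart_dproj_of_normal (hx : IsImm (n := n) x) (a : Euc N) {v : Euc N} {p : M}
    (hv : proj (n := n) x p v = 0) :
    norPart (n := n) x p (dproj (n := n) x a p v) = 0 :=
  norPart_of_tangent (proj_dproj_of_normal hx a hv)

/-- The trace of the derivative of the tangential projection is normal. -/
theorem proj_sum_dproj (hx : IsImm (n := n) x) (p : M) :
    proj (n := n) x p (∑ i, dproj (n := n) x (stdVec i) p (stdVec i)) = 0 := by
  -- From `P ∘ P = P` one has `P (dproj v w) = dproj v (w - P w)`. The `P` inserted in the direction
  -- is then moved onto the second slot, where `1 - P` kills it.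
  have h1 : ∀ i : Fin N, proj (n := n) x p (dproj (n := n) x (stdVec i) p (stdVec i)) =
      (dprojB (n := n) x p).compl₂ (norProj (n := n) x p) (proj (n := n) x p (stdVec i))
        (stdVec i) := by
    intro i
    have h := dproj_proj_add hx (stdVec i) (stdVec i) p
    simp only [LinearMap.compl₂_apply, dprojB_apply, norProj_apply]
    rw [dproj_proj_dir hx, norPart_eq, map_sub, eq_sub_iff_add_eq']
    exact h
  rw [map_sum, Finset.sum_congr rfl fun i _ => h1 i, sum_swap_proj]
  refine Finset.sum_eq_zero fun i _ => ?_
  simp only [LinearMap.compl₂_apply, dprojB_apply, norProj_apply]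
  rw [norPart_of_tangent (proj_proj p _), map_zero]

/-- The trace is normal by `proj_sum_dproj`, hence equal to `-H`, and the shrinker equation applies.
-/
theorem sum_dproj_stdVec (hx : IsShrinker (n := n) x) (p : M) :
    ∑ i, dproj (n := n) x (stdVec i) p (stdVec i) = -(1 / 2 : ℝ) • norPart (n := n) x p (x p) := by
  have h1 := hx.equation p
  rw [← norPart_of_normal (proj_sum_dproj hx.isImm p), norPart_sum]
  unfold meanCurv at h1
  simp only [secondFF_eq hx.isImm] at h1
  rw [neg_smul, ← h1, neg_neg]

/-- The rough Laplacian of the tangential projection. -/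
def lapProj (x : M → Euc N) (p : M) : Euc N →L[ℝ] Euc N :=
  ∑ i, tanDeriv (n := n) x (dproj (n := n) x (stdVec i)) (stdVec i) p

theorem tanDeriv_dproj_apply (hx : IsImm (n := n) x) (a b w : Euc N) (p : M) :
    tanDeriv (n := n) x (fun q => dproj (n := n) x a q w) b p =
      tanDeriv (n := n) x (dproj (n := n) x a) b p w := by
  rw [tanDeriv_clm_apply hx (smooth_dproj hx a) contMDiff_const, tanDeriv_const, map_zero, add_zero]

/-- The Codazzi equation, traced, on a shrinker. -/
theorem norPart_lapProj_of_tangent (hx : IsShrinker (n := n) x) {v : Euc N} {p : M}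
    (hv : proj (n := n) x p v = v) :
    norPart (n := n) x p (lapProj (n := n) x p v) =
      (1 / 2 : ℝ) • norPart (n := n) x p (dproj (n := n) x (x p) p v) := by
  have hi := hx.isImm
  set T : Euc N → Euc N →L[ℝ] Euc N := fun a => dproj (n := n) x a p with hT
  -- differentiate the symmetry of the second fundamental form
  have h1 : ∀ i : Fin N,
      norPart (n := n) x p (tanDeriv (n := n) x (dproj (n := n) x (stdVec i)) (stdVec i) p v) =
      norPart (n := n) x p (tanDeriv (n := n) x (dproj (n := n) x (stdVec i)) v p (stdVec i)) +
      norPart (n := n) x p (T (T (stdVec i) v - T v (stdVec i)) (stdVec i)) -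
      norPart (n := n) x p (T (stdVec i) (T v (stdVec i))) := by
    intro i
    have e1 := tanDeriv_norPart hi ((smooth_dproj hi (stdVec i)).clm_apply
      (contMDiff_const (c := v))) (stdVec i) p
    have e2 := tanDeriv_norPart hi ((smooth_dproj hi v).clm_apply
      (contMDiff_const (c := (stdVec i : Euc N)))) (stdVec i) p
    have e3 : (fun q => norPart (n := n) x q (dproj (n := n) x (stdVec i) q v)) =
        fun q => norPart (n := n) x q (dproj (n := n) x v q (stdVec i)) := by
      funext q; exact norPart_dproj_comm hi _ _ q
    rw [e3, e2] at e1
    rw [tanDeriv_dproj_apply hi, tanDeriv_dproj_apply hi] at e1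
    have e4 := congrArg (norPart (n := n) x p) e1
    rw [norPart_sub, norPart_sub, norPart_norPart, norPart_norPart,
      norPart_dproj_dproj_of_tangent hi _ _ hv, sub_zero] at e4
    rw [← e4]
    have e5 := tanDeriv_comm hi (smooth_proj hi) (stdVec i) v p
    have e6 : tanDeriv (n := n) x (dproj (n := n) x v) (stdVec i) p =
        tanDeriv (n := n) x (dproj (n := n) x (stdVec i)) v p +
          T (T (stdVec i) v - T v (stdVec i)) := by
      rw [← sub_eq_iff_eq_add']; exact e5
    rw [e6, add_apply, norPart_add]
  -- The trace `-x^⊥ / 2` is differentiated along `v`. As `dx` is tangential, only the derivative of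
  -- the normal projection contributes.
  have h2 : ∑ i : Fin N,
      tanDeriv (n := n) x (dproj (n := n) x (stdVec i)) v p (stdVec i) =
      (1 / 2 : ℝ) • dproj (n := n) x v p (x p) := by
    have e1 : (fun q => ∑ i : Fin N, dproj (n := n) x (stdVec i) q (stdVec i)) =
        fun q => (-(1 / 2 : ℝ)) • norPart (n := n) x q (x q) := by
      funext q; exact sum_dproj_stdVec hx q
    have e2 := congrArg (fun f => tanDeriv (n := n) x f v p) e1
    rw [tanDeriv_sum _ (fun i _ => (smooth_dproj hi (stdVec i)).clm_apply contMDiff_const),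
      tanDeriv_const_smul hi (smooth_norPart hi hx.smooth), tanDeriv_norPart hi hx.smooth,
      tanDeriv_self hi, norPart_of_tangent (proj_proj p v), zero_sub, smul_neg, neg_smul,
      neg_neg] at e2
    rw [← e2]
    exact Finset.sum_congr rfl fun i _ => (tanDeriv_dproj_apply hi _ _ _ p).symm
  -- Moving `P` from the direction to the innermost argument leaves two `dproj` applied to a tangent
  -- vector, which is again tangential.
  have h3 : ∑ i : Fin N, norPart (n := n) x p (T (stdVec i) (T v (stdVec i))) = 0 := by
    have e := sum_swap_proj (n := n) (x := x)
      (((dprojB (n := n) x p).compr₂ (norProj (n := n) x p)).compl₂ (dprojB (n := n) x p v)) p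
    simp only [LinearMap.compl₂_apply, LinearMap.compr₂_apply, dprojB_apply, norProj_apply,
      dproj_proj_dir hi] at e
    rw [e]
    exact Finset.sum_eq_zero fun i _ => norPart_dproj_dproj_of_tangent hi _ _ (proj_proj p _)
  -- Symmetry of the second fundamental form allows `E_i` to be projected. Moving `P` into the
  -- direction turns it into a difference of two normal vectors, along which the derivative is zero.
  have h4 : ∑ i : Fin N,
      norPart (n := n) x p (T (T (stdVec i) v - T v (stdVec i)) (stdVec i)) = 0 := by
    have e0 : ∀ i : Fin N, norPart (n := n) x p (T (T (stdVec i) v - T v (stdVec i)) (stdVec i)) =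
        norPart (n := n) x p (T (T (stdVec i) v - T v (stdVec i))
          (proj (n := n) x p (stdVec i))) := by
      intro i
      rw [hT]
      rw [norPart_dproj_comm hi, norPart_dproj_comm hi _ (proj (n := n) x p (stdVec i)),
        dproj_proj_dir hi]
    have e := sum_swap_proj (n := n) (x := x)
      (((dprojB (n := n) x p).comp ((dprojB (n := n) x p).flip v -
        (dprojB (n := n) x p v))).compr₂ (norProj (n := n) x p)) p
    simp only [LinearMap.comp_apply, LinearMap.compr₂_apply, dprojB_apply, norProj_apply,
      LinearMap.sub_apply, LinearMap.flip_apply] at e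
    rw [Finset.sum_congr rfl fun i _ => e0 i]
    refine e.symm.trans ?_
    refine Finset.sum_eq_zero fun i _ => ?_
    rw [dproj_of_normal hi (v := dproj (n := n) x (proj (n := n) x p (stdVec i)) p v -
      dproj (n := n) x v p (proj (n := n) x p (stdVec i)))]
    · exact map_zero (norProj (n := n) x p)
    · rw [map_sub, proj_dproj_of_tangent hi _ hv, proj_dproj_of_tangent hi _ (proj_proj p _),
        sub_zero]
  have h5 : lapProj (n := n) x p v = ∑ i : Fin N,
      tanDeriv (n := n) x (dproj (n := n) x (stdVec i)) (stdVec i) p v := by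
    simp [lapProj]
  rw [h5, norPart_sum, Finset.sum_congr rfl fun i _ => h1 i, Finset.sum_sub_distrib,
    Finset.sum_add_distrib, h3, h4, add_zero, sub_zero, ← norPart_sum, h2, norPart_smul,
    norPart_dproj_comm hi]

/-- The identity `(1 - P) ∘ dproj ∘ (1 - P) = 0` is differentiated once more. The two outer factors
contribute equal terms, whence the factor 2. -/
theorem norPart_lapProj_of_normal (hx : IsImm (n := n) x) {v : Euc N} {p : M}
    (hv : proj (n := n) x p v = 0) :
    norPart (n := n) x p (lapProj (n := n) x p v) =
      (2 : ℝ) • ∑ i, norPart (n := n) x p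
        (dproj (n := n) x (stdVec i) p (dproj (n := n) x (stdVec i) p v)) := by
  have h1 : ∀ i : Fin N,
      norPart (n := n) x p (tanDeriv (n := n) x (dproj (n := n) x (stdVec i)) (stdVec i) p v) =
      (2 : ℝ) • norPart (n := n) x p
        (dproj (n := n) x (stdVec i) p (dproj (n := n) x (stdVec i) p v)) := by
    intro i
    have sv : Smooth n (fun q => norPart (n := n) x q v) := smooth_norPart hx contMDiff_const
    have sf : Smooth n (fun q => dproj (n := n) x (stdVec i) q (norPart (n := n) x q v)) :=
      (smooth_dproj hx (stdVec i)).clm_apply sv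
    have e1 := tanDeriv_norPart hx sf (stdVec i) p
    have e2 : (fun q => norPart (n := n) x q
        (dproj (n := n) x (stdVec i) q (norPart (n := n) x q v))) = fun _ => (0 : Euc N) := by
      funext q; exact norPart_dproj_of_normal hx _ (proj_norPart q v)
    rw [e2, tanDeriv_const, tanDeriv_clm_apply hx (smooth_dproj hx (stdVec i)) sv,
      tanDeriv_norPart hx contMDiff_const, tanDeriv_const, norPart_of_normal hv] at e1
    have e3 : norPart (n := n) x p (0 : Euc N) = 0 := map_zero (norProj (n := n) x p)
    have e4 := congrArg (norPart (n := n) x p) e1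
    rw [e3, zero_sub, map_neg, norPart_sub, norPart_norPart, norPart_add, norPart_neg] at e4
    rw [two_smul, ← sub_eq_zero]
    rw [e4]
    abel
  have h5 : lapProj (n := n) x p v = ∑ i : Fin N,
      tanDeriv (n := n) x (dproj (n := n) x (stdVec i)) (stdVec i) p v := by
    simp [lapProj]
  rw [h5, norPart_sum, Finset.sum_congr rfl fun i _ => h1 i, Finset.smul_sum]

/-- The drift Laplacian of the normal projection of a constant vector. -/
theorem norPart_lapProj (hx : IsShrinker (n := n) x) (v : Euc N) (p : M) :
    norPart (n := n) x p (lapProj (n := n) x p v) -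
      ∑ i, norPart (n := n) x p
        (dproj (n := n) x (stdVec i) p (dproj (n := n) x (stdVec i) p v)) -
      (1 / 2 : ℝ) • norPart (n := n) x p (dproj (n := n) x (x p) p v) =
      ∑ i, norPart (n := n) x p
        (dproj (n := n) x (stdVec i) p (dproj (n := n) x (stdVec i) p
          (norPart (n := n) x p v))) := by
  have hi := hx.isImm
  -- The tangential part of `v` contributes only the drift term, which cancels. The normal part
  -- contributes the quadratic term twice, and one copy is subtracted. As `D_w v^⊥ = -dproj w v` up
  -- to the tangential part that the normal connection discards, the result says that `ℒ v^⊥` is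
  -- minus the curvature term of `L`, so `L v^⊥ = v^⊥ / 2`.
  have ht := norPart_lapProj_of_tangent hx (proj_proj (n := n) (x := x) p v)
  have hn := norPart_lapProj_of_normal hi (proj_norPart (n := n) (x := x) p v)
  have h1 : ∀ A : Euc N →L[ℝ] Euc N, norPart (n := n) x p (A v) =
      norPart (n := n) x p (A (proj (n := n) x p v)) +
        norPart (n := n) x p (A (norPart (n := n) x p v)) := by
    intro A
    rw [← norPart_add, ← map_add, proj_add_norPart]
  have h2 : ∀ i : Fin N, norPart (n := n) x p
        (dproj (n := n) x (stdVec i) p (dproj (n := n) x (stdVec i) p v)) =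
        norPart (n := n) x p (dproj (n := n) x (stdVec i) p (dproj (n := n) x (stdVec i) p
          (norPart (n := n) x p v))) := by
    intro i
    have := h1 (dproj (n := n) x (stdVec i) p ∘L dproj (n := n) x (stdVec i) p)
    simp only [ContinuousLinearMap.comp_apply] at this
    rw [this, norPart_dproj_dproj_of_tangent hi _ _ (proj_proj p v), zero_add]
  rw [h1 (lapProj (n := n) x p), h1 (dproj (n := n) x (x p) p), ht, hn,
    norPart_dproj_of_normal hi _ (proj_norPart p v), add_zero, Finset.sum_congr rfl fun i _ => h2 i,
    two_smul]
  abel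

/-- The operator `L` on a function times the normal part of a constant vector. -/
theorem jacobiOp_smul_norPart (hx : IsShrinker (n := n) x) {φ : M → ℝ} (hφ : Smooth n φ)
    (V : Euc N) (p : M) :
    jacobiOp (n := n) x (fun q => φ q • norPart (n := n) x q V) p =
      driftLaplacian (n := n) x φ p • norPart (n := n) x p V
      - (2 : ℝ) • ∑ i, tanDeriv (n := n) x φ (stdVec i) p •
          norPart (n := n) x p (dproj (n := n) x (stdVec i) p V)
      + (1 / 2 : ℝ) • φ p • norPart (n := n) x p V := by
  have hi := hx.isImm
  have sV : Smooth n (fun q => norPart (n := n) x q V) := smooth_norPart hi contMDiff_const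
  have dV : ∀ (w : Euc N) (q : M), tanDeriv (n := n) x (fun q => norPart (n := n) x q V) w q =
      - dproj (n := n) x w q V := by
    intro w q
    rw [tanDeriv_norPart hi contMDiff_const, tanDeriv_const]
    have e3 : norPart (n := n) x q (0 : Euc N) = 0 := map_zero (norProj (n := n) x q)
    rw [e3, zero_sub]
  have h1 : ∀ (w : Euc N) (q : M),
      norDeriv (n := n) x (fun q => φ q • norPart (n := n) x q V) w q =
      tanDeriv (n := n) x φ w q • norPart (n := n) x q V
        - φ q • norPart (n := n) x q (dproj (n := n) x w q V) := by
    intro w q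
    unfold norDeriv
    rw [tanDeriv_smul hi hφ sV, dV, norPart_add, norPart_smul, norPart_smul, norPart_norPart,
      norPart_neg, smul_neg, sub_eq_add_neg]
  have h2 : ∀ i : Fin N, norDeriv (n := n) x (fun q => norDeriv (n := n) x
      (fun q => φ q • norPart (n := n) x q V) (stdVec i) q) (stdVec i) p =
      tanDeriv (n := n) x (fun q => tanDeriv (n := n) x φ (stdVec i) q) (stdVec i) p •
        norPart (n := n) x p V
      - (2 : ℝ) • tanDeriv (n := n) x φ (stdVec i) p •
          norPart (n := n) x p (dproj (n := n) x (stdVec i) p V)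
      - φ p • (norPart (n := n) x p
          (tanDeriv (n := n) x (dproj (n := n) x (stdVec i)) (stdVec i) p V)
        - norPart (n := n) x p (dproj (n := n) x (stdVec i) p
            (dproj (n := n) x (stdVec i) p V))) := by
    intro i
    simp only [h1]
    have sφ := smooth_tanDeriv hi hφ (stdVec i)
    have sT : Smooth n (fun q => dproj (n := n) x (stdVec i) q V) :=
      (smooth_dproj hi (stdVec i)).clm_apply contMDiff_const
    have sQT := smooth_norPart hi sT
    unfold norDeriv
    rw [tanDeriv_sub (sφ.smul sV) (hφ.smul sQT), tanDeriv_smul hi sφ sV, tanDeriv_smul hi hφ sQT,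
      dV, tanDeriv_norPart hi sT, tanDeriv_dproj_apply hi]
    simp only [norPart_sub, norPart_add, norPart_smul, norPart_norPart, norPart_neg, smul_neg,
      smul_sub, two_smul]
    abel
  -- By symmetry of `dproj`, the sum over `j` rebuilds the vector `dproj E_i V^⊥` from its
  -- coordinates. The curvature term thereby becomes the right side of `norPart_lapProj`.
  have h3 : ∑ i : Fin N, ∑ j : Fin N,
        ⟪φ p • norPart (n := n) x p V, secondFF (n := n) x p (stdVec i) (stdVec j)⟫_ℝ •
          secondFF (n := n) x p (stdVec i) (stdVec j) =
      φ p • ∑ i, norPart (n := n) x p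
        (dproj (n := n) x (stdVec i) p (dproj (n := n) x (stdVec i) p
          (norPart (n := n) x p V))) := by
    rw [Finset.smul_sum]
    refine Finset.sum_congr rfl fun i _ => ?_
    have e : ∀ j : Fin N, ⟪φ p • norPart (n := n) x p V,
        secondFF (n := n) x p (stdVec i) (stdVec j)⟫_ℝ •
          secondFF (n := n) x p (stdVec i) (stdVec j) =
        φ p • (norProj (n := n) x p ∘ₗ (dproj (n := n) x (stdVec i) p : Euc N →ₗ[ℝ] Euc N))
          (⟪stdVec j, dproj (n := n) x (stdVec i) p (norPart (n := n) x p V)⟫_ℝ • stdVec j) := by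
      intro j
      rw [secondFF_eq hi, real_inner_smul_left, ← inner_norPart, norPart_norPart, map_smul,
        ← inner_dproj hi, real_inner_comm, mul_smul]
      rfl
    rw [Finset.sum_congr rfl fun j _ => e j, ← Finset.smul_sum, ← map_sum, sum_inner_stdVec_smul]
    rfl
  have h4 := norPart_lapProj hx V p
  have h5 : norPart (n := n) x p (lapProj (n := n) x p V) = ∑ i : Fin N, norPart (n := n) x p
      (tanDeriv (n := n) x (dproj (n := n) x (stdVec i)) (stdVec i) p V) := by
    rw [← norPart_sum]; simp [lapProj]
  unfold jacobiOp normalDriftLaplacian driftLaplacian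
  rw [h3, ← h4, Finset.sum_congr rfl fun i _ => h2 i, h1, h5, Finset.sum_sub_distrib,
    Finset.sum_sub_distrib, ← Finset.sum_smul, ← Finset.smul_sum, ← Finset.smul_sum,
    Finset.sum_sub_distrib]
  module

/-- The cross term is recognized as `⟪∇φ, ∇|V^⊥|²⟫`. Hence the first two summands are `φ` times the
drift divergence of `|V^⊥|² ∇φ`, ready for Green's formula. -/
theorem inner_jacobiOp_smul_norPart (hx : IsShrinker (n := n) x) {φ : M → ℝ} (hφ : Smooth n φ)
    (V : Euc N) (p : M) :
    ⟪φ p • norPart (n := n) x p V,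
      jacobiOp (n := n) x (fun q => φ q • norPart (n := n) x q V) p⟫_ℝ =
      (φ p * ‖norPart (n := n) x p V‖ ^ 2) * driftLaplacian (n := n) x φ p
      + φ p * ∑ i, tanDeriv (n := n) x φ (stdVec i) p *
          tanDeriv (n := n) x (fun q => ‖norPart (n := n) x q V‖ ^ 2) (stdVec i) p
      + (1 / 2 : ℝ) * φ p ^ 2 * ‖norPart (n := n) x p V‖ ^ 2 := by
  have hi := hx.isImm
  have sV : Smooth n (fun q => norPart (n := n) x q V) := smooth_norPart hi contMDiff_const
  have e1 : ∀ i : Fin N, tanDeriv (n := n) x (fun q => ‖norPart (n := n) x q V‖ ^ 2)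
      (stdVec i) p = -2 * ⟪norPart (n := n) x p V, norPart (n := n) x p
        (dproj (n := n) x (stdVec i) p V)⟫_ℝ := by
    intro i
    simp only [← real_inner_self_eq_norm_sq]
    rw [tanDeriv_inner hi sV sV, tanDeriv_norPart hi contMDiff_const, tanDeriv_const]
    have e3 : norPart (n := n) x p (0 : Euc N) = 0 := map_zero (norProj (n := n) x p)
    rw [e3, zero_sub, inner_neg_left, inner_neg_right, real_inner_comm,
      ← inner_norPart (n := n) (x := x) p (norPart (n := n) x p V), norPart_norPart]
    ring
  rw [jacobiOp_smul_norPart hx hφ, real_inner_smul_left]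
  simp only [inner_add_right, inner_sub_right, real_inner_smul_right,
    inner_sum, real_inner_self_eq_norm_sq, e1]
  have e2 : ∑ i, tanDeriv (n := n) x φ (stdVec i) p * (-2 * ⟪norPart (n := n) x p V,
      norPart (n := n) x p (dproj (n := n) x (stdVec i) p V)⟫_ℝ) =
      -2 * ∑ i, tanDeriv (n := n) x φ (stdVec i) p * ⟪norPart (n := n) x p V,
      norPart (n := n) x p (dproj (n := n) x (stdVec i) p V)⟫_ℝ := by
    rw [Finset.mul_sum]
    exact Finset.sum_congr rfl fun i _ => by ring
  rw [e2]
  ring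

end Simons


/-! ### Gram determinants -/

section Gram

variable {n N : ℕ}

/-- The Gram matrix of a linear map in the standard basis. -/
def gram (f : Euc n →L[ℝ] Euc N) : Matrix (Fin n) (Fin n) ℝ :=
  Matrix.of fun i j => ⟪f (stdVec i), f (stdVec j)⟫_ℝ

/-- The matrix of an endomorphism in the standard basis. -/
def stdMatrix (D : Euc n →L[ℝ] Euc n) : Matrix (Fin n) (Fin n) ℝ :=
  Matrix.of fun i j => D (stdVec j) i

theorem stdMatrix_eq_toMatrix (D : Euc n →L[ℝ] Euc n) :
    stdMatrix D = LinearMap.toMatrix (EuclideanSpace.basisFun (Fin n) ℝ).toBasis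
      (EuclideanSpace.basisFun (Fin n) ℝ).toBasis (D : Euc n →ₗ[ℝ] Euc n) := by
  ext i j
  simp [stdMatrix, LinearMap.toMatrix_apply, stdVec]

theorem det_stdMatrix (D : Euc n →L[ℝ] Euc n) : (stdMatrix D).det = D.det := by
  rw [stdMatrix_eq_toMatrix, LinearMap.det_toMatrix]

theorem trace_stdMatrix (D : Euc n →L[ℝ] Euc n) :
    (stdMatrix D).trace = LinearMap.trace ℝ (Euc n) (D : Euc n →ₗ[ℝ] Euc n) := by
  rw [stdMatrix_eq_toMatrix,
    ← LinearMap.trace_eq_matrix_trace ℝ (EuclideanSpace.basisFun (Fin n) ℝ).toBasis]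

theorem inner_apply_stdVec_sum (f : Euc n →L[ℝ] Euc N) (v : Euc N) (u : Euc n) :
    ⟪v, f u⟫_ℝ = ∑ k, u k * ⟪v, f (stdVec k)⟫_ℝ := by
  conv_lhs => rw [← stdVec_sum u]
  simp [inner_sum, real_inner_smul_right]

theorem gram_comp (f : Euc n →L[ℝ] Euc N) (D : Euc n →L[ℝ] Euc n) :
    gram (f ∘L D) = (stdMatrix D).transpose * gram f * stdMatrix D := by
  ext i j
  simp only [gram, stdMatrix, Matrix.of_apply, Matrix.mul_apply, Matrix.transpose_apply,
    ContinuousLinearMap.comp_apply]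
  rw [inner_apply_stdVec_sum f _ (D (stdVec j))]
  refine Finset.sum_congr rfl fun k _ => ?_
  rw [real_inner_comm, inner_apply_stdVec_sum f _ (D (stdVec i)), mul_comm]
  congr 1
  exact Finset.sum_congr rfl fun l _ => by rw [real_inner_comm]

theorem det_gram_comp (f : Euc n →L[ℝ] Euc N) (D : Euc n →L[ℝ] Euc n) :
    (gram (f ∘L D)).det = D.det ^ 2 * (gram f).det := by
  rw [gram_comp, Matrix.det_mul, Matrix.det_mul, Matrix.det_transpose, det_stdMatrix]
  ring

theorem gram_eq_stdMatrix (f : Euc n →L[ℝ] Euc N) :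
    gram f = stdMatrix ((ContinuousLinearMap.adjoint f) ∘L f) := by
  ext i j
  simp only [gram, stdMatrix, Matrix.of_apply, ContinuousLinearMap.comp_apply]
  rw [← inner_stdVec, ContinuousLinearMap.adjoint_inner_right]

theorem det_gram_nonneg (f : Euc n →L[ℝ] Euc N) : 0 ≤ (gram f).det := by
  have h : (gram f).PosSemidef := by
    rw [gram_eq_stdMatrix]
    refine Matrix.PosSemidef.of_dotProduct_mulVec_nonneg ?_ ?_
    · ext i j
      rw [← gram_eq_stdMatrix]
      simp [gram, real_inner_comm]
    · intro v
      rw [← gram_eq_stdMatrix]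
      have : star v ⬝ᵥ (gram f).mulVec v =
          ⟪f (WithLp.toLp 2 v), f (WithLp.toLp 2 v)⟫_ℝ := by
        rw [inner_apply_stdVec_sum f _ (WithLp.toLp 2 v)]
        simp only [dotProduct, Matrix.mulVec, gram, Matrix.of_apply, star_trivial]
        simp_rw [Finset.mul_sum]
        rw [Finset.sum_comm]
        refine Finset.sum_congr rfl fun k _ => ?_
        rw [real_inner_comm, inner_apply_stdVec_sum f _ (WithLp.toLp 2 v), Finset.mul_sum]
        refine Finset.sum_congr rfl fun l _ => ?_
        rw [real_inner_comm]
        simp only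
        ring
      rw [this]
      exact real_inner_self_nonneg
  exact h.det_nonneg

theorem det_gram_pos (f : Euc n →L[ℝ] Euc N) (hf : Function.Injective f) : 0 < (gram f).det := by
  refine lt_of_le_of_ne (det_gram_nonneg f) (Ne.symm ?_)
  obtain ⟨e, he⟩ := exists_gram_equiv f hf
  rw [gram_eq_stdMatrix, det_stdMatrix, ← he]
  exact (LinearEquiv.isUnit_det' e.toLinearEquiv).ne_zero

end Gram

/-! ### Riemannian and Gaussian measures in charts -/

section ChartVolume

variable {n N : ℕ} {M : Type*} [TopologicalSpace M] [ChartedSpace (Euc n) M]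
  [MeasurableSpace M] [BorelSpace M] [IsManifold (𝓡 n) ∞ M]
variable {x : M → Euc N}

theorem chartDensity_eq (e : OpenPartialHomeomorph M (Euc n)) (y : Euc n) :
    chartDensity x e y = Real.sqrt (gram (fderiv ℝ (x ∘ e.symm) y)).det := rfl

theorem measurable_chartDensity (e : OpenPartialHomeomorph M (Euc n)) :
    Measurable (chartDensity x e) := by
  have h1 : Measurable (fderiv ℝ (x ∘ e.symm)) := measurable_fderiv ℝ _
  have h2 : Continuous (fun f : Euc n →L[ℝ] Euc N => Real.sqrt (gram f).det) := by
    refine Real.continuous_sqrt.comp (Continuous.matrix_det ?_)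
    refine continuous_matrix fun i j => ?_
    simp only [gram, Matrix.of_apply]
    fun_prop
  exact h2.measurable.comp h1

theorem aemeasurable_chart_symm (e : OpenPartialHomeomorph M (Euc n)) (d : Euc n → ℝ≥0∞) :
    AEMeasurable e.symm (((volume : Measure (Euc n)).restrict e.target).withDensity d) :=
  (e.continuousOn_symm.aemeasurable e.open_target.measurableSet).mono_ac
    (withDensity_absolutelyContinuous _ _)

theorem lintegral_chartVolume (e : OpenPartialHomeomorph M (Euc n)) {f : M → ℝ≥0∞}
    (hf : Measurable f) : ∫⁻ p, f p ∂(chartVolume x e) =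
      ∫⁻ y in e.target, ENNReal.ofReal (chartDensity x e y) * f (e.symm y) := by
  unfold chartVolume
  rw [lintegral_map' hf.aemeasurable (aemeasurable_chart_symm e _),
    lintegral_withDensity_eq_lintegral_mul₀
      (measurable_chartDensity e).ennreal_ofReal.aemeasurable]
  · rfl
  · exact hf.comp_aemeasurable (e.continuousOn_symm.aemeasurable e.open_target.measurableSet)

theorem chartVolume_compl_source (e : OpenPartialHomeomorph M (Euc n)) :
    chartVolume x e e.sourceᶜ = 0 := by
  have h := lintegral_chartVolume (x := x) e
    (f := e.sourceᶜ.indicator 1) (measurable_one.indicator e.open_source.measurableSet.compl)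
  rw [lintegral_indicator_one e.open_source.measurableSet.compl] at h
  rw [h]
  rw [setLIntegral_congr_fun (g := fun _ => 0) e.open_target.measurableSet]
  · simp
  · intro y hy
    simp [e.map_target hy]

theorem contDiffOn_transition (p q : M) :
    ContDiffOn ℝ ∞ (chartAt (Euc n) p ∘ (chartAt (Euc n) q).symm)
      ((chartAt (Euc n) q).target ∩ (chartAt (Euc n) q).symm ⁻¹' (chartAt (Euc n) p).source) := by
  rw [← contMDiffOn_iff_contDiffOn]
  exact (contMDiffOn_chart (I := 𝓡 n) (n := ∞) (x := p)).comp
    ((contMDiffOn_chart_symm (I := 𝓡 n) (n := ∞) (x := q)).mono Set.inter_subset_left)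
    (fun y hy => hy.2)

/-- Change of variables along the transition map, whose Jacobian is the quotient of the two
densities by `det_gram_comp`. This inequality suffices, because each chart volume is below the
supremum anyway. -/
theorem chartVolume_inter_le (hx : IsImm (n := n) x) (p q : M) {A : Set M}
    (hA : MeasurableSet A) :
    chartVolume x (chartAt (Euc n) q) (A ∩ (chartAt (Euc n) p).source) ≤
      chartVolume x (chartAt (Euc n) p) A := by
  set e := chartAt (Euc n) p with he
  set e' := chartAt (Euc n) q with he'
  set S := e'.target ∩ e'.symm ⁻¹' e.source with hS
  set τ := e ∘ e'.symm with hτ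
  have hSo : IsOpen S := e'.isOpen_inter_preimage_symm e.open_source
  have hτd : ∀ y ∈ S, HasFDerivAt τ (fderiv ℝ τ y) y := fun y hy =>
    (((contDiffOn_transition p q).contDiffAt (hSo.mem_nhds hy)).differentiableAt
      (by simp)).hasFDerivAt
  have hτinj : Set.InjOn τ S := by
    intro y hy z hz hyz
    have h1 := e.injOn hy.2 hz.2 hyz
    exact e'.symm.injOn hy.1 hz.1 h1
  have hτt : ∀ y ∈ S, τ y ∈ e.target := fun y hy => e.map_source hy.2
  have hes : ∀ y ∈ S, e.symm (τ y) = e'.symm y := fun y hy => e.left_inv hy.2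
  have hdens : ∀ y ∈ S, chartDensity x e' y = |(fderiv ℝ τ y).det| * chartDensity x e (τ y) := by
    intro y hy
    have h1 : x ∘ e'.symm =ᶠ[𝓝 y] (x ∘ e.symm) ∘ τ := by
      filter_upwards [hSo.mem_nhds hy] with z hz
      simp only [Function.comp_apply]
      rw [← hes z hz]
    have h2 : fderiv ℝ (x ∘ e'.symm) y = fderiv ℝ (x ∘ e.symm) (τ y) ∘L fderiv ℝ τ y := by
      rw [h1.fderiv_eq]
      exact fderiv_comp y (differentiableAt_chartRep hx.smooth p (hτt y hy))
        (hτd y hy).differentiableAt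
    rw [chartDensity_eq, chartDensity_eq, h2, det_gram_comp, Real.sqrt_mul (sq_nonneg _),
      Real.sqrt_sq_eq_abs]
  have hAs : MeasurableSet (A ∩ e.source) := hA.inter e.open_source.measurableSet
  have l1 := lintegral_chartVolume (x := x) e' (f := (A ∩ e.source).indicator 1)
    (measurable_one.indicator hAs)
  have l2 := lintegral_chartVolume (x := x) e (f := A.indicator 1) (measurable_one.indicator hA)
  rw [lintegral_indicator_one hAs] at l1
  rw [lintegral_indicator_one hA] at l2
  rw [l1, l2]
  have l3 : ∫⁻ y in e'.target, ENNReal.ofReal (chartDensity x e' y) *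
      (A ∩ e.source).indicator 1 (e'.symm y) =
      ∫⁻ y in S, ENNReal.ofReal |(fderiv ℝ τ y).det| *
        (ENNReal.ofReal (chartDensity x e (τ y)) * A.indicator 1 (e.symm (τ y))) := by
    rw [← lintegral_indicator e'.open_target.measurableSet,
      ← lintegral_indicator hSo.measurableSet]
    congr 1
    funext y
    by_cases hy : y ∈ S
    · rw [Set.indicator_of_mem hy.1, Set.indicator_of_mem hy, hdens y hy, hes y hy,
        ENNReal.ofReal_mul (abs_nonneg _), mul_assoc]
      congr 2
      have : e'.symm y ∈ e.source := hy.2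
      by_cases hyA : e'.symm y ∈ A
      · rw [Set.indicator_of_mem hyA,
          Set.indicator_of_mem (show e'.symm y ∈ A ∩ e.source from ⟨hyA, this⟩)]
      · rw [Set.indicator_of_notMem hyA, Set.indicator_of_notMem fun h => hyA h.1]
    · rw [Set.indicator_of_notMem hy]
      by_cases hy' : y ∈ e'.target
      · rw [Set.indicator_of_mem hy', Set.indicator_of_notMem fun h => hy ⟨hy', h.2⟩, mul_zero]
      · rw [Set.indicator_of_notMem hy']
  rw [l3, ← lintegral_image_eq_lintegral_abs_det_fderiv_mul volume hSo.measurableSet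
    (fun y hy => (hτd y hy).hasFDerivWithinAt) hτinj
    (fun z => ENNReal.ofReal (chartDensity x e z) * A.indicator 1 (e.symm z))]
  exact lintegral_mono_set (by rintro _ ⟨y, hy, rfl⟩; exact hτt y hy)

theorem chartVolume_le_riemVolume (p : M) :
    chartVolume x (chartAt (Euc n) p) ≤ riemVolume (n := n) x :=
  le_iSup (fun p : M => chartVolume x (chartAt (Euc n) p)) p

/-- The supremum is dominated by any measure that dominates every chart volume. Here that measure is
the volume of the given chart plus the Riemannian volume of the complement of its domain, and the
latter vanishes on the domain. -/
theorem riemVolume_restrict_source (hx : IsImm (n := n) x) (p : M) :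
    (riemVolume (n := n) x).restrict (chartAt (Euc n) p).source =
      chartVolume x (chartAt (Euc n) p) := by
  set e := chartAt (Euc n) p with he
  have hU : MeasurableSet e.source := e.open_source.measurableSet
  have h1 : riemVolume (n := n) x ≤
      chartVolume x e + (riemVolume (n := n) x).restrict e.sourceᶜ := by
    refine iSup_le fun q => Measure.le_iff.2 fun A hA => ?_
    rw [← measure_inter_add_sdiff A hU, Measure.add_apply, Measure.restrict_apply hA]
    refine add_le_add (chartVolume_inter_le hx p q hA) ?_
    exact chartVolume_le_riemVolume (x := x) q _
  have h0 : (chartVolume x e).restrict e.source = chartVolume x e := by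
    rw [Measure.restrict_eq_self_of_ae_mem]
    rw [ae_iff]
    exact chartVolume_compl_source e
  refine le_antisymm ?_ ?_
  · calc (riemVolume (n := n) x).restrict e.source
        ≤ (chartVolume x e + (riemVolume (n := n) x).restrict e.sourceᶜ).restrict e.source :=
          Measure.restrict_mono le_rfl h1
      _ = chartVolume x e := by
          rw [Measure.restrict_add, h0, Measure.restrict_restrict hU, Set.inter_compl_self,
            Measure.restrict_empty, add_zero]
  · rw [← h0]
    exact Measure.restrict_mono le_rfl (chartVolume_le_riemVolume p)

/-- The Gaussian weight. -/
def gaussWeight (n : ℕ) (v : Euc N) : ℝ :=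
  (4 * Real.pi) ^ (-(n : ℝ) / 2) * Real.exp (-‖v‖ ^ 2 / 4)

theorem gaussWeight_pos (v : Euc N) : 0 < gaussWeight n v :=
  mul_pos (Real.rpow_pos_of_pos (by positivity) _) (Real.exp_pos _)

theorem contDiff_gaussWeight : ContDiff ℝ ∞ (gaussWeight (N := N) n) := by
  unfold gaussWeight
  exact contDiff_const.mul (((contDiff_norm_sq ℝ).neg.div_const 4).exp)

theorem measurable_gaussWeight_comp (hx : Continuous x) :
    Measurable fun p => ENNReal.ofReal (gaussWeight n (x p)) :=
  ((contDiff_gaussWeight (N := N) (n := n)).continuous.comp hx).measurable.ennreal_ofReal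

theorem gaussMeasure_eq : gaussMeasure (n := n) x =
    (riemVolume (n := n) x).withDensity fun p => ENNReal.ofReal (gaussWeight n (x p)) := rfl

/-- Integrals of functions supported in a chart domain. -/
theorem integral_gaussMeasure_chart (hx : IsImm (n := n) x) (q : M) {g : M → ℝ}
    (hg : Continuous g) (hs : ∀ p ∉ (chartAt (Euc n) q).source, g p = 0) :
    ∫ p, g p ∂(gaussMeasure (n := n) x) = ∫ y in (chartAt (Euc n) q).target,
      chartRep (n := n) g q y *
        (chartDensity x (chartAt (Euc n) q) y * gaussWeight n (chartRep (n := n) x q y)) := by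
  have hw := measurable_gaussWeight_comp (n := n) hx.smooth.continuous
  rw [gaussMeasure_eq, integral_withDensity_eq_integral_toReal_smul hw
    (by simp), ← setIntegral_eq_integral_of_forall_compl_eq_zero
      (s := (chartAt (Euc n) q).source) (fun p hp => by simp [hs p hp]),
    riemVolume_restrict_source hx q]
  unfold chartVolume
  have hc : Continuous fun p => (ENNReal.ofReal (gaussWeight n (x p))).toReal • g p := by
    have : (fun p => (ENNReal.ofReal (gaussWeight n (x p))).toReal • g p) =
        fun p => gaussWeight n (x p) * g p := by
      funext p; rw [ENNReal.toReal_ofReal (gaussWeight_pos _).le, smul_eq_mul]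
    rw [this]
    exact ((contDiff_gaussWeight (N := N) (n := n)).continuous.comp hx.smooth.continuous).mul hg
  rw [integral_map (aemeasurable_chart_symm _ _) hc.measurable.aestronglyMeasurable,
    integral_withDensity_eq_integral_toReal_smul (measurable_chartDensity _).ennreal_ofReal
      (by simp)]
  refine integral_congr_ae (Filter.Eventually.of_forall fun y => ?_)
  simp only [smul_eq_mul, chartRep, Function.comp_apply]
  rw [ENNReal.toReal_ofReal (gaussWeight_pos _).le, ENNReal.toReal_ofReal (show 0 ≤ chartDensity x _ y from Real.sqrt_nonneg _)]
  ring

/-- The Gaussian measure charges every nonempty open set. -/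
theorem isOpenPosMeasure_gaussMeasure (hx : IsImm (n := n) x) :
    (gaussMeasure (n := n) x).IsOpenPosMeasure := by
  refine ⟨fun U hU hne h0 => ?_⟩
  obtain ⟨p, hp⟩ := hne
  rw [gaussMeasure_eq, withDensity_apply_eq_zero
    (measurable_gaussWeight_comp (n := n) hx.smooth.continuous)] at h0
  have h1 : {p | ENNReal.ofReal (gaussWeight n (x p)) ≠ 0} = Set.univ := by
    ext p; simp [gaussWeight_pos]
  rw [h1, Set.univ_inter] at h0
  set e := chartAt (Euc n) p with he
  have h2 : chartVolume x e U = 0 :=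
    le_antisymm ((chartVolume_le_riemVolume (x := x) p U).trans_eq h0) bot_le
  have l2 := lintegral_chartVolume (x := x) e (f := U.indicator 1)
    (measurable_one.indicator hU.measurableSet)
  rw [lintegral_indicator_one hU.measurableSet, h2] at l2
  set S := e.target ∩ e.symm ⁻¹' U with hS
  have hSo : IsOpen S := e.isOpen_inter_preimage_symm hU
  have hps : e p ∈ S := ⟨mem_chart_target _ p, by
    simp only [Set.mem_preimage]; rw [e.left_inv (mem_chart_source _ p)]; exact hp⟩
  have l3 : ∫⁻ y in S, ENNReal.ofReal (chartDensity x e y) = 0 := by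
    refine le_antisymm ?_ bot_le
    rw [l2, ← lintegral_indicator hSo.measurableSet,
      ← lintegral_indicator e.open_target.measurableSet]
    refine lintegral_mono fun y => ?_
    by_cases hy : y ∈ S
    · have hyU : e.symm y ∈ U := hy.2
      rw [Set.indicator_of_mem hy, Set.indicator_of_mem hy.1, Set.indicator_of_mem hyU]
      simp
    · rw [Set.indicator_of_notMem hy]
      exact bot_le
  rw [lintegral_eq_zero_iff (measurable_chartDensity e).ennreal_ofReal] at l3
  have l4 : ∀ᵐ y ∂(volume : Measure (Euc n)), y ∉ S := by
    have := (ae_restrict_iff' hSo.measurableSet).1 l3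
    filter_upwards [this] with y hy hyS
    have h3 := hy hyS
    simp only [Pi.zero_apply, ENNReal.ofReal_eq_zero] at h3
    have h4 : 0 < chartDensity x e y :=
      Real.sqrt_pos.2 (det_gram_pos _ (hx.injective_chart' p hyS.1))
    linarith
  rw [ae_iff] at l4
  simp only [not_not, Set.ofPred_mem_eq] at l4
  exact (hSo.measure_pos volume ⟨_, hps⟩).ne' l4

end ChartVolume


/-! ### Derivative of the Gram determinant -/

section DetDerivative

variable {n N : ℕ}

/-- The determinant as a function of the entries. -/
def detFun (a : Fin n → Fin n → ℝ) : ℝ := (Matrix.of a).det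

theorem contDiff_detFun : ContDiff ℝ ∞ (detFun (n := n)) := by
  unfold detFun
  simp only [Matrix.det_apply, Matrix.of_apply]
  refine ContDiff.sum fun σ _ => ContDiff.const_smul _ ?_
  refine contDiff_prod fun i _ => ?_
  fun_prop

/-- Jacobi's formula without an inverse: `det (A + t A M) = det A * det (1 + t M)`, and the linear
coefficient of the last factor is the trace. -/
theorem fderiv_detFun_mul (A M : Matrix (Fin n) (Fin n) ℝ) :
    fderiv ℝ (detFun (n := n)) (fun i j => A i j) (fun i j => (A * M) i j) =
      A.det * M.trace := by
  have h1 : HasFDerivAt (detFun (n := n)) (fderiv ℝ detFun (fun i j => A i j))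
      ((fun i j => A i j) + (0 : ℝ) • (fun i j => (A * M) i j)) := by
    rw [zero_smul, add_zero]
    exact (contDiff_detFun.differentiable (by simp) _).hasFDerivAt
  have h2 : HasDerivAt (fun t : ℝ => (fun i j => A i j) + t • (fun i j => (A * M) i j))
      (fun i j => (A * M) i j) 0 := by
    simpa using ((hasDerivAt_id (0 : ℝ)).smul_const (fun i j => (A * M) i j)).const_add
      (fun i j => A i j)
  have h3 := h1.comp_hasDerivAt (0 : ℝ) h2
  have h4 : (detFun ∘ fun t : ℝ => (fun i j => A i j) + t • (fun i j => (A * M) i j)) =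
      fun t : ℝ => A.det * (1 + M.trace * t + Polynomial.eval t
        (1 + (Polynomial.X : Polynomial ℝ) • M.map (⇑Polynomial.C)).det.divX.divX * t ^ 2) := by
    funext t
    rw [← Matrix.det_one_add_smul, ← Matrix.det_mul, mul_add, mul_one, Matrix.mul_smul]
    rfl
  rw [h4] at h3
  have h5 : HasDerivAt (fun t : ℝ => A.det * (1 + M.trace * t + Polynomial.eval t
        (1 + (Polynomial.X : Polynomial ℝ) • M.map (⇑Polynomial.C)).det.divX.divX * t ^ 2)) (A.det * M.trace) 0 := by
    have := ((((hasDerivAt_id (0 : ℝ)).const_mul M.trace).const_add 1).add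
      ((Polynomial.hasDerivAt (1 + (Polynomial.X : Polynomial ℝ) • M.map (⇑Polynomial.C)).det.divX.divX 0).mul
        (hasDerivAt_pow 2 (0 : ℝ)))).const_mul A.det
    simpa using this
  exact h3.unique h5

/-- Replacing `h` by `f ∘ f⁺ ∘ h` changes it by vectors orthogonal to the range of `f`, which the
inner product does not see. -/
theorem gram_mul_stdMatrix (f h : Euc n →L[ℝ] Euc N) (hf : Function.Injective f) (i j : Fin n) :
    (gram f * stdMatrix (pinv f ∘L h)) i j = ⟪f (stdVec i), h (stdVec j)⟫_ℝ := by
  have e1 : ⟪f (stdVec i), h (stdVec j)⟫_ℝ = ⟪f (stdVec i), f (pinv f (h (stdVec j)))⟫_ℝ := by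
    rw [apply_pinv f hf, ← Submodule.inner_starProjection_left_eq_right]
    congr 1
    exact (Submodule.starProjection_eq_self_iff.2
      (LinearMap.mem_range_self (f : Euc n →ₗ[ℝ] Euc N) (stdVec i))).symm
  rw [e1, inner_apply_stdVec_sum f _ (pinv f (h (stdVec j)))]
  simp only [Matrix.mul_apply, gram, stdMatrix, Matrix.of_apply, ContinuousLinearMap.comp_apply]
  exact Finset.sum_congr rfl fun k _ => mul_comm _ _

/-- With `G` the Gram matrix and `S` the matrix of `B⁺ ∘ dB`, the derivative of `G` is `G S + Sᵀ G =
G (S + G⁻¹ Sᵀ G)`. Both summands in brackets have trace `tr S`, whence the factor 2. -/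
theorem fderiv_det_gram {E : Type*} [NormedAddCommGroup E] [NormedSpace ℝ E]
    {B : E → Euc n →L[ℝ] Euc N} {y : E} (hB : DifferentiableAt ℝ B y)
    (hf : Function.Injective (B y)) (v : E) :
    fderiv ℝ (fun z => (gram (B z)).det) y v =
      (gram (B y)).det * (2 * LinearMap.trace ℝ (Euc n)
        ((pinv (B y) ∘L fderiv ℝ B y v : Euc n →L[ℝ] Euc n) : Euc n →ₗ[ℝ] Euc n)) := by
  have hBi : ∀ i : Fin n, DifferentiableAt ℝ (fun z => B z (stdVec i)) y := fun i =>
    hB.clm_apply (differentiableAt_const _)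
  have hBv : ∀ i : Fin n, fderiv ℝ (fun z => B z (stdVec i)) y v = fderiv ℝ B y v (stdVec i) := by
    intro i
    rw [fderiv_clm_apply hB (differentiableAt_const _), fderiv_const_apply]
    simp
  have hG : HasFDerivAt (fun z => (fun i j => gram (B z) i j : Fin n → Fin n → ℝ))
      (fderiv ℝ (fun z => (fun i j => gram (B z) i j : Fin n → Fin n → ℝ)) y) y := by
    refine DifferentiableAt.hasFDerivAt ?_
    rw [differentiableAt_pi]
    intro i
    rw [differentiableAt_pi]
    intro j
    exact (hBi i).inner ℝ (hBi j)
  have hGv : fderiv ℝ (fun z => (fun i j => gram (B z) i j : Fin n → Fin n → ℝ)) y v =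
      fun i j => (gram (B y) * (stdMatrix (pinv (B y) ∘L fderiv ℝ B y v) +
        (gram (B y))⁻¹ * ((stdMatrix (pinv (B y) ∘L fderiv ℝ B y v)).transpose *
          gram (B y)))) i j := by
    funext i j
    have e1 : fderiv ℝ (fun z => (fun i j => gram (B z) i j : Fin n → Fin n → ℝ)) y v i j =
        fderiv ℝ (fun z => gram (B z) i j) y v := by
      have h1 := (hasFDerivAt_pi'.1 hG) i
      have h2 := (hasFDerivAt_pi'.1 h1) j
      rw [h2.fderiv]
      rfl
    rw [e1]
    have hdet : IsUnit (gram (B y)).det := (det_gram_pos _ hf).ne'.isUnit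
    rw [mul_add, ← mul_assoc (gram (B y)) (gram (B y))⁻¹, Matrix.mul_nonsing_inv _ hdet, one_mul,
      Matrix.add_apply]
    have hs : (gram (B y)).transpose = gram (B y) := by
      ext a b; simp [gram, real_inner_comm]
    have e2 : ((stdMatrix (pinv (B y) ∘L fderiv ℝ B y v)).transpose * gram (B y)) i j =
        (gram (B y) * stdMatrix (pinv (B y) ∘L fderiv ℝ B y v)) j i := by
      rw [← Matrix.transpose_apply (gram (B y) * _) i j, Matrix.transpose_mul, hs]
    rw [e2, gram_mul_stdMatrix _ _ hf, gram_mul_stdMatrix _ _ hf]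
    have e3 : (fun z => gram (B z) i j) = fun z => ⟪B z (stdVec i), B z (stdVec j)⟫_ℝ := rfl
    rw [e3, fderiv_inner_apply ℝ (hBi i) (hBi j), hBv, hBv, real_inner_comm (B y (stdVec j))]
  have h3 := ((contDiff_detFun (n := n)).differentiable (by simp)
    (fun i j => gram (B y) i j)).hasFDerivAt.comp y hG
  have h4 : (fun z => (gram (B z)).det) =
    detFun ∘ fun z => (fun i j => gram (B z) i j : Fin n → Fin n → ℝ) := rfl
  rw [h4, h3.fderiv, ContinuousLinearMap.comp_apply, hGv, fderiv_detFun_mul, Matrix.trace_add,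
    ← trace_stdMatrix]
  have hdet : IsUnit (gram (B y)).det := (det_gram_pos _ hf).ne'.isUnit
  rw [Matrix.trace_mul_comm (gram (B y))⁻¹, Matrix.mul_assoc, Matrix.mul_nonsing_inv _ hdet,
    mul_one, Matrix.trace_transpose]
  ring

end DetDerivative

/-! ### Weighted divergence of the tangential part of a constant vector -/

section FirstVariation

variable {n N : ℕ} {M : Type*} [TopologicalSpace M] [ChartedSpace (Euc n) M]
  [IsManifold (𝓡 n) ∞ M]
variable {x : M → Euc N}

/-- The trace of a continuous endomorphism. -/
def tr {d : ℕ} (A : Euc d →L[ℝ] Euc d) : ℝ := LinearMap.trace ℝ (Euc d) (A : Euc d →ₗ[ℝ] Euc d)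

theorem tr_eq_sum {d : ℕ} (A : Euc d →L[ℝ] Euc d) : tr A = ∑ i, A (stdVec i) i := by
  unfold tr
  rw [LinearMap.trace_eq_sum_inner _ (EuclideanSpace.basisFun (Fin d) ℝ)]
  refine Finset.sum_congr rfl fun i _ => ?_
  rw [← inner_stdVec]
  simp [stdVec]

theorem tr_add {d : ℕ} (A B : Euc d →L[ℝ] Euc d) : tr (A + B) = tr A + tr B := by
  simp [tr_eq_sum, Finset.sum_add_distrib]

theorem tr_smul {d : ℕ} (c : ℝ) (A : Euc d →L[ℝ] Euc d) : tr (c • A) = c * tr A := by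
  simp [tr_eq_sum, Finset.mul_sum]

theorem tr_comp_comm {d e : ℕ} (A : Euc d →L[ℝ] Euc e) (B : Euc e →L[ℝ] Euc d) :
    tr (B ∘L A) = tr (A ∘L B) :=
  LinearMap.trace_comp_comm' (A : Euc d →ₗ[ℝ] Euc e) (B : Euc e →ₗ[ℝ] Euc d)

theorem tr_smulRight {d : ℕ} (f : Euc d →L[ℝ] ℝ) (v : Euc d) : tr (f.smulRight v) = f v := by
  rw [tr_eq_sum]
  conv_rhs => rw [← stdVec_sum v]
  simp [mul_comm]

/-- The weighted density of a chart. -/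
def chartWeight (x : M → Euc N) (q : M) (y : Euc n) : ℝ :=
  chartDensity x (chartAt (Euc n) q) y * gaussWeight n (chartRep (n := n) x q y)

theorem fderiv_gaussWeight_comp {X : Euc n → Euc N} {y : Euc n} (hX : DifferentiableAt ℝ X y)
    (v : Euc n) : fderiv ℝ (fun z => gaussWeight n (X z)) y v =
      gaussWeight n (X y) * (-(1 / 2 : ℝ) * ⟪X y, fderiv ℝ X y v⟫_ℝ) := by
  have h1 : HasFDerivAt (fun z => ‖X z‖ ^ 2) _ y := hX.hasFDerivAt.norm_sq
  have h2 := ((h1.neg.mul_const (4 : ℝ)⁻¹).exp).const_mul ((4 * Real.pi) ^ (-(n : ℝ) / 2))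
  have h3 : (fun z => gaussWeight n (X z)) = fun z => (4 * Real.pi) ^ (-(n : ℝ) / 2) *
      Real.exp ((-fun z => ‖X z‖ ^ 2) z * (4 : ℝ)⁻¹) := by
    funext z; rw [gaussWeight]; simp [div_eq_mul_inv]
  rw [h3, h2.fderiv]
  simp only [gaussWeight, Pi.neg_apply, smul_apply, neg_apply, ContinuousLinearMap.comp_apply,
    innerSL_apply_apply, smul_eq_mul, nsmul_eq_mul, div_eq_mul_inv]
  push_cast
  ring

theorem contDiffAt_det_gram_chart (hx : IsImm (n := n) x) (q : M) {y : Euc n}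
    (hy : y ∈ (chartAt (Euc n) q).target) :
    ContDiffAt ℝ ∞ (fun z => (gram (fderiv ℝ (chartRep (n := n) x q) z)).det) y := by
  have h1 : ContDiffAt ℝ ∞
      (fun z => (fun i j => gram (fderiv ℝ (chartRep (n := n) x q) z) i j)) y := by
    rw [contDiffAt_pi]
    intro i
    rw [contDiffAt_pi]
    intro j
    exact ((contDiffAt_fderiv_chartRep hx.smooth q hy).clm_apply contDiffAt_const).inner ℝ
      ((contDiffAt_fderiv_chartRep hx.smooth q hy).clm_apply contDiffAt_const)
  exact (contDiff_detFun (n := n)).contDiffAt.comp y h1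

theorem contDiffAt_chartDensity (hx : IsImm (n := n) x) (q : M) {y : Euc n}
    (hy : y ∈ (chartAt (Euc n) q).target) :
    ContDiffAt ℝ ∞ (chartDensity x (chartAt (Euc n) q)) y :=
  (contDiffAt_det_gram_chart hx q hy).sqrt (det_gram_pos _ (hx.injective_chart' q hy)).ne'

theorem fderiv_chartDensity (hx : IsImm (n := n) x) (q : M) {y : Euc n}
    (hy : y ∈ (chartAt (Euc n) q).target) (v : Euc n) :
    fderiv ℝ (chartDensity x (chartAt (Euc n) q)) y v = chartDensity x (chartAt (Euc n) q) y *
      tr (pinv (fderiv ℝ (chartRep (n := n) x q) y) ∘L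
        fderiv ℝ (fderiv ℝ (chartRep (n := n) x q)) y v) := by
  have hinj := hx.injective_chart' q hy
  have hpos := det_gram_pos _ hinj
  have h1 := ((contDiffAt_det_gram_chart hx q hy).differentiableAt (by simp)).hasFDerivAt.sqrt
    hpos.ne'
  have h2 : chartDensity x (chartAt (Euc n) q) =
    fun z => Real.sqrt (gram (fderiv ℝ (chartRep (n := n) x q) z)).det := rfl
  rw [h2, h1.fderiv, smul_apply, fderiv_det_gram
    ((contDiffAt_fderiv_chartRep hx.smooth q hy).differentiableAt (by simp)) hinj, tr]
  have h3 := Real.mul_self_sqrt hpos.le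
  have h4 := (Real.sqrt_pos.2 hpos).ne'
  simp only [smul_eq_mul]
  rw [one_div, inv_mul_eq_div, div_eq_iff (by positivity)]
  nth_rewrite 1 [← h3]
  ring

theorem contDiffAt_chartWeight (hx : IsImm (n := n) x) (q : M) {y : Euc n}
    (hy : y ∈ (chartAt (Euc n) q).target) : ContDiffAt ℝ ∞ (chartWeight (n := n) x q) y :=
  (contDiffAt_chartDensity hx q hy).mul
    (contDiff_gaussWeight.contDiffAt.comp y (contDiffAt_chartRep hx.smooth q hy))

/-- The coordinate expression of the tangential part of a constant vector. -/
def chartField (x : M → Euc N) (q : M) (w : Euc N) (y : Euc n) : Euc n :=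
  pinv (fderiv ℝ (chartRep (n := n) x q) y) w

theorem contDiffAt_chartField (hx : IsImm (n := n) x) (q : M) (w : Euc N) {y : Euc n}
    (hy : y ∈ (chartAt (Euc n) q).target) : ContDiffAt ℝ ∞ (chartField (n := n) x q w) y :=
  (contDiffAt_pinv_chartRep hx q hy).clm_apply contDiffAt_const

theorem proj_chartRep (hx : IsImm (n := n) x) (q : M) {y : Euc n}
    (hy : y ∈ (chartAt (Euc n) q).target) : chartRep (n := n) (proj (n := n) x) q y =
      fderiv ℝ (chartRep (n := n) x q) y ∘L pinv (fderiv ℝ (chartRep (n := n) x q) y) := by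
  have := proj_chart hx q ((chartAt (Euc n) q).map_target hy)
  rwa [(chartAt (Euc n) q).right_inv hy] at this

/-- The trace of the derivative of the pseudo-inverse, applied to a normal vector. -/
theorem tr_fderiv_pinv_normal (hx : IsImm (n := n) x) (q : M) (w : Euc N) {y : Euc n}
    (hy : y ∈ (chartAt (Euc n) q).target) :
    tr ((fderiv ℝ (fun z => pinv (fderiv ℝ (chartRep (n := n) x q) z)) y).flip
      (norPart (n := n) x ((chartAt (Euc n) q).symm y) w)) =
    ⟪∑ i, dproj (n := n) x (stdVec i) ((chartAt (Euc n) q).symm y) (stdVec i), w⟫_ℝ := by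
  set p := (chartAt (Euc n) q).symm y with hp
  set B := fderiv ℝ (chartRep (n := n) x q) with hB
  set P := fun z => pinv (B z) with hP
  have hps : p ∈ (chartAt (Euc n) q).source := (chartAt (Euc n) q).map_target hy
  have hep : chartAt (Euc n) q p = y := (chartAt (Euc n) q).right_inv hy
  have hBd : DifferentiableAt ℝ B y :=
    (contDiffAt_fderiv_chartRep hx.smooth q hy).differentiableAt (by simp)
  have hPd : DifferentiableAt ℝ P y := (contDiffAt_pinv_chartRep hx q hy).differentiableAt (by simp)
  have hproj : proj (n := n) x p = B y ∘L P y := proj_chartRep hx q hy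
  have hQ : P y (norPart (n := n) x p w) = 0 := by
    apply hx.injective_chart' q hy
    have : B y (P y (norPart (n := n) x p w)) = proj (n := n) x p (norPart (n := n) x p w) := by
      rw [hproj]; rfl
    rw [map_zero]
    exact this.trans (proj_norPart p w)
  -- the derivative of the projection on a normal vector
  have h1 : ∀ v : Euc N, dproj (n := n) x v p (norPart (n := n) x p w) =
      B y (fderiv ℝ P y (P y v) (norPart (n := n) x p w)) := by
    intro v
    have e1 := hx.tanDeriv_chart (mdiffAt_of_contMDiff (smooth_proj hx) p) q hps v
    rw [hep] at e1
    have e2 : chartRep (n := n) (proj (n := n) x) q =ᶠ[𝓝 y] fun z => B z ∘L P z := by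
      filter_upwards [eventually_mem_target q hy] with z hz
      exact proj_chartRep hx q hz
    rw [e2.fderiv_eq, fderiv_clm_comp hBd hPd] at e1
    have e3 := congrArg (fun A : Euc N →L[ℝ] Euc N => A (norPart (n := n) x p w)) e1
    simp only [add_apply, ContinuousLinearMap.comp_apply, ContinuousLinearMap.compL_apply,
      ContinuousLinearMap.flip_apply, hQ, map_zero, add_zero] at e3
    exact e3
  have h2 : ⟪∑ i, dproj (n := n) x (stdVec i) p (stdVec i), w⟫_ℝ =
      ∑ i, ⟪stdVec i, dproj (n := n) x (stdVec i) p (norPart (n := n) x p w)⟫_ℝ := by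
    have e1 := norPart_of_normal (proj_sum_dproj hx p)
    rw [← e1, inner_norPart, sum_inner]
    exact Finset.sum_congr rfl fun i _ => inner_dproj hx _ _ _ p
  rw [h2]
  set S : Euc n →L[ℝ] Euc n := (fderiv ℝ P y).flip (norPart (n := n) x p w) with hS
  have h3 : ∑ i, ⟪stdVec i, dproj (n := n) x (stdVec i) p (norPart (n := n) x p w)⟫_ℝ =
      tr (B y ∘L (S ∘L P y)) := by
    rw [tr_eq_sum]
    refine Finset.sum_congr rfl fun i _ => ?_
    rw [h1, inner_stdVec]
    rfl
  -- Cyclicity brings `dX⁺ ∘ dX = 1` together inside the trace.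
  rw [h3, ← tr_comp_comm]
  congr 1
  ext1 v
  have : P y (B y v) = v := pinv_apply_self _ (hx.injective_chart' q hy) v
  simp only [ContinuousLinearMap.comp_apply, this]

/-- The divergence of the weighted coordinate field of a constant vector. -/
theorem tr_fderiv_weighted_field (hx : IsShrinker (n := n) x) (q : M) (w : Euc N) {y : Euc n}
    (hy : y ∈ (chartAt (Euc n) q).target) :
    tr (fderiv ℝ (fun z => chartWeight (n := n) x q z • chartField (n := n) x q w z) y) =
      -(1 / 2 : ℝ) * ⟪chartRep (n := n) x q y, w⟫_ℝ * chartWeight (n := n) x q y := by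
  have hi := hx.isImm
  set p := (chartAt (Euc n) q).symm y with hp
  set X := chartRep (n := n) x q with hX
  set B := fderiv ℝ X with hB
  set P := fun z => pinv (B z) with hP
  have hXy : X y = x p := rfl
  have hXd : DifferentiableAt ℝ X y := differentiableAt_chartRep hx.smooth q hy
  have hBd : DifferentiableAt ℝ B y :=
    (contDiffAt_fderiv_chartRep hx.smooth q hy).differentiableAt (by simp)
  have hPd : DifferentiableAt ℝ P y := (contDiffAt_pinv_chartRep hi q hy).differentiableAt (by simp)
  have hproj : proj (n := n) x p = B y ∘L P y := proj_chartRep hi q hy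
  have hWd : DifferentiableAt ℝ (chartWeight (n := n) x q) y :=
    (contDiffAt_chartWeight hi q hy).differentiableAt (by simp)
  have hVd : DifferentiableAt ℝ (chartField (n := n) x q w) y :=
    (contDiffAt_chartField hi q w hy).differentiableAt (by simp)
  set V := chartField (n := n) x q w y with hV
  have hBV : B y V = proj (n := n) x p w := by rw [hproj]; rfl
  rw [fderiv_fun_smul hWd hVd, tr_add, tr_smul, tr_smulRight]
  have e1 : fderiv ℝ (chartField (n := n) x q w) y = (fderiv ℝ P y).flip w := by
    have : chartField (n := n) x q w = fun z => P z w := rfl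
    rw [this, fderiv_clm_apply hPd (differentiableAt_const w), fderiv_const_apply]
    simp
  have e2 : fderiv ℝ (chartWeight (n := n) x q) y V = chartWeight (n := n) x q y *
      (tr (P y ∘L fderiv ℝ B y V) - (1 / 2 : ℝ) * ⟪x p, proj (n := n) x p w⟫_ℝ) := by
    have a1 : chartWeight (n := n) x q = fun z => chartDensity x (chartAt (Euc n) q) z *
      gaussWeight n (X z) := rfl
    have a2 : DifferentiableAt ℝ (fun z => gaussWeight n (X z)) y :=
      ((contDiff_gaussWeight (N := N) (n := n)).differentiable (by simp) (X y)).comp y hXd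
    rw [a1, fderiv_fun_mul ((contDiffAt_chartDensity hi q hy).differentiableAt (by simp)) a2, add_apply, smul_apply,
      smul_apply, fderiv_gaussWeight_comp hXd, fderiv_chartDensity hi q hy, hXy, ← hB, hBV]
    simp only [smul_eq_mul, hXy, show P y = pinv (B y) from rfl]
    ring
  -- Differentiating `dX⁺ ∘ dX = 1` and using the symmetry of the second derivative, the growth of
  -- the volume density is seen to cancel the trace of the derivative of `dX⁺` on the tangential
  -- part of `w`.
  have e3 : P y ∘L fderiv ℝ B y V = - (fderiv ℝ P y).flip (proj (n := n) x p w) := by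
    ext1 v
    have hsymm : fderiv ℝ B y V v = fderiv ℝ B y v V :=
      ((contDiffAt_chartRep hx.smooth q hy).isSymmSndFDerivAt
        (by simpa using (ENat.LEInfty.out : (2 : ℕ∞ω) ≤ (∞ : ℕ∞ω)))).eq V v
    have a1 : (fun z => P z ∘L B z) =ᶠ[𝓝 y] fun _ => ContinuousLinearMap.id ℝ (Euc n) := by
      filter_upwards [eventually_mem_target q hy] with z hz
      ext1 u
      exact pinv_apply_self _ (hi.injective_chart' q hz) u
    have a2 := a1.fderiv_eq (𝕜 := ℝ)
    rw [fderiv_const_apply, fderiv_clm_comp hPd hBd] at a2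
    have a3 := congrArg (fun A : Euc n →L[ℝ] Euc n →L[ℝ] Euc n => A v V) a2
    simp only [add_apply, ContinuousLinearMap.comp_apply, ContinuousLinearMap.compL_apply,
      ContinuousLinearMap.flip_apply, zero_apply] at a3
    rw [ContinuousLinearMap.comp_apply, hsymm, neg_apply, ContinuousLinearMap.flip_apply, ← hBV]
    exact eq_neg_of_add_eq_zero_left a3
  have e4 : (fderiv ℝ P y).flip w = (fderiv ℝ P y).flip (proj (n := n) x p w) +
      (fderiv ℝ P y).flip (norPart (n := n) x p w) := by
    rw [← map_add, proj_add_norPart]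
  have e5 := tr_fderiv_pinv_normal hi q w hy
  rw [sum_dproj_stdVec hx, inner_smul_left] at e5
  have e6 : tr (-(fderiv ℝ P y).flip (proj (n := n) x p w)) =
      - tr ((fderiv ℝ P y).flip (proj (n := n) x p w)) := by
    simp [tr_eq_sum]
  have e7 : tr ((fderiv ℝ P y).flip (norPart (n := n) x p w)) =
      -(1 / 2 : ℝ) * ⟪norPart (n := n) x p (x p), w⟫_ℝ := e5
  -- The Gaussian weight contributes the tangential part of `⟪x, w⟫` and the mean curvature
  -- contributes the normal part. The shrinker equation gives both the coefficient `-1/2`.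
  have e8 : ⟪x p, w⟫_ℝ = ⟪x p, proj (n := n) x p w⟫_ℝ + ⟪norPart (n := n) x p (x p), w⟫_ℝ := by
    rw [inner_norPart, ← inner_add_right, proj_add_norPart]
  rw [e1, e2, e3, e4, tr_add, e6, e7, hXy, e8]
  ring

end FirstVariation


/-! ### Integration by parts in Euclidean space -/

section IntegrationByParts

variable {d : ℕ}

theorem contDiff_indicator_of_tsupport {U K : Set (Euc d)} {a : Euc d → ℝ} (hU : IsOpen U)
    (hK : IsCompact K) (ha : ∀ y ∈ U, ContDiffAt ℝ ∞ a y) (hKU : K ⊆ U)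
    (h0 : ∀ y ∈ U, y ∉ K → a y = 0) : ContDiff ℝ ∞ (U.indicator a) := by
  rw [contDiff_iff_contDiffAt]
  intro y
  by_cases hy : y ∈ U
  · refine (ha y hy).congr_of_eventuallyEq ?_
    filter_upwards [hU.mem_nhds hy] with z hz
    exact Set.indicator_of_mem hz a
  · have hyK : y ∉ K := fun h => hy (hKU h)
    refine (contDiffAt_const (c := (0 : ℝ))).congr_of_eventuallyEq ?_
    filter_upwards [hK.isClosed.isOpen_compl.mem_nhds hyK] with z hz
    by_cases hzU : z ∈ U
    · rw [Set.indicator_of_mem hzU, h0 z hzU hz]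
    · exact Set.indicator_of_notMem hzU a

theorem continuous_mul_of_tsupport {U K : Set (Euc d)} {a b : Euc d → ℝ}
    (hK : IsCompact K) (hKU : K ⊆ U) (ha : Continuous a) (hb : ∀ y ∈ U, ContinuousAt b y)
    (h0 : ∀ y ∉ K, a y = 0) : Continuous fun y => a y * b y := by
  rw [continuous_iff_continuousAt]
  intro y
  by_cases hy : y ∈ U
  · exact ha.continuousAt.mul (hb y hy)
  · have hyK : y ∉ K := fun h => hy (hKU h)
    refine (continuousAt_const (y := (0 : ℝ))).congr ?_
    filter_upwards [hK.isClosed.isOpen_compl.mem_nhds hyK] with z hz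
    rw [h0 z hz, zero_mul]

theorem integrable_mul_of_tsupport {U K : Set (Euc d)} {a b : Euc d → ℝ}
    (hK : IsCompact K) (hKU : K ⊆ U) (ha : Continuous a) (hb : ∀ y ∈ U, ContinuousAt b y)
    (h0 : ∀ y ∉ K, a y = 0) : Integrable (fun y => a y * b y) (volume : Measure (Euc d)) :=
  (continuous_mul_of_tsupport hK hKU ha hb h0).integrable_of_hasCompactSupport
    (HasCompactSupport.intro hK fun y hy => by simp [h0 y hy])

/-- Integration by parts against a vector field that is only smooth near the support. -/
theorem integral_fderiv_apply_field {U K : Set (Euc d)} {a : Euc d → ℝ} {F : Euc d → Euc d}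
    (hK : IsCompact K) (hKU : K ⊆ U) (ha : ContDiff ℝ ∞ a)
    (h0 : ∀ y ∉ K, a y = 0) (hF : ∀ y ∈ U, ContDiffAt ℝ ∞ F y) :
    ∫ y, fderiv ℝ a y (F y) = - ∫ y, a y * tr (fderiv ℝ F y) := by
  have hts : tsupport a ⊆ K := closure_minimal (fun y hy => by
    by_contra h; exact hy (h0 y h)) hK.isClosed
  have hFi : ∀ (i : Fin d), ∀ y ∈ U, ContDiffAt ℝ ∞ (fun z => F z i) y := fun i y hy =>
    (EuclideanSpace.proj (𝕜 := ℝ) i).contDiff.contDiffAt.comp y (hF y hy)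
  have hdF : ∀ i : Fin d, ∀ y ∈ U, fderiv ℝ (fun z => F z i) y (stdVec i) =
      fderiv ℝ F y (stdVec i) i := by
    intro i y hy
    have h1 := ((EuclideanSpace.proj (𝕜 := ℝ) i).hasFDerivAt (x := F y)).comp y
      ((hF y hy).differentiableAt (by simp)).hasFDerivAt
    have h2 : (fun z => F z i) = (EuclideanSpace.proj (𝕜 := ℝ) i : Euc d →L[ℝ] ℝ) ∘ F := rfl
    rw [h2, h1.fderiv]
    rfl
  have hda : ∀ v : Euc d, Continuous fun y => fderiv ℝ a y v := fun v =>
    (ha.continuous_fderiv (by simp)).clm_apply continuous_const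
  have hda0 : ∀ v : Euc d, ∀ y ∉ K, fderiv ℝ a y v = 0 := by
    intro v y hy
    have : a =ᶠ[𝓝 y] fun _ => (0 : ℝ) := by
      filter_upwards [hK.isClosed.isOpen_compl.mem_nhds hy] with z hz using h0 z hz
    rw [this.fderiv_eq, fderiv_const_apply, zero_apply]
  have hcF : ∀ i : Fin d, ∀ y ∈ U, ContinuousAt (fun z => F z i) y := fun i y hy =>
    (hFi i y hy).continuousAt
  have hcdF : ∀ i : Fin d, ∀ y ∈ U,
      ContinuousAt (fun z => fderiv ℝ (fun z => F z i) z (stdVec i)) y := fun i y hy =>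
    (((hFi i y hy).fderiv_right (m := ∞) (by simp)).clm_apply contDiffAt_const).continuousAt
  have i1 : ∀ i : Fin d, Integrable (fun y => fderiv ℝ a y (stdVec i) * F y i)
      (volume : Measure (Euc d)) := fun i =>
    integrable_mul_of_tsupport hK hKU (hda _) (hcF i) (hda0 _)
  have i2 : ∀ i : Fin d, Integrable
      (fun y => a y * fderiv ℝ (fun z => F z i) y (stdVec i)) (volume : Measure (Euc d)) := fun i =>
    integrable_mul_of_tsupport hK hKU ha.continuous (hcdF i) h0
  have i3 : ∀ i : Fin d, Integrable (fun y => a y * F y i) (volume : Measure (Euc d)) := fun i =>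
    integrable_mul_of_tsupport hK hKU ha.continuous (hcF i) h0
  have key : ∀ i : Fin d, ∫ y, a y * fderiv ℝ (fun z => F z i) y (stdVec i) =
      - ∫ y, fderiv ℝ a y (stdVec i) * F y i := fun i =>
    integral_mul_fderiv_eq_neg_fderiv_mul_of_integrable (i1 i) (i2 i) (i3 i)
      (fun y _ => ha.differentiable (by simp) y)
      (fun y hy => (hFi i y (hKU (hts hy))).differentiableAt (by simp))
  have e1 : ∀ y, fderiv ℝ a y (F y) = ∑ i, fderiv ℝ a y (stdVec i) * F y i := by
    intro y
    conv_lhs => rw [← stdVec_sum (F y)]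
    simp [mul_comm]
  have e2 : ∀ y, a y * tr (fderiv ℝ F y) =
      ∑ i, a y * fderiv ℝ (fun z => F z i) y (stdVec i) := by
    intro y
    by_cases hy : y ∈ K
    · rw [tr_eq_sum, Finset.mul_sum]
      exact Finset.sum_congr rfl fun i _ => by rw [hdF i y (hKU hy)]
    · simp [h0 y hy]
  simp_rw [e1, e2]
  rw [integral_finsetSum _ fun i _ => i1 i, integral_finsetSum _ fun i _ => i2 i,
    ← Finset.sum_neg_distrib]
  exact Finset.sum_congr rfl fun i _ => by rw [key, neg_neg]

end IntegrationByParts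

/-! ### First variation formula and divergence theorem -/

section Global

variable {n N : ℕ} {M : Type*} [TopologicalSpace M] [T2Space M] [ChartedSpace (Euc n) M]
  [MeasurableSpace M] [BorelSpace M] [IsManifold (𝓡 n) ∞ M]
variable {x : M → Euc N}

/-- In coordinates the left side integrates the derivative of `g` along the weighted field of `w`.
Integration by parts moves it to the divergence computed in `tr_fderiv_weighted_field`. -/
theorem integral_tanDeriv_of_chart (hx : IsShrinker (n := n) x) (q : M) {g : M → ℝ}
    (hg : Smooth n g) (hc : HasCompactSupport g)
    (hs : tsupport g ⊆ (chartAt (Euc n) q).source) (w : Euc N) :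
    ∫ p, tanDeriv (n := n) x g w p ∂(gaussMeasure (n := n) x) =
      (1 / 2 : ℝ) * ∫ p, g p * ⟪x p, w⟫_ℝ ∂(gaussMeasure (n := n) x) := by
  have hi := hx.isImm
  set e := chartAt (Euc n) q with he
  set K : Set (Euc n) := e '' tsupport g with hKdef
  have hK : IsCompact K := hc.isCompact.image_of_continuousOn (e.continuousOn.mono hs)
  have hKU : K ⊆ e.target := by
    rintro _ ⟨p, hp, rfl⟩
    exact e.map_source (hs hp)
  have hgK : ∀ y ∈ e.target, y ∉ K → chartRep (n := n) g q y = 0 := by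
    intro y hy hyK
    by_contra h
    exact hyK ⟨e.symm y, subset_tsupport g h, e.right_inv hy⟩
  set a : Euc n → ℝ := e.target.indicator (chartRep (n := n) g q) with ha
  have haC : ContDiff ℝ ∞ a := contDiff_indicator_of_tsupport e.open_target hK
    (fun y hy => contDiffAt_chartRep hg q hy) hKU hgK
  have ha0 : ∀ y ∉ K, a y = 0 := by
    intro y hyK
    by_cases hy : y ∈ e.target
    · rw [ha, Set.indicator_of_mem hy, hgK y hy hyK]
    · exact Set.indicator_of_notMem hy _
  have haU : ∀ y ∈ e.target, a y = chartRep (n := n) g q y := fun y hy =>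
    Set.indicator_of_mem hy _
  have hda : ∀ y ∈ e.target, fderiv ℝ a y = fderiv ℝ (chartRep (n := n) g q) y := by
    intro y hy
    refine Filter.EventuallyEq.fderiv_eq ?_
    filter_upwards [e.open_target.mem_nhds hy] with z hz using haU z hz
  have hda0 : ∀ y ∉ K, fderiv ℝ a y = 0 := by
    intro y hy
    have : a =ᶠ[𝓝 y] fun _ => (0 : ℝ) := by
      filter_upwards [hK.isClosed.isOpen_compl.mem_nhds hy] with z hz using ha0 z hz
    rw [this.fderiv_eq, fderiv_const_apply]
  set F : Euc n → Euc n := fun z => chartWeight (n := n) x q z • chartField (n := n) x q w z with hF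
  have hFC : ∀ y ∈ e.target, ContDiffAt ℝ ∞ F y := fun y hy =>
    (contDiffAt_chartWeight hi q hy).smul (contDiffAt_chartField hi q w hy)
  have key := integral_fderiv_apply_field hK hKU haC ha0 hFC
  have hg0 : ∀ p ∉ e.source, g p = 0 := fun p hp => image_eq_zero_of_notMem_tsupport
    fun h => hp (hs h)
  rw [integral_gaussMeasure_chart hi q (smooth_tanDeriv hi hg w).continuous
      (fun p hp => tanDeriv_eq_zero_of_notMem_tsupport (fun h => hp (hs h)) w),
    integral_gaussMeasure_chart hi q
      (hg.mul (Smooth.inner hx.smooth (contMDiff_const (c := w)))).continuous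
      (fun p hp => by rw [hg0 p hp, zero_mul])]
  have e1 : ∫ y in e.target, chartRep (n := n) (tanDeriv (n := n) x g w) q y *
      (chartDensity x e y * gaussWeight n (chartRep (n := n) x q y)) =
      ∫ y, fderiv ℝ a y (F y) := by
    rw [← setIntegral_eq_integral_of_forall_compl_eq_zero (s := e.target)
      (f := fun y => fderiv ℝ a y (F y))
      (fun y hy => by rw [hda0 y fun h => hy (hKU h), zero_apply])]
    refine setIntegral_congr_fun e.open_target.measurableSet fun y hy => ?_
    rw [hda y hy, hi.tanDeriv_chartRep hg q w hy, hF]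
    simp only [map_smul, smul_eq_mul]
    rw [mul_comm]
    rfl
  have e2 : ∫ y in e.target, chartRep (n := n) (fun p => g p * ⟪x p, w⟫_ℝ) q y *
      (chartDensity x e y * gaussWeight n (chartRep (n := n) x q y)) =
      ∫ y, -2 * (a y * tr (fderiv ℝ F y)) := by
    rw [← setIntegral_eq_integral_of_forall_compl_eq_zero (s := e.target)
      (f := fun y => -2 * (a y * tr (fderiv ℝ F y)))
      (fun y hy => by rw [ha0 y fun h => hy (hKU h), zero_mul, mul_zero])]
    refine setIntegral_congr_fun e.open_target.measurableSet fun y hy => ?_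
    rw [haU y hy, tr_fderiv_weighted_field hx q w hy]
    simp only [chartRep, Function.comp_apply, chartWeight]
    ring
  rw [e1, e2, key, integral_const_mul]
  ring

variable [SecondCountableTopology M]

/-- A partition of unity subordinate to the charts is multiplied by `g`. Only finitely many of its
members meet the compact support. -/
theorem exists_finite_chart_decomposition {g : M → ℝ} (hg : Smooth n g)
    (hc : HasCompactSupport g) :
    ∃ (s : Finset M) (G : M → M → ℝ), (∀ q, Smooth n (G q) ∧ HasCompactSupport (G q) ∧
      tsupport (G q) ⊆ (chartAt (Euc n) q).source) ∧ ∀ p, g p = ∑ q ∈ s, G q p := by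
  have : LocallyCompactSpace M := ChartedSpace.locallyCompactSpace (Euc n) M
  obtain ⟨f, hf⟩ := SmoothPartitionOfUnity.exists_isSubordinate (𝓡 n) (isClosed_univ (X := M))
    (fun q : M => (chartAt (Euc n) q).source) (fun q => (chartAt (Euc n) q).open_source)
    (fun p _ => Set.mem_iUnion.2 ⟨p, mem_chart_source _ p⟩)
  have hfin := f.locallyFinite.finite_nonempty_inter_compact hc.isCompact
  refine ⟨hfin.toFinset, fun q p => f q p * g p, fun q => ⟨?_, ?_, ?_⟩, fun p => ?_⟩
  · exact Smooth.mul (f q).contMDiff hg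
  · exact hc.mul_left
  · exact (tsupport_mul_subset_left (f := fun p => f q p) (g := g)).trans (hf q)
  · by_cases hp : p ∈ tsupport g
    · have h1 : ∑ q ∈ hfin.toFinset, f q p = 1 := by
        rw [← f.sum_eq_one (Set.mem_univ p), finsum_eq_sum_of_support_subset]
        intro q hq
        rw [Set.Finite.coe_toFinset]
        exact ⟨p, hq, hp⟩
      rw [← Finset.sum_mul, h1, one_mul]
    · have : g p = 0 := image_eq_zero_of_notMem_tsupport hp
      simp [this]

/-- Compactly supported continuous functions are integrable. -/
theorem integrable_of_compact [IsFiniteMeasure (gaussMeasure (n := n) x)] {g : M → ℝ}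
    (hg : Continuous g) (hc : HasCompactSupport g) :
    Integrable g (gaussMeasure (n := n) x) :=
  hg.integrable_of_hasCompactSupport hc

/-- The first variation formula for the Gaussian measure of a shrinker. -/
theorem integral_tanDeriv (hx : IsShrinker (n := n) x)
    [IsFiniteMeasure (gaussMeasure (n := n) x)] {g : M → ℝ}
    (hg : Smooth n g) (hc : HasCompactSupport g) (w : Euc N) :
    ∫ p, tanDeriv (n := n) x g w p ∂(gaussMeasure (n := n) x) =
      (1 / 2 : ℝ) * ∫ p, g p * ⟪x p, w⟫_ℝ ∂(gaussMeasure (n := n) x) := by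
  have hi := hx.isImm
  obtain ⟨s, G, hG, hsum⟩ := exists_finite_chart_decomposition hg hc
  have e0 : g = fun p => ∑ q ∈ s, G q p := funext hsum
  have e1 : ∀ p, tanDeriv (n := n) x g w p = ∑ q ∈ s, tanDeriv (n := n) x (G q) w p := by
    intro p
    rw [e0, tanDeriv_sum s fun q _ => (hG q).1]
  have e2 : ∀ p, g p * ⟪x p, w⟫_ℝ = ∑ q ∈ s, G q p * ⟪x p, w⟫_ℝ := by
    intro p
    rw [hsum, Finset.sum_mul]
  simp_rw [e1, e2]
  rw [integral_finsetSum _ fun q _ => integrable_of_compact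
      (smooth_tanDeriv hi (hG q).1 w).continuous (hasCompactSupport_tanDeriv (hG q).2.1 w),
    integral_finsetSum _ fun q _ => integrable_of_compact
      ((hG q).1.mul (Smooth.inner hx.smooth (contMDiff_const (c := w)))).continuous (hG q).2.1.mul_right,
    Finset.mul_sum]
  exact Finset.sum_congr rfl fun q _ =>
    integral_tanDeriv_of_chart hx q (hG q).1 (hG q).2.1 (hG q).2.2 w

/-- The term `c = 1`, `x₀ = 0` of the supremum. The entropy bound serves only for this finiteness.
-/
theorem isFiniteMeasure_gaussMeasure (h : entropy (n := n) x < ⊤) :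
    IsFiniteMeasure (gaussMeasure (n := n) x) := by
  refine ⟨lt_of_le_of_lt ?_ h⟩
  have h1 : gaussMeasure (n := n) x Set.univ =
      gaussArea (n := n) (fun p => (1 : ℝ) • x p + (0 : Euc N)) := by
    simp [gaussArea]
  rw [h1]
  unfold entropy
  exact le_iSup_of_le (1 : ℝ) (le_iSup_of_le one_pos (le_iSup_of_le (0 : Euc N) le_rfl))

/-- The divergence theorem for tangential fields `∑ i, g i • E_i`. -/
theorem integral_divergence (hx : IsShrinker (n := n) x)
    [IsFiniteMeasure (gaussMeasure (n := n) x)] {g : Fin N → M → ℝ}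
    (hg : ∀ i, Smooth n (g i)) (hc : ∀ i, HasCompactSupport (g i)) :
    ∫ p, (∑ i, tanDeriv (n := n) x (g i) (stdVec i) p - (1 / 2 : ℝ) * ∑ i, x p i * g i p)
      ∂(gaussMeasure (n := n) x) = 0 := by
  have hi := hx.isImm
  have i1 : ∀ i, Integrable (tanDeriv (n := n) x (g i) (stdVec i)) (gaussMeasure (n := n) x) :=
    fun i => integrable_of_compact (smooth_tanDeriv hi (hg i) _).continuous
      (hasCompactSupport_tanDeriv (hc i) _)
  have i2 : ∀ i, Integrable (fun p => x p i * g i p) (gaussMeasure (n := n) x) :=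
    fun i => integrable_of_compact ((Smooth.coord hx.smooth i).mul (hg i)).continuous (hc i).mul_left
  rw [integral_sub (integrable_finsetSum _ fun i _ => i1 i)
    ((integrable_finsetSum _ fun i _ => i2 i).const_mul _), integral_const_mul,
    integral_finsetSum _ fun i _ => i1 i, integral_finsetSum _ fun i _ => i2 i, Finset.mul_sum,
    ← Finset.sum_sub_distrib]
  refine Finset.sum_eq_zero fun i _ => ?_
  rw [integral_tanDeriv hx (hg i) (hc i)]
  simp only [inner_stdVec_right, mul_comm (g i _)]
  ring

end Global


/-! ### Green's formula and the second variation form -/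

section Green

variable {n N : ℕ} {M : Type*} [TopologicalSpace M] [T2Space M] [SecondCountableTopology M]
  [ChartedSpace (Euc n) M] [MeasurableSpace M] [BorelSpace M] [IsManifold (𝓡 n) ∞ M]
variable {x : M → Euc N}

/-- The inner product of two gradients. -/
def gradInner (x : M → Euc N) (φ ψ : M → ℝ) (p : M) : ℝ :=
  ∑ i : Fin N, tanDeriv (n := n) x φ (stdVec i) p * tanDeriv (n := n) x ψ (stdVec i) p

theorem gradSq_eq (φ : M → ℝ) (p : M) :
    gradSq (n := n) x φ p = gradInner (n := n) x φ φ p := by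
  simp only [gradSq, gradInner, sq]

theorem gradInner_comm (φ ψ : M → ℝ) (p : M) :
    gradInner (n := n) x φ ψ p = gradInner (n := n) x ψ φ p :=
  Finset.sum_congr rfl fun _ _ => mul_comm _ _

theorem smooth_gradInner (hx : IsImm (n := n) x) {φ ψ : M → ℝ} (hφ : Smooth n φ)
    (hψ : Smooth n ψ) : Smooth n (gradInner (n := n) x φ ψ) :=
  Smooth.sum fun _ _ => (smooth_tanDeriv hx hφ _).mul (smooth_tanDeriv hx hψ _)

theorem hasCompactSupport_sum {ι F : Type*} [AddCommMonoid F] {s : Finset ι} {f : ι → M → F}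
    (h : ∀ i ∈ s, HasCompactSupport (f i)) : HasCompactSupport (fun p => ∑ i ∈ s, f i p) := by
  classical
  induction s using Finset.induction_on with
  | empty => exact HasCompactSupport.intro isCompact_empty fun _ _ => by simp
  | insert a s ha ih =>
    simp only [Finset.sum_insert ha]
    exact (h a (Finset.mem_insert_self _ _)).add
      (ih fun i hi => h i (Finset.mem_insert_of_mem hi))

theorem hasCompactSupport_gradInner {φ : M → ℝ} (hφ : HasCompactSupport φ) (ψ : M → ℝ) :
    HasCompactSupport (gradInner (n := n) x φ ψ) :=
  hasCompactSupport_sum fun i _ => (hasCompactSupport_tanDeriv hφ (stdVec i)).mul_right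

theorem smooth_driftLaplacian (hx : IsImm (n := n) x) {φ : M → ℝ} (hφ : Smooth n φ) :
    Smooth n (driftLaplacian (n := n) x φ) := by
  have h1 : driftLaplacian (n := n) x φ = fun p => (∑ i : Fin N, tanDeriv (n := n) x
      (tanDeriv (n := n) x φ (stdVec i)) (stdVec i) p) -
      (1 / 2 : ℝ) * ∑ i, x p i * tanDeriv (n := n) x φ (stdVec i) p := by
    funext p
    unfold driftLaplacian
    rw [tanDeriv_eq_sum φ (x p)]
    rfl
  rw [h1]
  refine (Smooth.sum fun i _ => smooth_tanDeriv hx (smooth_tanDeriv hx hφ _) _).sub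
    (Smooth.mul contMDiff_const (Smooth.sum fun i _ => ?_))
  exact (Smooth.coord hx.smooth i).mul (smooth_tanDeriv hx hφ _)

/-- Green's formula for the drift Laplacian. -/
theorem integral_mul_driftLaplacian (hx : IsShrinker (n := n) x)
    [IsFiniteMeasure (gaussMeasure (n := n) x)] {φ ψ : M → ℝ} (hφ : Smooth n φ)
    (hc : HasCompactSupport φ) (hψ : Smooth n ψ) :
    ∫ p, φ p * driftLaplacian (n := n) x ψ p ∂(gaussMeasure (n := n) x) =
      - ∫ p, gradInner (n := n) x φ ψ p ∂(gaussMeasure (n := n) x) := by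
  have hi := hx.isImm
  have h := integral_divergence hx (g := fun i p => φ p * tanDeriv (n := n) x ψ (stdVec i) p)
    (fun i => hφ.mul (smooth_tanDeriv hi hψ _)) (fun i => hc.mul_right)
  have e : ∀ p, (∑ i, tanDeriv (n := n) x (fun p => φ p * tanDeriv (n := n) x ψ (stdVec i) p)
      (stdVec i) p - (1 / 2 : ℝ) * ∑ i, x p i * (φ p * tanDeriv (n := n) x ψ (stdVec i) p)) =
      gradInner (n := n) x φ ψ p + φ p * driftLaplacian (n := n) x ψ p := by
    intro p
    unfold driftLaplacian gradInner
    rw [tanDeriv_eq_sum ψ (x p)]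
    simp only [tanDeriv_mul hi hφ (smooth_tanDeriv hi hψ _), Finset.sum_add_distrib, smul_eq_mul]
    have : ∑ i, x p i * (φ p * tanDeriv (n := n) x ψ (stdVec i) p) =
        φ p * ∑ i, x p i * tanDeriv (n := n) x ψ (stdVec i) p := by
      rw [Finset.mul_sum]; exact Finset.sum_congr rfl fun _ _ => by ring
    rw [this, ← Finset.mul_sum]
    ring
  simp_rw [e] at h
  rw [integral_add (integrable_of_compact (smooth_gradInner hi hφ hψ).continuous
      (hasCompactSupport_gradInner hc ψ))
    (integrable_of_compact (hφ.mul (smooth_driftLaplacian hi hψ)).continuous hc.mul_right)] at h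
  linarith

theorem smooth_norm_norPart_sq (hx : IsImm (n := n) x) (V : Euc N) :
    Smooth n (fun q => ‖norPart (n := n) x q V‖ ^ 2) := by
  simp only [← real_inner_self_eq_norm_sq]
  exact Smooth.inner (smooth_norPart hx contMDiff_const) (smooth_norPart hx contMDiff_const)

/-- The second variation of `F` in the direction `φ V^⊥`. -/
theorem secondVariation_smul_norPart (hx : IsShrinker (n := n) x)
    [IsFiniteMeasure (gaussMeasure (n := n) x)] {φ : M → ℝ} (hφ : Smooth n φ)
    (hc : HasCompactSupport φ) (V : Euc N) :
    secondVariation (n := n) x (fun q => φ q • norPart (n := n) x q V) =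
      ∫ p, (gradSq (n := n) x φ p - (1 / 2 : ℝ) * φ p ^ 2) * ‖norPart (n := n) x p V‖ ^ 2
        ∂(gaussMeasure (n := n) x) := by
  have hi := hx.isImm
  set w : M → ℝ := fun q => ‖norPart (n := n) x q V‖ ^ 2 with hw
  have sw : Smooth n w := smooth_norm_norPart_sq hi V
  have hφw : Smooth n (fun p => φ p * w p) := hφ.mul sw
  -- Green's formula is tested against `φ |V^⊥|²`. The derivative of the weight `|V^⊥|²` then
  -- cancels the cross term of `inner_jacobiOp_smul_norPart`.
  have hG := integral_mul_driftLaplacian hx hφw hc.mul_right hφ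
  unfold secondVariation
  simp_rw [inner_jacobiOp_smul_norPart hx hφ]
  have e1 : ∀ p, gradInner (n := n) x (fun p => φ p * w p) φ p =
      w p * gradSq (n := n) x φ p + φ p * gradInner (n := n) x φ w p := by
    intro p
    rw [gradSq_eq]
    unfold gradInner
    simp only [tanDeriv_mul hi hφ sw, Finset.mul_sum, ← Finset.sum_add_distrib]
    exact Finset.sum_congr rfl fun _ _ => by ring
  simp_rw [e1] at hG
  have s1 : Smooth n (fun p => gradSq (n := n) x φ p) := by
    simp_rw [gradSq_eq]; exact smooth_gradInner hi hφ hφ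
  have c1 : HasCompactSupport (fun p => gradSq (n := n) x φ p) := by
    simp_rw [gradSq_eq]; exact hasCompactSupport_gradInner hc φ
  have i1 : Integrable (fun p => φ p * w p * driftLaplacian (n := n) x φ p)
      (gaussMeasure (n := n) x) := integrable_of_compact
    (hφw.mul (smooth_driftLaplacian hi hφ)).continuous (hc.mul_right.mul_right)
  have i2 : Integrable (fun p => φ p * gradInner (n := n) x φ w p)
      (gaussMeasure (n := n) x) := integrable_of_compact
    (hφ.mul (smooth_gradInner hi hφ sw)).continuous hc.mul_right
  have i3 : Integrable (fun p => w p * gradSq (n := n) x φ p)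
      (gaussMeasure (n := n) x) := integrable_of_compact
    (sw.mul s1).continuous c1.mul_left
  have i4 : Integrable (fun p => (1 / 2 : ℝ) * φ p ^ 2 * w p) (gaussMeasure (n := n) x) := by
    have : (fun p => (1 / 2 : ℝ) * φ p ^ 2 * w p) =
        fun p => φ p * ((1 / 2 : ℝ) * (φ p * w p)) := by funext p; ring
    rw [this]
    exact integrable_of_compact
      (hφ.mul (Smooth.mul contMDiff_const (hφ.mul sw))).continuous hc.mul_right
  rw [integral_add i3 i2] at hG
  have e2 : ∫ p, (φ p * ‖norPart (n := n) x p V‖ ^ 2 * driftLaplacian (n := n) x φ p +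
      φ p * ∑ i, tanDeriv (n := n) x φ (stdVec i) p *
        tanDeriv (n := n) x (fun q => ‖norPart (n := n) x q V‖ ^ 2) (stdVec i) p +
      1 / 2 * φ p ^ 2 * ‖norPart (n := n) x p V‖ ^ 2) ∂(gaussMeasure (n := n) x) =
      ∫ p, φ p * w p * driftLaplacian (n := n) x φ p ∂(gaussMeasure (n := n) x) +
      ∫ p, φ p * gradInner (n := n) x φ w p ∂(gaussMeasure (n := n) x) +
      ∫ p, (1 / 2 : ℝ) * φ p ^ 2 * w p ∂(gaussMeasure (n := n) x) := by
    have i12 : Integrable (fun p => φ p * w p * driftLaplacian (n := n) x φ p +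
      φ p * gradInner (n := n) x φ w p) (gaussMeasure (n := n) x) := i1.add i2
    rw [← integral_add i1 i2, ← integral_add i12 i4]
    rfl
  have e3 : ∫ p, (gradSq (n := n) x φ p - (1 / 2 : ℝ) * φ p ^ 2) * ‖norPart (n := n) x p V‖ ^ 2
        ∂(gaussMeasure (n := n) x) = ∫ p, w p * gradSq (n := n) x φ p ∂(gaussMeasure (n := n) x) -
      ∫ p, (1 / 2 : ℝ) * φ p ^ 2 * w p ∂(gaussMeasure (n := n) x) := by
    rw [← integral_sub i3 i4]
    refine integral_congr_ae (Filter.Eventually.of_forall fun p => ?_)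
    simp only [hw]
    ring
  rw [e2, e3]
  linarith

/-- The integrand of the symmetric bilinear form of the second variation. -/
def secondFormDensity (x : M → Euc N) (u v : M → Euc N) (p : M) : ℝ :=
  ∑ i : Fin N, ⟪norDeriv (n := n) x u (stdVec i) p, norDeriv (n := n) x v (stdVec i) p⟫_ℝ
    - (1 / 2 : ℝ) * ⟪u p, v p⟫_ℝ
    - ∑ i : Fin N, ∑ j : Fin N, ⟪u p, secondFF (n := n) x p (stdVec i) (stdVec j)⟫_ℝ *
        ⟪v p, secondFF (n := n) x p (stdVec i) (stdVec j)⟫_ℝ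

/-- The symmetric bilinear form of the second variation. -/
def secondForm (x : M → Euc N) (u v : M → Euc N) : ℝ :=
  ∫ p, secondFormDensity (n := n) x u v p ∂(gaussMeasure (n := n) x)

theorem secondFormDensity_comm (u v : M → Euc N) (p : M) :
    secondFormDensity (n := n) x u v p = secondFormDensity (n := n) x v u p := by
  unfold secondFormDensity
  simp only [real_inner_comm (norDeriv (n := n) x v _ p), real_inner_comm (v p) (u p),
    mul_comm ⟪u p, _⟫_ℝ]

theorem smooth_norDeriv (hx : IsImm (n := n) x) {u : M → Euc N} (hu : Smooth n u) (w : Euc N) :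
    Smooth n (norDeriv (n := n) x u w) :=
  smooth_norPart hx (smooth_tanDeriv hx hu w)

theorem smooth_secondFF (hx : IsImm (n := n) x) (v w : Euc N) :
    Smooth n (fun p => secondFF (n := n) x p v w) := by
  simp only [secondFF_eq hx]
  exact smooth_norPart hx ((smooth_dproj hx v).clm_apply contMDiff_const)

theorem smooth_secondFormDensity (hx : IsImm (n := n) x) {u v : M → Euc N} (hu : Smooth n u)
    (hv : Smooth n v) : Smooth n (secondFormDensity (n := n) x u v) := by
  unfold secondFormDensity
  refine ((Smooth.sum fun i _ => (smooth_norDeriv hx hu _).inner (smooth_norDeriv hx hv _)).sub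
    (Smooth.mul contMDiff_const (hu.inner hv))).sub
    (Smooth.sum fun i _ => Smooth.sum fun j _ => ?_)
  exact (hu.inner (smooth_secondFF hx _ _)).mul (hv.inner (smooth_secondFF hx _ _))

theorem norDeriv_eq_zero_of_notMem_tsupport {u : M → Euc N} {p : M} (h : p ∉ tsupport u)
    (w : Euc N) : norDeriv (n := n) x u w p = 0 := by
  unfold norDeriv
  rw [tanDeriv_eq_zero_of_notMem_tsupport h]
  exact map_zero (norProj (n := n) x p)

theorem hasCompactSupport_secondFormDensity {u : M → Euc N} (hu : HasCompactSupport u)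
    (v : M → Euc N) : HasCompactSupport (secondFormDensity (n := n) x u v) := by
  refine HasCompactSupport.intro hu.isCompact fun p hp => ?_
  unfold secondFormDensity
  simp [norDeriv_eq_zero_of_notMem_tsupport hp, image_eq_zero_of_notMem_tsupport hp]

theorem integrable_secondFormDensity (hx : IsImm (n := n) x)
    [IsFiniteMeasure (gaussMeasure (n := n) x)] {u v : M → Euc N} (hu : Smooth n u)
    (hc : HasCompactSupport u) (hv : Smooth n v) :
    Integrable (secondFormDensity (n := n) x u v) (gaussMeasure (n := n) x) :=
  integrable_of_compact (smooth_secondFormDensity hx hu hv).continuous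
    (hasCompactSupport_secondFormDensity hc v)

theorem norDeriv_add {u v : M → Euc N} (hu : Smooth n u)
    (hv : Smooth n v) (w : Euc N) (p : M) : norDeriv (n := n) x (u + v) w p =
      norDeriv (n := n) x u w p + norDeriv (n := n) x v w p := by
  unfold norDeriv
  rw [← norPart_add, ← tanDeriv_add hu hv]
  rfl

theorem norDeriv_const_smul (hx : IsImm (n := n) x) {u : M → Euc N} (hu : Smooth n u) (c : ℝ)
    (w : Euc N) (p : M) : norDeriv (n := n) x (c • u) w p = c • norDeriv (n := n) x u w p := by
  unfold norDeriv
  rw [← norPart_smul, ← tanDeriv_const_smul hx hu]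
  rfl

theorem secondFormDensity_add_left {u u' v : M → Euc N} (hu : Smooth n u)
    (hu' : Smooth n u') (p : M) : secondFormDensity (n := n) x (u + u') v p =
      secondFormDensity (n := n) x u v p + secondFormDensity (n := n) x u' v p := by
  unfold secondFormDensity
  simp only [norDeriv_add hu hu', Pi.add_apply, inner_add_left, Finset.sum_add_distrib, add_mul]
  ring

theorem secondFormDensity_smul_left (hx : IsImm (n := n) x) {u v : M → Euc N} (hu : Smooth n u)
    (c : ℝ) (p : M) : secondFormDensity (n := n) x (c • u) v p =
      c * secondFormDensity (n := n) x u v p := by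
  unfold secondFormDensity
  simp only [norDeriv_const_smul hx hu, Pi.smul_apply, real_inner_smul_left, mul_assoc,
    ← Finset.mul_sum]
  ring

theorem secondForm_comm (u v : M → Euc N) :
    secondForm (n := n) x u v = secondForm (n := n) x v u := by
  unfold secondForm
  simp_rw [secondFormDensity_comm u v]

theorem secondForm_add_left (hx : IsImm (n := n) x) [IsFiniteMeasure (gaussMeasure (n := n) x)]
    {u u' v : M → Euc N} (hu : Smooth n u) (hu' : Smooth n u') (hc : HasCompactSupport u)
    (hc' : HasCompactSupport u') (hv : Smooth n v) : secondForm (n := n) x (u + u') v =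
      secondForm (n := n) x u v + secondForm (n := n) x u' v := by
  unfold secondForm
  simp_rw [secondFormDensity_add_left hu hu']
  exact integral_add (integrable_secondFormDensity hx hu hc hv)
    (integrable_secondFormDensity hx hu' hc' hv)

theorem secondForm_smul_left (hx : IsImm (n := n) x) {u v : M → Euc N} (hu : Smooth n u)
    (c : ℝ) : secondForm (n := n) x (c • u) v = c * secondForm (n := n) x u v := by
  unfold secondForm
  simp_rw [secondFormDensity_smul_left hx hu]
  exact integral_const_mul _ _

/-- The second variation is the quadratic form of `secondForm`. -/
theorem secondVariation_eq_secondForm (hx : IsShrinker (n := n) x)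
    [IsFiniteMeasure (gaussMeasure (n := n) x)] {u : M → Euc N} (hu : Smooth n u)
    (hc : HasCompactSupport u) (hn : ∀ p, tanPart (n := n) x p (u p) = 0) :
    secondVariation (n := n) x u = secondForm (n := n) x u u := by
  have hi := hx.isImm
  have hnor : ∀ p, norPart (n := n) x p (u p) = u p := fun p => norPart_of_normal (hn p)
  have hin : ∀ p v, ⟪u p, norPart (n := n) x p v⟫_ℝ = ⟪u p, v⟫_ℝ := fun p v => by
    rw [← inner_norPart, hnor]
  -- The drift divergence of these components is `|∇^⊥ u|² + ⟪u, ℒ u⟫`, because `u` is normal. Its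
  -- integral vanishes.
  set g : Fin N → M → ℝ := fun i p => ⟪u p, norDeriv (n := n) x u (stdVec i) p⟫_ℝ with hg
  have sg : ∀ i, Smooth n (g i) := fun i => hu.inner (smooth_norDeriv hi hu _)
  have cg : ∀ i, HasCompactSupport (g i) := fun i =>
    HasCompactSupport.intro hc.isCompact fun p hp => by
      simp [hg, image_eq_zero_of_notMem_tsupport hp]
  have hdiv := integral_divergence hx sg cg
  have e : ∀ p, ⟪u p, jacobiOp (n := n) x u p⟫_ℝ =
      (∑ i, tanDeriv (n := n) x (g i) (stdVec i) p - (1 / 2 : ℝ) * ∑ i, x p i * g i p)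
        - secondFormDensity (n := n) x u u p := by
    intro p
    have e1 : ∀ i, tanDeriv (n := n) x (g i) (stdVec i) p =
        ⟪norDeriv (n := n) x u (stdVec i) p, norDeriv (n := n) x u (stdVec i) p⟫_ℝ +
        ⟪u p, norDeriv (n := n) x (fun q => norDeriv (n := n) x u (stdVec i) q) (stdVec i) p⟫_ℝ := by
      intro i
      rw [hg, tanDeriv_inner hi hu (smooth_norDeriv hi hu _)]
      congr 1
      · rw [norDeriv, inner_norPart, norPart_norPart]
      · rw [norDeriv, hin]
    have e2 : ∑ i, x p i * g i p = ⟪u p, norDeriv (n := n) x u (x p) p⟫_ℝ := by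
      rw [norDeriv, hin, tanDeriv_eq_sum u (x p), inner_sum]
      refine Finset.sum_congr rfl fun i _ => ?_
      rw [real_inner_smul_right, hg]
      simp only [norDeriv, hin]
    unfold jacobiOp normalDriftLaplacian secondFormDensity
    simp only [e1, e2, inner_add_right, inner_sub_right, inner_sum, real_inner_smul_right,
      Finset.sum_add_distrib]
    ring
  unfold secondVariation secondForm
  simp_rw [e]
  have iF := integrable_secondFormDensity hi hu hc hu
  have iD : Integrable (fun p => ∑ i, tanDeriv (n := n) x (g i) (stdVec i) p -
      (1 / 2 : ℝ) * ∑ i, x p i * g i p) (gaussMeasure (n := n) x) := by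
    refine Integrable.sub (integrable_finsetSum _ fun i _ => ?_)
      ((integrable_finsetSum _ fun i _ => ?_).const_mul _)
    · exact integrable_of_compact (smooth_tanDeriv hi (sg i) _).continuous
        (hasCompactSupport_tanDeriv (cg i) _)
    · exact integrable_of_compact ((Smooth.coord hx.smooth i).mul (sg i)).continuous
        (cg i).mul_left
  rw [integral_sub iD iF, hdiv, zero_sub, neg_neg]

end Green


/-! ### The intrinsic distance -/

section IntrinsicDistance

variable {n N : ℕ} {M : Type*} [TopologicalSpace M] [ChartedSpace (Euc n) M]
  [IsManifold (𝓡 n) ∞ M]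
variable {x : M → Euc N}

/-- The norms of tangent vectors for the induced metric. -/
abbrev immENorm (x : M → Euc N) (r : M) : ENorm (TangentSpace (𝓡 n) r) :=
  ⟨fun v => ‖dmap (n := n) x r v‖ₑ⟩

theorem immENormSMulClass (x : M → Euc N) (r : M) :
    letI := immENorm (n := n) x r
    ENormSMulClass ℝ (TangentSpace (𝓡 n) r) := by
  let _ := immENorm (n := n) x r
  refine ⟨fun c v => ?_⟩
  change ‖dmap (n := n) x r (c • v)‖ₑ = ‖c‖ₑ * ‖dmap (n := n) x r v‖ₑ
  rw [← enorm_smul]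
  congr 1
  exact (dmap (n := n) x r).map_smul c v

theorem intrinsicEDist_self (p : M) : intrinsicEDist (n := n) x p p = 0 := by
  let _ := immENorm (n := n) x
  have := immENormSMulClass (n := n) x
  exact Manifold.riemannianEDist_self

theorem intrinsicEDist_comm (p q : M) :
    intrinsicEDist (n := n) x p q = intrinsicEDist (n := n) x q p := by
  let _ := immENorm (n := n) x
  have := immENormSMulClass (n := n) x
  exact Manifold.riemannianEDist_comm

theorem intrinsicEDist_triangle (p q r : M) : intrinsicEDist (n := n) x p r ≤
    intrinsicEDist (n := n) x p q + intrinsicEDist (n := n) x q r := by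
  let _ := immENorm (n := n) x
  have := immENormSMulClass (n := n) x
  exact Manifold.riemannianEDist_triangle

theorem dmap_mfderiv_path (hx : IsImm (n := n) x) {γ : ℝ → M} {t : ℝ}
    (hγ : MDifferentiableAt 𝓘(ℝ, ℝ) (𝓡 n) γ t) :
    dmap (n := n) x (γ t) (mfderiv 𝓘(ℝ, ℝ) (𝓡 n) γ t (1 : ℝ)) = deriv (x ∘ γ) t := by
  have h1 := mfderiv_comp t (mdiffAt_of_contMDiff hx.smooth (γ t)) hγ
  rw [← fderiv_apply_one_eq_deriv, ← mfderiv_eq_fderiv, h1]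
  rfl

/-- Cauchy–Schwarz for the expansion of `D_w` over the standard basis. -/
theorem abs_tanDeriv_le {η : M → ℝ} {p : M} (h : gradSq (n := n) x η p ≤ 1) (w : Euc N) :
    |tanDeriv (n := n) x η w p| ≤ ‖w‖ := by
  rw [tanDeriv_eq_sum]
  simp only [smul_eq_mul]
  have h1 := Finset.sum_mul_sq_le_sq_mul_sq Finset.univ (fun i => w i)
    (fun i => tanDeriv (n := n) x η (stdVec i) p)
  rw [← EuclideanSpace.real_norm_sq_eq] at h1
  refine abs_le_of_sq_le_sq (h1.trans ?_) (norm_nonneg _)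
  unfold gradSq at h
  nlinarith [sq_nonneg ‖w‖]

/-- Functions with gradient at most one are Lipschitz for the intrinsic distance. -/
theorem le_add_intrinsicEDist (hx : IsImm (n := n) x) {η : M → ℝ} (hη : Smooth n η)
    (hg : ∀ p, gradSq (n := n) x η p ≤ 1) (p q : M) :
    ENNReal.ofReal (η q) ≤ ENNReal.ofReal (η p) + intrinsicEDist (n := n) x p q := by
  have key : ‖η q - η p‖ₑ ≤ intrinsicEDist (n := n) x p q := by
    let _ := immENorm (n := n) x
    have := immENormSMulClass (n := n) x
    refine le_of_forall_gt fun r hr => ?_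
    obtain ⟨γ, h0, h1, hγ, -, hlen⟩ :=
      (Manifold.exists_lt_locally_constant_of_riemannianEDist_lt (I := 𝓡 n) hr zero_lt_one).imp
        fun γ h => (⟨h.1, h.2.1, h.2.2.1, trivial, h.2.2.2.1⟩ :
          _ ∧ _ ∧ _ ∧ True ∧ Manifold.pathELength (𝓡 n) γ 0 1 < r)
    refine lt_of_le_of_lt ?_ hlen
    have hd : ∀ t, MDifferentiableAt 𝓘(ℝ, ℝ) (𝓡 n) γ t := fun t =>
      (hγ t).mdifferentiableAt (by simp)
    have hc : ContDiff ℝ 1 (η ∘ γ) := by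
      rw [← contMDiff_iff_contDiff]
      exact (hη.of_le (by exact_mod_cast le_top)).comp hγ
    have h2 := enorm_sub_le_lintegral_deriv_of_contDiffOn_Icc (f := η ∘ γ) (a := 0) (b := 1)
      hc.contDiffOn zero_le_one
    simp only [Function.comp_apply, h0, h1] at h2
    refine h2.trans ?_
    rw [Manifold.pathELength_eq_lintegral_mfderiv_Icc]
    refine lintegral_mono fun t => ?_
    change ‖deriv (η ∘ γ) t‖ₑ ≤ ‖dmap (n := n) x (γ t) (mfderiv 𝓘(ℝ, ℝ) (𝓡 n) γ t (1 : ℝ))‖ₑ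
    set v : Euc n := mfderiv 𝓘(ℝ, ℝ) (𝓡 n) γ t (1 : ℝ) with hv
    -- The derivative along the path is the tangential derivative in the direction `dx v`, since the
    -- pseudo-inverse returns `v`. Its size is therefore at most the length integrand.
    have h3 : deriv (η ∘ γ) t = tanDeriv (n := n) x η (dmap (n := n) x (γ t) v) (γ t) := by
      have e1 := mfderiv_comp t (mdiffAt_of_contMDiff hη (γ t)) (hd t)
      rw [← fderiv_apply_one_eq_deriv, ← mfderiv_eq_fderiv, e1]
      unfold tanDeriv
      rw [pinv_apply_self _ (hx.immersive _)]
      rfl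
    rw [h3, ← ofReal_norm, ← ofReal_norm, Real.norm_eq_abs]
    exact ENNReal.ofReal_le_ofReal (abs_tanDeriv_le (hg _) _)
  have h4 : η q ≤ η p + |η q - η p| := by linarith [le_abs_self (η q - η p)]
  calc ENNReal.ofReal (η q) ≤ ENNReal.ofReal (η p + |η q - η p|) := ENNReal.ofReal_le_ofReal h4
    _ ≤ ENNReal.ofReal (η p) + ENNReal.ofReal |η q - η p| := ENNReal.ofReal_add_le
    _ ≤ _ := by
      gcongr
      rw [← Real.enorm_eq_ofReal_abs]
      exact key

/-- Near a point the intrinsic distance is comparable to the extrinsic one. -/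
theorem eventually_intrinsicEDist_le (hx : IsImm (n := n) x) (p : M) :
    ∀ᶠ q in 𝓝 p, intrinsicEDist (n := n) x p q ≤ ENNReal.ofReal (2 * ‖x q - x p‖) ∧
      (x q = x p → q = p) := by
  set e := chartAt (Euc n) p with he
  set X := chartRep (n := n) x p with hX
  set y₀ := e p with hy₀
  have hy : y₀ ∈ e.target := mem_chart_target _ p
  set B := fderiv ℝ X y₀ with hB
  have hinj : Function.Injective B := hx.injective_chart' p hy
  set C := ‖pinv B‖ + 1 with hC
  have hCpos : 0 < C := by positivity
  have hlow : ∀ v, ‖v‖ ≤ C * ‖B v‖ := by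
    intro v
    calc ‖v‖ = ‖pinv B (B v)‖ := by rw [pinv_apply_self B hinj]
      _ ≤ ‖pinv B‖ * ‖B v‖ := (pinv B).le_opNorm _
      _ ≤ C * ‖B v‖ := by gcongr; linarith
  -- On a ball where `dX` is within `δ` of `B`, it differs on `v` from `B v` by at most `‖B v‖ / 4`.
  -- The coordinate segment then has length at most `(5/4) ‖B v‖`, while `‖x q - x p‖ ≥ (3/4) ‖B
  -- v‖`; their ratio is below the factor 2 of the statement.
  set δ := 1 / (4 * C) with hδ
  have hδpos : 0 < δ := by positivity
  have hcont : ContinuousAt (fderiv ℝ X) y₀ := (contDiffAt_fderiv_chartRep hx.smooth p hy).continuousAt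
  have htarget : ∀ᶠ y in 𝓝 y₀, y ∈ e.target := e.open_target.mem_nhds hy
  obtain ⟨r, hr, hball⟩ := Metric.eventually_nhds_iff_ball.1
    (htarget.and ((Metric.tendsto_nhds.1 hcont.tendsto) δ hδpos))
  have hsource : ∀ᶠ q in 𝓝 p, q ∈ e.source := e.open_source.mem_nhds (mem_chart_source _ p)
  have hev : ∀ᶠ q in 𝓝 p, q ∈ e.source ∧ e q ∈ Metric.ball y₀ r :=
    hsource.and ((e.continuousAt (mem_chart_source _ p)).eventually_mem (Metric.ball_mem_nhds _ hr))
  filter_upwards [hev] with q hq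
  obtain ⟨hqs, hqb⟩ := hq
  set v := e q - y₀ with hv
  have hδv : δ * ‖v‖ ≤ ‖B v‖ / 4 := by
    calc δ * ‖v‖ ≤ δ * (C * ‖B v‖) := by gcongr; exact hlow v
      _ = ‖B v‖ / 4 := by rw [hδ]; field_simp
  have hXd : ∀ y ∈ Metric.ball y₀ r, DifferentiableAt ℝ X y := fun y h =>
    differentiableAt_chartRep hx.smooth p (hball y h).1
  have hlow2 : ‖x q - x p - B v‖ ≤ δ * ‖v‖ := by
    have h1 := (convex_ball y₀ r).norm_image_sub_le_of_norm_fderiv_le' (φ := B) (C := δ) hXd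
      (fun y h => by rw [← dist_eq_norm]; exact (hball y h).2.le) (Metric.mem_ball_self hr) hqb
    have h2 : X (e q) = x q := by simp [hX, chartRep, ← he, e.left_inv hqs]
    have h3 : X y₀ = x p := by simp [hX, chartRep, hy₀, ← he, e.left_inv (mem_chart_source _ p)]
    rw [h2, h3] at h1
    exact h1
  have hxx : 3 / 4 * ‖B v‖ ≤ ‖x q - x p‖ := by
    have h1 : ‖B v‖ ≤ ‖x q - x p‖ + ‖x q - x p - B v‖ := by
      have := norm_sub_norm_le (B v) (x q - x p)
      rw [norm_sub_rev (B v) (x q - x p)] at this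
      linarith
    linarith
  constructor
  · set γ : ℝ → M := fun t => e.symm (y₀ + t • v) with hγ
    have hmem : ∀ t ∈ Set.Icc (0 : ℝ) 1, y₀ + t • v ∈ Metric.ball y₀ r := by
      intro t ht
      have h1 : ‖v‖ < r := by rw [hv, ← dist_eq_norm]; exact hqb
      rw [Metric.mem_ball, dist_eq_norm, add_sub_cancel_left, norm_smul, Real.norm_eq_abs,
        abs_of_nonneg ht.1]
      nlinarith [ht.1, ht.2, norm_nonneg v]
    have hlin : ContDiff ℝ ∞ (fun t : ℝ => y₀ + t • v) := by fun_prop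
    have hγat : ∀ t ∈ Set.Icc (0 : ℝ) 1, ContMDiffAt 𝓘(ℝ, ℝ) (𝓡 n) ∞ γ t := by
      intro t ht
      have h1 := (contMDiffOn_chart_symm (I := 𝓡 n) (n := ∞) (x := p)).contMDiffAt
        (e.open_target.mem_nhds (hball _ (hmem t ht)).1)
      exact ContMDiffAt.comp (I' := 𝓡 n) t h1 hlin.contMDiff.contMDiffAt
    let _ := immENorm (n := n) x
    have := immENormSMulClass (n := n) x
    have h0 : γ 0 = p := by simp [hγ, hy₀, e.left_inv (mem_chart_source _ p)]
    have h1 : γ 1 = q := by simp [hγ, hv, e.left_inv hqs]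
    have hlen := Manifold.riemannianEDist_le_pathELength (I := 𝓡 n) (γ := γ) (a := 0) (b := 1)
      (fun t ht => ((hγat t ht).of_le (by exact_mod_cast le_top)).contMDiffWithinAt) h0 h1
      zero_le_one
    refine hlen.trans ?_
    rw [Manifold.pathELength_eq_lintegral_mfderiv_Icc]
    have hbound : ∀ t ∈ Set.Icc (0 : ℝ) 1,
        ‖dmap (n := n) x (γ t) (mfderiv 𝓘(ℝ, ℝ) (𝓡 n) γ t (1 : ℝ))‖ₑ ≤
          ENNReal.ofReal (2 * ‖x q - x p‖) := by
      intro t ht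
      rw [dmap_mfderiv_path hx ((hγat t ht).mdifferentiableAt (by simp))]
      have e1 : x ∘ γ = X ∘ fun t : ℝ => y₀ + t • v := rfl
      have e2 : HasDerivAt (fun t : ℝ => y₀ + t • v) v t := by
        simpa using ((hasDerivAt_id t).smul_const v).const_add y₀
      rw [e1, ((hXd _ (hmem t ht)).hasFDerivAt.comp_hasDerivAt t e2).deriv,
        ← ofReal_norm]
      apply ENNReal.ofReal_le_ofReal
      have e3 : ‖fderiv ℝ X (y₀ + t • v) v‖ ≤ ‖B v‖ + δ * ‖v‖ := by
        have h5 : ‖fderiv ℝ X (y₀ + t • v) - B‖ ≤ δ := by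
          rw [← dist_eq_norm]; exact (hball _ (hmem t ht)).2.le
        calc ‖fderiv ℝ X (y₀ + t • v) v‖ = ‖B v + (fderiv ℝ X (y₀ + t • v) - B) v‖ := by
              simp
          _ ≤ ‖B v‖ + ‖(fderiv ℝ X (y₀ + t • v) - B) v‖ := norm_add_le _ _
          _ ≤ ‖B v‖ + δ * ‖v‖ := by
              gcongr
              exact ((fderiv ℝ X (y₀ + t • v) - B).le_opNorm v).trans (by gcongr)
      linarith [norm_nonneg (B v)]
    calc ∫⁻ t in Set.Icc (0 : ℝ) 1,
        ‖dmap (n := n) x (γ t) (mfderiv 𝓘(ℝ, ℝ) (𝓡 n) γ t (1 : ℝ))‖ₑ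
        ≤ ∫⁻ _ in Set.Icc (0 : ℝ) 1, ENNReal.ofReal (2 * ‖x q - x p‖) :=
          setLIntegral_mono' measurableSet_Icc hbound
      _ = ENNReal.ofReal (2 * ‖x q - x p‖) := by simp
  · intro hxq
    rw [hxq, sub_self, norm_zero] at hxx
    have h1 : ‖B v‖ = 0 := le_antisymm (by linarith) (norm_nonneg _)
    have h2 := hlow v
    rw [h1, mul_zero] at h2
    have h3 : v = 0 := norm_eq_zero.1 (le_antisymm h2 (norm_nonneg _))
    exact e.injOn hqs (mem_chart_source _ p) (sub_eq_zero.1 h3)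

theorem tendsto_intrinsicEDist (hx : IsImm (n := n) x) {a : ℕ → M} {p : M}
    (ha : Filter.Tendsto a Filter.atTop (𝓝 p)) :
    Filter.Tendsto (fun j => intrinsicEDist (n := n) x p (a j)) Filter.atTop (𝓝 0) := by
  have h1 : Filter.Tendsto (fun q => ENNReal.ofReal (2 * ‖x q - x p‖)) (𝓝 p) (𝓝 0) := by
    have : Filter.Tendsto (fun q => 2 * ‖x q - x p‖) (𝓝 p) (𝓝 (2 * ‖x p - x p‖)) :=
      (((hx.smooth.continuous.sub continuous_const).norm).const_mul 2).tendsto p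
    simpa using ENNReal.tendsto_ofReal this
  refine tendsto_of_tendsto_of_tendsto_of_le_of_le' tendsto_const_nhds (h1.comp ha)
    (Filter.Eventually.of_forall fun _ => bot_le) ?_
  exact (ha.eventually (eventually_intrinsicEDist_le hx p)).mono fun j hj => hj.1

end IntrinsicDistance


/-! ### A smooth positive part -/

section Ramp

/-- A smooth approximation of the positive part. -/
def ramp (ε t : ℝ) : ℝ := ∫ s in (0 : ℝ)..t, Real.smoothTransition (s / ε)

theorem continuous_smoothTransition_div (ε : ℝ) :
    Continuous fun s : ℝ => Real.smoothTransition (s / ε) :=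
  Real.smoothTransition.continuous.comp (continuous_id.div_const ε)

theorem hasDerivAt_ramp (ε t : ℝ) : HasDerivAt (ramp ε) (Real.smoothTransition (t / ε)) t :=
  (continuous_smoothTransition_div ε).integral_hasStrictDerivAt 0 t |>.hasDerivAt

theorem contDiff_ramp (ε : ℝ) : ContDiff ℝ ∞ (ramp ε) := by
  rw [contDiff_infty_iff_deriv]
  refine ⟨fun t => (hasDerivAt_ramp ε t).differentiableAt, ?_⟩
  have : deriv (ramp ε) = fun t => Real.smoothTransition (t / ε) :=
    funext fun t => (hasDerivAt_ramp ε t).deriv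
  rw [this]
  exact Real.smoothTransition.contDiff.comp (contDiff_id.div_const ε)

theorem ramp_of_nonpos {ε t : ℝ} (hε : 0 < ε) (ht : t ≤ 0) : ramp ε t = 0 := by
  rw [ramp, intervalIntegral.integral_congr (g := fun _ => (0 : ℝ))]
  · simp
  · intro s hs
    rw [Set.uIcc_of_ge ht] at hs
    exact Real.smoothTransition.zero_of_nonpos (div_nonpos_of_nonpos_of_nonneg hs.2 hε.le)

theorem ramp_nonneg {ε : ℝ} (hε : 0 < ε) (t : ℝ) : 0 ≤ ramp ε t := by
  rcases le_total t 0 with h | h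
  · rw [ramp_of_nonpos hε h]
  · exact intervalIntegral.integral_nonneg h fun _ _ => Real.smoothTransition.nonneg _

theorem sub_le_ramp {ε : ℝ} (hε : 0 < ε) (t : ℝ) : t - ε ≤ ramp ε t := by
  rcases le_total t ε with h | h
  · linarith [ramp_nonneg hε t]
  · have hi : ∀ a b : ℝ, IntervalIntegrable (fun s => Real.smoothTransition (s / ε)) volume a b :=
      fun a b => (continuous_smoothTransition_div ε).intervalIntegrable a b
    rw [ramp, ← intervalIntegral.integral_add_adjacent_intervals (hi 0 ε) (hi ε t)]
    have h1 := ramp_nonneg hε ε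
    rw [ramp] at h1
    have h2 : ∫ s in ε..t, Real.smoothTransition (s / ε) = ∫ _ in ε..t, (1 : ℝ) := by
      refine intervalIntegral.integral_congr fun s hs => ?_
      rw [Set.uIcc_of_le h] at hs
      exact Real.smoothTransition.one_of_one_le ((one_le_div hε).2 hs.1)
    rw [h2, intervalIntegral.integral_const]
    simp only [smul_eq_mul, mul_one]
    linarith

theorem fderiv_ramp (ε t v : ℝ) :
    fderiv ℝ (ramp ε) t v = Real.smoothTransition (t / ε) * v := by
  rw [fderiv_eq_deriv_mul, (hasDerivAt_ramp ε t).deriv]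

theorem exists_bound_deriv_smoothTransition :
    ∃ C : ℝ, 0 < C ∧ ∀ t, |deriv Real.smoothTransition t| ≤ C := by
  have hc : Continuous (deriv Real.smoothTransition) :=
    (Real.smoothTransition.contDiff (n := 1)).continuous_deriv le_rfl
  have hs : HasCompactSupport (deriv Real.smoothTransition) := by
    refine HasCompactSupport.intro (isCompact_Icc (a := (0 : ℝ)) (b := 1)) fun t ht => ?_
    rw [Set.mem_Icc, not_and_or, not_le, not_le] at ht
    rcases ht with h | h
    · have : Real.smoothTransition =ᶠ[𝓝 t] fun _ => (0 : ℝ) := by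
        filter_upwards [Iio_mem_nhds h] with s hs
        exact Real.smoothTransition.zero_of_nonpos (le_of_lt hs)
      rw [this.deriv_eq, deriv_const]
    · have : Real.smoothTransition =ᶠ[𝓝 t] fun _ => (1 : ℝ) := by
        filter_upwards [Ioi_mem_nhds h] with s hs
        exact Real.smoothTransition.one_of_one_le (le_of_lt hs)
      rw [this.deriv_eq, deriv_const]
  obtain ⟨C, hC⟩ := hs.exists_bound_of_continuous hc
  exact ⟨max C 1, by positivity, fun t => (hC t).trans (le_max_left _ _)⟩

end Ramp

/-! ### Ekeland's variational principle -/

section Ekeland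

variable {M : Type*} {d : M → M → ℝ≥0∞} {G : M → ℝ≥0∞}

/-- Ekeland's variational principle for a function that is Lipschitz with constant one. -/
theorem exists_ekeland_point [TopologicalSpace M] (hself : ∀ p, d p p = 0)
    (hcomm : ∀ p q, d p q = d q p)
    (htri : ∀ p q r, d p r ≤ d p q + d q r)
    (hcomplete : ∀ a : ℕ → M, (∀ ε : ℝ≥0∞, 0 < ε → ∃ K : ℕ, ∀ i ≥ K, ∀ j ≥ K, d (a i) (a j) < ε) →
      ∃ p : M, Filter.Tendsto (fun j => d p (a j)) Filter.atTop (𝓝 0))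
    (hG : ∀ p q, G q ≤ G p + d p q) {p₀ : M} (hp₀ : G p₀ ≠ ⊤) :
    ∃ p, G p ≠ ⊤ ∧ ∀ q, G q + 4⁻¹ * d p q ≤ G p → d p q = 0 := by
  have h4 : (4⁻¹ : ℝ≥0∞) ≠ 0 := by simp
  have h4t : (4⁻¹ : ℝ≥0∞) ≠ ⊤ := by simp
  -- The points reached from `p` by a descent of at least a quarter of the distance. The relation is
  -- transitive, so these sets are nested along the sequence built below.
  let S : M → Set M := fun p => {q | G q + 4⁻¹ * d p q ≤ G p}
  have hSself : ∀ p, p ∈ S p := fun p => by simp [S, hself]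
  have hStrans : ∀ p q r, q ∈ S p → r ∈ S q → r ∈ S p := by
    intro p q r hq hr
    change G r + 4⁻¹ * d p r ≤ G p
    calc G r + 4⁻¹ * d p r ≤ G r + 4⁻¹ * (d p q + d q r) := by gcongr; exact htri _ _ _
      _ = (G r + 4⁻¹ * d q r) + 4⁻¹ * d p q := by ring
      _ ≤ G q + 4⁻¹ * d p q := by gcongr; exact hr
      _ ≤ G p := hq
  -- Each point is followed by one that minimizes `G` over its descent set up to `2⁻ᵏ`. This makes
  -- the sequence Cauchy.
  have hstep : ∀ (k : ℕ) (p : {p // G p ≠ ⊤}), ∃ q : {p // G p ≠ ⊤}, q.1 ∈ S p.1 ∧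
      ∀ r ∈ S p.1, G q.1 ≤ G r + 2⁻¹ ^ k := by
    intro k p
    have hpos : (2⁻¹ ^ k : ℝ≥0∞) ≠ 0 := by simp
    have hinf : (⨅ r ∈ S p.1, G r) ≠ ⊤ :=
      ne_top_of_le_ne_top p.2 (iInf₂_le p.1 (hSself p.1))
    have hlt := ENNReal.lt_add_right hinf hpos
    rw [iInf_lt_iff] at hlt
    obtain ⟨q, hq⟩ := hlt
    rw [iInf_lt_iff] at hq
    obtain ⟨hqS, hq⟩ := hq
    refine ⟨⟨q, ne_top_of_le_ne_top p.2 (le_self_add.trans hqS)⟩, hqS, fun r hr => ?_⟩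
    refine hq.le.trans ?_
    gcongr
    exact iInf₂_le r hr
  choose nxt hnxt1 hnxt2 using hstep
  let a : ℕ → {p // G p ≠ ⊤} := fun k => Nat.rec ⟨p₀, hp₀⟩ (fun k p => nxt k p) k
  have ha1 : ∀ k, (a (k + 1)).1 ∈ S (a k).1 := fun k => hnxt1 k (a k)
  have ha2 : ∀ k, ∀ r ∈ S (a k).1, G (a (k + 1)).1 ≤ G r + 2⁻¹ ^ k := fun k => hnxt2 k (a k)
  have hmem : ∀ k j, k ≤ j → (a j).1 ∈ S (a k).1 := by
    intro k j hkj
    induction j, hkj using Nat.le_induction with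
    | base => exact hSself _
    | succ j _ ih => exact hStrans _ _ _ ih (ha1 j)
  have hdist : ∀ k j, k + 1 ≤ j → d (a (k + 1)).1 (a j).1 ≤ 4 * 2⁻¹ ^ k := by
    intro k j hkj
    have h1 := hmem _ _ hkj
    have h2 := ha2 k _ (hmem k j (by omega))
    have h3 : G (a j).1 + 4⁻¹ * d (a (k + 1)).1 (a j).1 ≤ G (a j).1 + 2⁻¹ ^ k := le_trans h1 h2
    have h5 := (ENNReal.add_le_add_iff_left (a j).2).1 h3
    calc d (a (k + 1)).1 (a j).1 = 4 * (4⁻¹ * d (a (k + 1)).1 (a j).1) := by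
          rw [← mul_assoc, ENNReal.mul_inv_cancel (by simp) (by simp), one_mul]
      _ ≤ _ := by gcongr
  have hlim : ∀ c : ℝ≥0∞, c ≠ ⊤ →
      Filter.Tendsto (fun k : ℕ => c * 2⁻¹ ^ k) Filter.atTop (𝓝 0) := by
    intro c hc
    have := ENNReal.Tendsto.const_mul (a := c)
      (ENNReal.tendsto_pow_atTop_nhds_zero_of_lt_one (r := 2⁻¹) (by simp)) (Or.inr hc)
    simpa using this
  obtain ⟨p, hp⟩ := hcomplete (fun k => (a k).1) (by
    intro ε hε
    obtain ⟨k, hk⟩ := ((hlim 8 (by simp)).eventually (gt_mem_nhds hε)).exists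
    refine ⟨k + 1, fun i hi j hj => lt_of_le_of_lt ?_ hk⟩
    calc d (a i).1 (a j).1 ≤ d (a i).1 (a (k + 1)).1 + d (a (k + 1)).1 (a j).1 := htri _ _ _
      _ ≤ 4 * 2⁻¹ ^ k + 4 * 2⁻¹ ^ k := by
        gcongr
        · rw [hcomm]; exact hdist k i hi
        · exact hdist k j hj
      _ = 8 * 2⁻¹ ^ k := by rw [← add_mul]; norm_num)
  -- The Lipschitz bound plays the role of lower semicontinuity: passing from `a j` to the limit
  -- costs at most `2 d p (a j)`.
  have hpS : ∀ k, p ∈ S (a k).1 := by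
    intro k
    have h1 : ∀ j, k ≤ j → G p + 4⁻¹ * d (a k).1 p ≤ G (a k).1 + 2 * d p (a j).1 := by
      intro j hj
      calc G p + 4⁻¹ * d (a k).1 p
          ≤ (G (a j).1 + d (a j).1 p) + 4⁻¹ * (d (a k).1 (a j).1 + d (a j).1 p) := by
            gcongr
            · exact hG _ _
            · exact htri _ _ _
        _ = (G (a j).1 + 4⁻¹ * d (a k).1 (a j).1) + (1 * d (a j).1 p + 4⁻¹ * d (a j).1 p) := by ring
        _ ≤ G (a k).1 + (1 * d (a j).1 p + 1 * d (a j).1 p) := by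
            gcongr
            · exact hmem k j hj
            · simp
        _ = G (a k).1 + 2 * d p (a j).1 := by rw [hcomm p]; ring
    have h2 : Filter.Tendsto (fun j => G (a k).1 + 2 * d p (a j).1) Filter.atTop
        (𝓝 (G (a k).1 + 2 * 0)) :=
      (ENNReal.Tendsto.const_mul hp (Or.inr (by simp))).const_add _
    rw [mul_zero, add_zero] at h2
    exact ge_of_tendsto h2 (Filter.eventually_atTop.2 ⟨k, h1⟩)
  have hpt : G p ≠ ⊤ := ne_top_of_le_ne_top hp₀ (le_self_add.trans (hpS 0))
  refine ⟨p, hpt, fun q hq => ?_⟩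
  -- A point `q` of the descent set of `p` lies in all earlier ones, over which the sequence is
  -- almost minimal.
  have h1 : G p ≤ G q := by
    have h2 : ∀ k, G p ≤ G q + 2⁻¹ ^ k := fun k =>
      (le_self_add.trans (hpS (k + 1))).trans (ha2 k q (hStrans _ _ _ (hpS k) hq))
    have h3 : Filter.Tendsto (fun k : ℕ => G q + 1 * 2⁻¹ ^ k) Filter.atTop (𝓝 (G q + 0)) :=
      (hlim 1 (by simp)).const_add _
    simp only [one_mul, add_zero] at h3
    exact ge_of_tendsto' h3 h2
  have h2 : G p + 4⁻¹ * d p q ≤ G p + 0 := by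
    rw [add_zero]
    exact le_trans (by gcongr) hq
  have h3 := (ENNReal.add_le_add_iff_left hpt).1 h2
  have h5 := mul_eq_zero.1 (le_antisymm h3 bot_le)
  exact h5.resolve_left h4

end Ekeland

/-! ### Cutoffs of small gradient on complete immersed manifolds -/

section Cutoff

variable {n N : ℕ} {M : Type*} [TopologicalSpace M] [ChartedSpace (Euc n) M]
  [IsManifold (𝓡 n) ∞ M]
variable {x : M → Euc N}

/-- Nonnegative smooth compactly supported functions whose gradient is at most one. -/
structure IsSlowCutoff (x : M → Euc N) (η : M → ℝ) : Prop where
  smooth : Smooth n η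
  compact : HasCompactSupport η
  nonneg : ∀ p, 0 ≤ η p
  grad : ∀ p, gradSq (n := n) x η p ≤ 1

/-- `a + ramp (b - a)` is a smooth substitute for `max a b`. Its gradient is a convex combination of
the gradients of `a` and `b`, so the class of slow cutoffs is closed under it. -/
theorem gradSq_add_ramp_le (hx : IsImm (n := n) x) {a b : M → ℝ} (ha : Smooth n a)
    (hb : Smooth n b) (ε : ℝ) {p : M} (ha1 : gradSq (n := n) x a p ≤ 1)
    (hb1 : gradSq (n := n) x b p ≤ 1) :
    gradSq (n := n) x (fun q => a q + ramp ε (b q - a q)) p ≤ 1 := by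
  set s := Real.smoothTransition ((b p - a p) / ε) with hs
  have hs0 : 0 ≤ s := Real.smoothTransition.nonneg _
  have hs1 : s ≤ 1 := Real.smoothTransition.le_one _
  have hba : Smooth n (fun q => b q - a q) := hb.sub ha
  have hD : ∀ w, tanDeriv (n := n) x (fun q => a q + ramp ε (b q - a q)) w p =
      (1 - s) * tanDeriv (n := n) x a w p + s * tanDeriv (n := n) x b w p := by
    intro w
    rw [tanDeriv_add ha (hba.comp_contDiff (contDiff_ramp ε)),
      tanDeriv_comp hx hba (contDiff_ramp ε), fderiv_ramp, tanDeriv_sub hb ha]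
    ring
  unfold gradSq at *
  calc ∑ i : Fin N, tanDeriv (n := n) x (fun q => a q + ramp ε (b q - a q)) (stdVec i) p ^ 2
      ≤ ∑ i : Fin N, ((1 - s) * tanDeriv (n := n) x a (stdVec i) p ^ 2 +
          s * tanDeriv (n := n) x b (stdVec i) p ^ 2) := by
        refine Finset.sum_le_sum fun i _ => ?_
        rw [hD]
        generalize tanDeriv (n := n) x a (stdVec i) p = A
        generalize tanDeriv (n := n) x b (stdVec i) p = B
        have := mul_nonneg (mul_nonneg hs0 (sub_nonneg.2 hs1)) (sq_nonneg (A - B))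
        linear_combination this
    _ ≤ 1 := by
        rw [Finset.sum_add_distrib, ← Finset.mul_sum, ← Finset.mul_sum]
        have h1 := mul_le_mul_of_nonneg_left ha1 (sub_nonneg.2 hs1)
        have h2 := mul_le_mul_of_nonneg_left hb1 hs0
        linarith

theorem smooth_add_ramp {a b : M → ℝ} (ha : Smooth n a) (hb : Smooth n b) (ε : ℝ) :
    Smooth n (fun q => a q + ramp ε (b q - a q)) :=
  ha.add (Smooth.comp_contDiff (hb.sub ha) (contDiff_ramp ε))

variable [T2Space M]

theorem IsSlowCutoff.add_ramp (hx : IsImm (n := n) x) {a b : M → ℝ}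
    (ha : IsSlowCutoff (n := n) x a) (hb : IsSlowCutoff (n := n) x b) {ε : ℝ} (hε : 0 < ε) :
    IsSlowCutoff (n := n) x (fun q => a q + ramp ε (b q - a q)) where
  smooth := smooth_add_ramp ha.smooth hb.smooth ε
  compact := by
    refine HasCompactSupport.intro (ha.compact.isCompact.union hb.compact.isCompact) fun q hq => ?_
    rw [Set.mem_union, not_or] at hq
    rw [image_eq_zero_of_notMem_tsupport hq.1, image_eq_zero_of_notMem_tsupport hq.2, sub_zero,
      ramp_of_nonpos hε le_rfl, add_zero]
  nonneg p := add_nonneg (ha.nonneg p) (ramp_nonneg hε _)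
  grad p := gradSq_add_ramp_le hx ha.smooth hb.smooth ε (ha.grad p) (hb.grad p)

theorem isSlowCutoff_zero : IsSlowCutoff (n := n) x (fun _ => 0) where
  smooth := contMDiff_const
  compact := HasCompactSupport.zero
  nonneg _ := le_rfl
  grad p := by simp [gradSq, tanDeriv_const]

/-- Approximate maxima of slow cutoffs over a compact set. -/
theorem exists_isSlowCutoff_of_compact (hx : IsImm (n := n) x) {K : Set M} (hK : IsCompact K)
    {c : M → ℝ} (hc : Continuous c)
    (h : ∀ q ∈ K, ∃ η, IsSlowCutoff (n := n) x η ∧ c q < η q) {ε : ℝ} (hε : 0 < ε) :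
    ∃ η, IsSlowCutoff (n := n) x η ∧ ∀ q ∈ K, c q - ε < η q := by
  have key : ∀ ε : ℝ, 0 < ε → ∃ η, IsSlowCutoff (n := n) x η ∧ ∀ q ∈ K, c q - ε < η q := by
    -- The tolerance is quantified inside the induction because each union splits it in half.
    refine hK.induction_on
      (p := fun s => ∀ ε : ℝ, 0 < ε → ∃ η, IsSlowCutoff (n := n) x η ∧ ∀ q ∈ s, c q - ε < η q)
      ?_ ?_ ?_ ?_
    · exact fun ε _ => ⟨_, isSlowCutoff_zero, fun q hq => hq.elim⟩
    · intro s t hst ht ε hε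
      obtain ⟨η, h1, h2⟩ := ht ε hε
      exact ⟨η, h1, fun q hq => h2 q (hst hq)⟩
    · intro s t hs ht ε hε
      obtain ⟨a, ha1, ha2⟩ := hs (ε / 2) (by positivity)
      obtain ⟨b, hb1, hb2⟩ := ht (ε / 2) (by positivity)
      refine ⟨_, ha1.add_ramp hx hb1 (half_pos hε), fun q hq => ?_⟩
      have h1 := ramp_nonneg (half_pos hε) (b q - a q)
      have h2 := sub_le_ramp (half_pos hε) (b q - a q)
      rcases hq with hq | hq
      · linarith [ha2 q hq]
      · linarith [hb2 q hq]
    · intro q hq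
      obtain ⟨η, h1, h2⟩ := h q hq
      have h3 : ∀ᶠ r in 𝓝 q, c r < η r :=
        hc.continuousAt.eventually_lt h1.smooth.continuous.continuousAt h2
      refine ⟨{r | c r < η r}, mem_nhdsWithin_of_mem_nhds h3, fun ε hε => ⟨η, h1, fun r hr => ?_⟩⟩
      have : c r < η r := hr
      linarith
  exact key ε hε

/-- The squared length of the tangential part. -/
theorem sum_inner_proj_sq (p : M) (z : Euc N) :
    ∑ i : Fin N, ⟪z, proj (n := n) x p (stdVec i)⟫_ℝ ^ 2 = ‖proj (n := n) x p z‖ ^ 2 := by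
  rw [EuclideanSpace.real_norm_sq_eq]
  refine Finset.sum_congr rfl fun i _ => ?_
  rw [← inner_proj, inner_stdVec_right]

/-- A smooth approximation of the distance to `y₀` in Euclidean space. -/
def smoothDist (κ : ℝ) (y₀ y : Euc N) : ℝ := Real.sqrt (‖y - y₀‖ ^ 2 + κ ^ 2)

theorem hasFDerivAt_smoothDist {κ : ℝ} (hκ : 0 < κ) (y₀ y : Euc N) :
    HasFDerivAt (smoothDist κ y₀) ((smoothDist κ y₀ y)⁻¹ • innerSL ℝ (y - y₀)) y := by
  have h1 : HasFDerivAt (fun y : Euc N => ‖y - y₀‖ ^ 2 + κ ^ 2)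
      (2 • innerSL ℝ (y - y₀)) y := by
    have := ((hasFDerivAt_id (𝕜 := ℝ) y).sub_const y₀).norm_sq.add_const (κ ^ 2)
    simpa using this
  have h2 : (‖y - y₀‖ ^ 2 + κ ^ 2) ≠ 0 := by positivity
  have h3 := h1.sqrt h2
  refine h3.congr_fderiv ?_
  rw [← Nat.cast_smul_eq_nsmul ℝ, smul_smul]
  congr 1
  rw [smoothDist]
  have : Real.sqrt (‖y - y₀‖ ^ 2 + κ ^ 2) ≠ 0 := (Real.sqrt_pos.2 (by positivity)).ne'
  push_cast
  field_simp

theorem contDiff_smoothDist {κ : ℝ} (hκ : 0 < κ) (y₀ : Euc N) :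
    ContDiff ℝ ∞ (smoothDist κ y₀) := by
  refine ContDiff.sqrt (((contDiff_id.sub contDiff_const).norm_sq ℝ).add contDiff_const) fun y => ?_
  positivity

theorem gradSq_smoothDist_le (hx : IsImm (n := n) x) {κ : ℝ} (hκ : 0 < κ) (y₀ : Euc N) (p : M) :
    gradSq (n := n) x (fun q => smoothDist κ y₀ (x q)) p ≤ 1 := by
  set z := x p - y₀ with hz
  have hpos : 0 < smoothDist κ y₀ (x p) := Real.sqrt_pos.2 (by positivity)
  have h1 : ∀ w, tanDeriv (n := n) x (fun q => smoothDist κ y₀ (x q)) w p =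
      (smoothDist κ y₀ (x p))⁻¹ * ⟪z, proj (n := n) x p w⟫_ℝ := by
    intro w
    rw [tanDeriv_comp hx hx.smooth (contDiff_smoothDist hκ y₀), tanDeriv_self hx,
      (hasFDerivAt_smoothDist hκ y₀ (x p)).fderiv]
    rfl
  unfold gradSq
  simp only [h1, mul_pow]
  rw [← Finset.mul_sum, sum_inner_proj_sq, inv_pow, inv_mul_le_iff₀ (by positivity), mul_one,
    smoothDist, Real.sq_sqrt (by positivity)]
  have := norm_proj_le (n := n) (x := x) p z
  have h2 : ‖proj (n := n) x p z‖ ^ 2 ≤ ‖z‖ ^ 2 := by gcongr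
  nlinarith [sq_nonneg κ]

theorem gradSq_const_sub {η : M → ℝ} (hη : Smooth n η) (c : ℝ) (p : M) :
    gradSq (n := n) x (fun q => c - η q) p = gradSq (n := n) x η p := by
  unfold gradSq
  refine Finset.sum_congr rfl fun i _ => ?_
  rw [tanDeriv_sub contMDiff_const hη, tanDeriv_const]
  ring

/-- The smoothed Euclidean distance to `x p` has gradient at most one and attains its minimum only
at `x p`. -/
theorem apply_eq_of_intrinsicEDist_eq_zero (hx : IsImm (n := n) x) {p q : M}
    (h : intrinsicEDist (n := n) x p q = 0) : x q = x p := by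
  have h1 := le_add_intrinsicEDist hx
    (Smooth.comp_contDiff hx.smooth (contDiff_smoothDist zero_lt_one (x p)))
    (gradSq_smoothDist_le hx zero_lt_one (x p)) p q
  rw [h, add_zero, ENNReal.ofReal_le_ofReal_iff (by exact Real.sqrt_nonneg _), smoothDist,
    smoothDist] at h1
  have h2 := (Real.sqrt_le_sqrt_iff (by positivity)).1 h1
  rw [sub_self, norm_zero] at h2
  have h3 : ‖x q - x p‖ = 0 := by nlinarith [norm_nonneg (x q - x p)]
  exact sub_eq_zero.1 (norm_eq_zero.1 h3)

/-- The supremum of the slow cutoffs. -/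
def cutoffSup (x : M → Euc N) (p : M) : ℝ≥0∞ :=
  ⨆ (η : M → ℝ) (_ : IsSlowCutoff (n := n) x η), ENNReal.ofReal (η p)

theorem exists_isSlowCutoff_of_lt {p : M} {c : ℝ}
    (h : ENNReal.ofReal c < cutoffSup (n := n) x p) :
    ∃ η, IsSlowCutoff (n := n) x η ∧ c < η p := by
  unfold cutoffSup at h
  rw [lt_iSup_iff] at h
  obtain ⟨η, h⟩ := h
  rw [lt_iSup_iff] at h
  obtain ⟨h1, h⟩ := h
  exact ⟨η, h1, (ENNReal.ofReal_lt_ofReal_iff').1 h |>.1⟩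

theorem cutoffSup_lipschitz (hx : IsImm (n := n) x) (p q : M) :
    cutoffSup (n := n) x q ≤ cutoffSup (n := n) x p + intrinsicEDist (n := n) x p q := by
  refine iSup₂_le fun η hη => (le_add_intrinsicEDist hx hη.smooth hη.grad p q).trans ?_
  gcongr
  exact le_iSup₂ (f := fun (η : M → ℝ) (_ : IsSlowCutoff (n := n) x η) => ENNReal.ofReal (η p)) η hη

/-- A slow cutoff may be raised near a point above which it lies below a cone. -/
theorem IsSlowCutoff.glue (hx : IsImm (n := n) x) {η c : M → ℝ}
    (hη : IsSlowCutoff (n := n) x η) (hc : Smooth n c)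
    (hc1 : ∀ q, gradSq (n := n) x c q ≤ 1) {K T : Set M} (hK : IsCompact K) (hT : IsClosed T)
    (hTK : T ⊆ interior K) (hle : ∀ q ∈ K, q ∉ T → c q ≤ η q) {ε : ℝ} (hε : 0 < ε) {p : M}
    (hp : p ∈ K) : ∃ η', IsSlowCutoff (n := n) x η' ∧ c p - ε ≤ η' p := by
  classical
  set a : M → ℝ := fun q => η q + ramp ε (c q - η q) with ha
  set η' : M → ℝ := fun q => if q ∈ K then a q else η q with hη'
  -- On `K` outside `T` one has `c ≤ η`, so the ramp vanishes and the two branches agree. Since `T`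
  -- is inside the interior of `K`, the function is locally given by a single formula.
  have hloc : ∀ q, η' =ᶠ[𝓝 q] a ∨ η' =ᶠ[𝓝 q] η := by
    intro q
    by_cases hq : q ∈ T
    · left
      filter_upwards [isOpen_interior.mem_nhds (hTK hq)] with r hr
      simp [hη', interior_subset hr]
    · right
      filter_upwards [hT.isOpen_compl.mem_nhds hq] with r hr
      by_cases hrK : r ∈ K
      · simp [hη', hrK, ha, ramp_of_nonpos hε (sub_nonpos.2 (hle r hrK hr))]
      · simp [hη', hrK]
  have hasm : Smooth n a := smooth_add_ramp hη.smooth hc ε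
  refine ⟨η', ⟨?_, ?_, ?_, ?_⟩, ?_⟩
  · intro q
    rcases hloc q with h | h
    · exact (hasm q).congr_of_eventuallyEq h
    · exact (hη.smooth q).congr_of_eventuallyEq h
  · refine HasCompactSupport.intro (hK.union hη.compact) fun q hq => ?_
    rw [Set.mem_union, not_or] at hq
    simp only [hη', hq.1, if_false]
    exact image_eq_zero_of_notMem_tsupport hq.2
  · intro q
    have : 0 ≤ a q := add_nonneg (hη.nonneg q) (ramp_nonneg hε _)
    simp only [hη']
    split_ifs
    · exact this
    · exact hη.nonneg q
  · intro q
    rcases hloc q with h | h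
    · have : gradSq (n := n) x η' q = gradSq (n := n) x a q := by
        unfold gradSq
        simp only [tanDeriv_congr h]
      rw [this]
      exact gradSq_add_ramp_le hx hη.smooth hc ε (hη.grad q) (hc1 q)
    · have : gradSq (n := n) x η' q = gradSq (n := n) x η q := by
        unfold gradSq
        simp only [tanDeriv_congr h]
      rw [this]
      exact hη.grad q
  · simp only [hη', hp, if_true, ha]
    linarith [sub_le_ramp hε (c p - η p)]

/-- If the supremum were finite at one point, Ekeland's principle would give `p` away from which it
cannot fall faster than a quarter of the distance. Near `p`, where the distance is at most twice the
Euclidean one, slow cutoffs then stay above a cone of slope `1/2`, up to a small error. A cone of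
slope one with a slightly higher apex can be glued to such a cutoff, and the result exceeds the
supremum at `p`. -/
theorem cutoffSup_eq_top (hx : IsImm (n := n) x) (hcomplete : IsCompleteImm (n := n) x) (p₀ : M) :
    cutoffSup (n := n) x p₀ = ⊤ := by
  by_contra hp₀
  obtain ⟨p, hpt, hp⟩ := exists_ekeland_point (d := intrinsicEDist (n := n) x)
    (G := cutoffSup (n := n) x) intrinsicEDist_self intrinsicEDist_comm intrinsicEDist_triangle
    (fun a ha => by
      obtain ⟨p, hp⟩ := hcomplete a ha
      exact ⟨p, tendsto_intrinsicEDist hx hp⟩) (cutoffSup_lipschitz hx) hp₀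
  set g := (cutoffSup (n := n) x p).toReal with hg
  have hgG : ENNReal.ofReal g = cutoffSup (n := n) x p := ENNReal.ofReal_toReal hpt
  have : LocallyCompactSpace M := ChartedSpace.locallyCompactSpace (Euc n) M
  obtain ⟨K, hKn, hKU, hK⟩ := local_compact_nhds (eventually_intrinsicEDist_le hx p)
  have hpK : p ∈ interior K := mem_interior_iff_mem_nhds.2 hKn
  set r : M → ℝ := fun q => ‖x q - x p‖ with hr
  have hrc : Continuous r := (hx.smooth.continuous.sub continuous_const).norm
  -- On `K` the map `x` takes the value `x p` only at `p`, so `r` has a positive minimum on the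
  -- compact set `K \ interior K`.
  obtain ⟨δ, hδ, hδK⟩ : ∃ δ : ℝ, 0 < δ ∧ ∀ q ∈ K, q ∉ interior K → δ < r q := by
    have hB : IsCompact (K \ interior K) := hK.diff isOpen_interior
    rcases (K \ interior K).eq_empty_or_nonempty with h | h
    · refine ⟨1, one_pos, fun q hq hq' => ?_⟩
      have : q ∈ K \ interior K := ⟨hq, hq'⟩
      rw [h] at this
      exact this.elim
    · obtain ⟨q₀, hq₀, hmin⟩ := hB.exists_isMinOn h hrc.continuousOn
      have hr0 : 0 < r q₀ := by
        refine norm_pos_iff.2 (sub_ne_zero.2 fun h' => hq₀.2 ?_)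
        rw [(hKU hq₀.1).2 h']
        exact hpK
      refine ⟨r q₀ / 2, half_pos hr0, fun q hq hq' => ?_⟩
      have : r q₀ ≤ r q := hmin ⟨hq, hq'⟩
      linarith
  have hS : IsCompact (K ∩ {q | δ ≤ r q}) :=
    hK.inter_right (isClosed_le continuous_const hrc)
  obtain ⟨η, hη, hηS⟩ := exists_isSlowCutoff_of_compact hx hS
    (c := fun q => g - r q / 2 - δ / 16) (by fun_prop) (fun q hq => by
      obtain ⟨hqK, hqr⟩ := hq
      have hqr : δ ≤ r q := hqr
      by_cases hneg : g - r q / 2 - δ / 16 < 0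
      · exact ⟨_, isSlowCutoff_zero, hneg⟩
      refine exists_isSlowCutoff_of_lt ?_
      have hd := (hKU hqK).1
      by_contra hlt
      rw [not_lt] at hlt hneg
      -- Since `d ≤ 2 r`, a quarter of the distance is at most `r / 2`. A value of the supremum
      -- below the cone would thus be a descent in the sense of Ekeland, and would force `d = 0` and
      -- then `r = 0`.
      have h1 : cutoffSup (n := n) x q + 4⁻¹ * intrinsicEDist (n := n) x p q ≤
          cutoffSup (n := n) x p := by
        calc cutoffSup (n := n) x q + 4⁻¹ * intrinsicEDist (n := n) x p q
            ≤ ENNReal.ofReal (g - r q / 2) + 4⁻¹ * ENNReal.ofReal (2 * r q) := by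
              gcongr
              exact hlt.trans (ENNReal.ofReal_le_ofReal (by linarith))
          _ = ENNReal.ofReal g := by
            have : (4⁻¹ : ℝ≥0∞) = ENNReal.ofReal (1 / 4) := by
              rw [one_div, ENNReal.ofReal_inv_of_pos (by norm_num)]
              norm_num
            rw [this, ← ENNReal.ofReal_mul (by norm_num), ← ENNReal.ofReal_add (by linarith)
              (by positivity)]
            congr 1
            ring
          _ = _ := hgG
      have h2 := apply_eq_of_intrinsicEDist_eq_zero hx (hp q h1)
      have h3 : r q = 0 := by simp [hr, h2]
      linarith) (ε := δ / 16) (by positivity)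
  have hκ : 0 < δ / 16 := by positivity
  -- Where `r ≥ δ` this is at most `g - r / 2 - δ / 4`, below the bound `g - r / 2 - δ / 8` for `η`.
  -- At `p` the smoothing and the gluing lose `δ / 16` each, which leaves `g + δ / 8 > g`.
  set c : M → ℝ := fun q => (g + δ / 4) - smoothDist (δ / 16) (x p) (x q) with hcdef
  have hds : Smooth n (fun q => smoothDist (δ / 16) (x p) (x q)) :=
    Smooth.comp_contDiff hx.smooth (contDiff_smoothDist hκ (x p))
  have hcs : Smooth n c := contMDiff_const.sub hds
  have hc1 : ∀ q, gradSq (n := n) x c q ≤ 1 := fun q => by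
    rw [hcdef, gradSq_const_sub hds]
    exact gradSq_smoothDist_le hx hκ (x p) q
  obtain ⟨η', hη', hη'p⟩ := hη.glue hx hcs hc1 (K := K) (T := K ∩ {q | r q ≤ δ}) hK
    (hK.isClosed.inter (isClosed_le hrc continuous_const))
    (fun q hq => by
      by_contra h
      have h1 : r q ≤ δ := hq.2
      linarith [hδK q hq.1 h])
    (fun q hqK hqT => by
      have h1 : δ < r q := by
        by_contra h
        exact hqT ⟨hqK, not_lt.1 h⟩
      have h2 := hηS q ⟨hqK, h1.le⟩
      have h3 : r q ≤ smoothDist (δ / 16) (x p) (x q) := by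
        refine Real.le_sqrt_of_sq_le ?_
        simp only [hr]
        nlinarith [sq_nonneg (δ / 16)]
      simp only [hcdef]
      linarith) hκ (interior_subset hpK)
  have h1 : c p = g + δ / 4 - δ / 16 := by
    simp [hcdef, smoothDist, Real.sqrt_sq hκ.le]
  have h2 : ENNReal.ofReal (η' p) ≤ cutoffSup (n := n) x p :=
    le_iSup₂ (f := fun (η : M → ℝ) (_ : IsSlowCutoff (n := n) x η) => ENNReal.ofReal (η p)) η' hη'
  rw [← hgG, ENNReal.ofReal_le_ofReal_iff ENNReal.toReal_nonneg] at h2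
  linarith

/-- Complete immersed manifolds have compactly supported cutoffs of small gradient. -/
theorem exists_cutoff (hx : IsImm (n := n) x) (hcomplete : IsCompleteImm (n := n) x) {K : Set M}
    (hK : IsCompact K) {ε : ℝ} (hε : 0 < ε) :
    ∃ χ : M → ℝ, Smooth n χ ∧ HasCompactSupport χ ∧ (∀ p, 0 ≤ χ p) ∧ (∀ p, χ p ≤ 1) ∧
      (∀ p ∈ K, χ p = 1) ∧ ∀ p, gradSq (n := n) x χ p ≤ ε ^ 2 := by
  obtain ⟨C, hC, hCb⟩ := exists_bound_deriv_smoothTransition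
  set R := C / ε with hR
  have hRpos : 0 < R := by positivity
  -- The extra 1 absorbs the tolerance, so `η > R` on `K`. Division by `R = C / ε` makes the
  -- argument of the transition at least 1 there, and bounds the gradient of the composite by `C / R
  -- = ε`.
  obtain ⟨η, hη, hηK⟩ := exists_isSlowCutoff_of_compact hx hK (c := fun _ => R + 1)
    continuous_const (fun q _ => exists_isSlowCutoff_of_lt
      (by rw [cutoffSup_eq_top hx hcomplete]; exact ENNReal.ofReal_lt_top)) one_pos
  have hηR : Smooth n (fun p => R⁻¹ • η p) := hη.smooth.clm (R⁻¹ • ContinuousLinearMap.id ℝ ℝ)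
  have hst : ContDiff ℝ ∞ Real.smoothTransition := Real.smoothTransition.contDiff
  refine ⟨fun p => Real.smoothTransition (R⁻¹ • η p), hηR.comp_contDiff hst,
    hη.compact.comp_left (g := fun t => Real.smoothTransition (R⁻¹ • t)) (by simp),
    fun p => Real.smoothTransition.nonneg _, fun p => Real.smoothTransition.le_one _, ?_, ?_⟩
  · intro p hp
    refine Real.smoothTransition.one_of_one_le ?_
    have := hηK p hp
    rw [smul_eq_mul, inv_mul_eq_div, one_le_div hRpos]
    linarith
  · intro p
    set s := deriv Real.smoothTransition (R⁻¹ • η p) with hs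
    have h1 : ∀ w, tanDeriv (n := n) x (fun p => Real.smoothTransition (R⁻¹ • η p)) w p =
        s * (R⁻¹ * tanDeriv (n := n) x η w p) := by
      intro w
      rw [tanDeriv_comp hx hηR hst, fderiv_eq_deriv_mul, tanDeriv_const_smul hx hη.smooth,
        smul_eq_mul (a := R⁻¹) (b := tanDeriv (n := n) x η w p)]
    have h2 : gradSq (n := n) x (fun p => Real.smoothTransition (R⁻¹ • η p)) p =
        s ^ 2 * R⁻¹ ^ 2 * gradSq (n := n) x η p := by
      unfold gradSq
      simp only [h1, mul_pow]
      rw [Finset.mul_sum]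
      exact Finset.sum_congr rfl fun i _ => by ring
    have h3 : s ^ 2 ≤ C ^ 2 := sq_le_sq' (by linarith [(abs_le.1 (hCb (R⁻¹ • η p))).1])
      (abs_le.1 (hCb (R⁻¹ • η p))).2
    rw [h2]
    calc s ^ 2 * R⁻¹ ^ 2 * gradSq (n := n) x η p ≤ C ^ 2 * R⁻¹ ^ 2 * 1 := by
          refine mul_le_mul (by gcongr) (hη.grad p) ?_ (by positivity)
          exact Finset.sum_nonneg fun _ _ => sq_nonneg _
      _ = ε ^ 2 := by rw [hR]; field_simp

variable [SecondCountableTopology M]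

/-- A sequence of cutoffs exhausting a complete immersed manifold. -/
theorem exists_cutoff_seq (hx : IsImm (n := n) x) (hcomplete : IsCompleteImm (n := n) x) :
    ∃ χ : ℕ → M → ℝ, (∀ k, Smooth n (χ k)) ∧ (∀ k, HasCompactSupport (χ k)) ∧
      (∀ k p, 0 ≤ χ k p) ∧ (∀ k p, χ k p ≤ 1) ∧
      (∀ p, ∀ᶠ k in Filter.atTop, χ k p = 1) ∧
      ∀ k p, gradSq (n := n) x (χ k) p ≤ (1 / ((k : ℝ) + 1)) ^ 2 := by
  have : LocallyCompactSpace M := ChartedSpace.locallyCompactSpace (Euc n) M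
  choose χ h1 h2 h3 h4 h5 h6 using fun k : ℕ => exists_cutoff hx hcomplete
    (isCompact_compactCovering M k) (ε := 1 / ((k : ℝ) + 1)) (by positivity)
  refine ⟨χ, h1, h2, h3, h4, fun p => ?_, h6⟩
  obtain ⟨k, hk⟩ := exists_mem_compactCovering p
  filter_upwards [Filter.eventually_ge_atTop k] with j hj
  exact h5 j p (compactCovering_subset M hj hk)

end Cutoff


/-! ### From constrained Rayleigh bounds to eigenvalue bounds -/

section Core

variable {n N : ℕ} {M : Type*} [TopologicalSpace M] [T2Space M] [SecondCountableTopology M]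
  [ChartedSpace (Euc n) M] [MeasurableSpace M] [BorelSpace M] [IsManifold (𝓡 n) ∞ M]
variable {x : M → Euc N}

/-- The smooth compactly supported functions. -/
def testSpace (n : ℕ) (M : Type*) [TopologicalSpace M] [ChartedSpace (Euc n) M] :
    Submodule ℝ (M → ℝ) where
  carrier := {φ | Smooth n φ ∧ HasCompactSupport φ}
  add_mem' h1 h2 := ⟨h1.1.add h2.1, h1.2.add h2.2⟩
  zero_mem' := ⟨contMDiff_const, HasCompactSupport.zero⟩
  smul_mem' c _ h := ⟨(contDiff_const_smul (𝕜 := ℝ) (n := ∞) (F := ℝ) c).contMDiff.comp h.1, h.2.smul_left (f := fun _ => c)⟩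

theorem eq_zero_of_integral_sq_nonpos (hx : IsImm (n := n) x) {f : M → ℝ} (hf : Continuous f)
    (hi : Integrable (fun p => f p ^ 2) (gaussMeasure (n := n) x))
    (h : ∫ p, f p ^ 2 ∂(gaussMeasure (n := n) x) ≤ 0) : f = 0 := by
  have := isOpenPosMeasure_gaussMeasure hx
  have h0 : ∫ p, f p ^ 2 ∂(gaussMeasure (n := n) x) = 0 :=
    le_antisymm h (integral_nonneg fun _ => sq_nonneg _)
  have h1 := (integral_eq_zero_iff_of_nonneg (fun p => sq_nonneg (f p)) hi).1 h0
  have h2 := (Continuous.ae_eq_iff_eq _ (hf.pow 2) continuous_const).1 h1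
  funext p
  have h3 := congrFun h2 p
  exact pow_eq_zero_iff two_ne_zero |>.1 h3

theorem continuous_gradSq (hx : IsImm (n := n) x) {φ : M → ℝ} (hφ : Smooth n φ) :
    Continuous (gradSq (n := n) x φ) := by
  have h1 : gradSq (n := n) x φ = gradInner (n := n) x φ φ := funext (gradSq_eq φ)
  rw [h1]
  exact (smooth_gradInner hx hφ hφ).continuous

theorem gradSq_nonneg (φ : M → ℝ) (p : M) : 0 ≤ gradSq (n := n) x φ p :=
  Finset.sum_nonneg fun _ _ => sq_nonneg _

/-- A space of dimension `m + 1` contains a nonzero function that satisfies at most `m` linear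
conditions, and this function has Rayleigh quotient at least `θ`. -/
theorem le_driftMinMax (hx : IsShrinker (n := n) x)
    [IsFiniteMeasure (gaussMeasure (n := n) x)] {ι : Type*} [Fintype ι]
    (ℓ : testSpace n M →ₗ[ℝ] (ι → ℝ)) {m : ℕ} (hι : Fintype.card ι ≤ m) {θ : ℝ}
    (hℓ : ∀ φ : testSpace n M, ℓ φ = 0 →
      θ * ∫ p, (φ : M → ℝ) p ^ 2 ∂(gaussMeasure (n := n) x) ≤
        ∫ p, gradSq (n := n) x φ p ∂(gaussMeasure (n := n) x)) :
    (θ : EReal) ≤ driftMinMax (n := n) x m := by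
  unfold driftMinMax
  refine le_iInf fun W => le_iInf fun hW => le_iInf fun htest => ?_
  have hWle : W ≤ testSpace n M := fun φ hφ => htest φ hφ
  have hfin : FiniteDimensional ℝ W := Module.finite_of_finrank_pos (by omega)
  have hker := LinearMap.ker_ne_bot_of_finrank_lt (f := ℓ ∘ₗ Submodule.inclusion hWle)
    (by rw [hW, Module.finrank_fintype_fun_eq_card]; omega)
  obtain ⟨φ, hφ, hne⟩ := (Submodule.ne_bot_iff _).1 hker
  have hφ0 : (φ : M → ℝ) ≠ 0 := fun h => hne (Subtype.ext h)
  have h1 := hℓ (Submodule.inclusion hWle φ) hφ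
  obtain ⟨hs, hc⟩ := hWle φ.2
  have hint : Integrable (fun p => (φ : M → ℝ) p ^ 2) (gaussMeasure (n := n) x) :=
    integrable_of_compact (hs.continuous.pow 2) (hc.comp_left (g := fun t => t ^ 2) (by simp))
  have hpos : 0 < ∫ p, (φ : M → ℝ) p ^ 2 ∂(gaussMeasure (n := n) x) := by
    by_contra h
    exact hφ0 (eq_zero_of_integral_sq_nonpos hx.isImm hs.continuous hint (not_lt.1 h))
  refine le_iSup_of_le (φ : M → ℝ) (le_iSup_of_le φ.2 (le_iSup_of_le hφ0 ?_))
  rw [EReal.coe_le_coe_iff, le_div_iff₀ hpos]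
  exact h1

/-- A sequence of cutoffs exhausting `M` with gradients tending to zero. -/
structure IsExhaustion (x : M → Euc N) (χ : ℕ → M → ℝ) : Prop where
  smooth : ∀ k, Smooth n (χ k)
  compact : ∀ k, HasCompactSupport (χ k)
  nonneg : ∀ k p, 0 ≤ χ k p
  le_one : ∀ k p, χ k p ≤ 1
  eventually : ∀ p, ∀ᶠ k in Filter.atTop, χ k p = 1
  grad : ∀ k p, gradSq (n := n) x (χ k) p ≤ (1 / ((k : ℝ) + 1)) ^ 2

theorem gradInner_sq_mul (hx : IsImm (n := n) x) {χ φ ψ : M → ℝ} (hχ : Smooth n χ)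
    (hφ : Smooth n φ) (p : M) :
    gradInner (n := n) x (fun q => χ q * χ q * φ q) ψ p =
      χ p ^ 2 * gradInner (n := n) x φ ψ p + 2 * φ p * χ p * gradInner (n := n) x χ ψ p := by
  unfold gradInner
  rw [Finset.mul_sum, Finset.mul_sum, ← Finset.sum_add_distrib]
  refine Finset.sum_congr rfl fun i _ => ?_
  rw [tanDeriv_mul hx (hχ.mul hχ) hφ, tanDeriv_mul hx hχ hχ]
  ring

/-- With `χ² φ` as second test function, truncation costs only `φ² |∇χ|²`: no mixed term with `∇φ`
is left over. -/
theorem gradSq_mul (hx : IsImm (n := n) x) {χ φ : M → ℝ} (hχ : Smooth n χ)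
    (hφ : Smooth n φ) (p : M) :
    gradSq (n := n) x (fun q => χ q * φ q) p =
      gradInner (n := n) x (fun q => χ q * χ q * φ q) φ p +
        φ p ^ 2 * gradSq (n := n) x χ p := by
  unfold gradInner gradSq
  rw [Finset.mul_sum, ← Finset.sum_add_distrib]
  refine Finset.sum_congr rfl fun i _ => ?_
  rw [tanDeriv_mul hx (hχ.mul hχ) hφ, tanDeriv_mul hx hχ hχ, tanDeriv_mul hx hχ hφ]
  ring

theorem abs_mul_gradInner_le (a b : M → ℝ) (s t : ℝ) {ε : ℝ} (hε : 0 < ε) (p : M) :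
    |2 * t * s * gradInner (n := n) x a b p| ≤
      t ^ 2 / ε * gradSq (n := n) x a p + ε * s ^ 2 * gradSq (n := n) x b p := by
  unfold gradInner gradSq
  rw [Finset.mul_sum, Finset.mul_sum, Finset.mul_sum, ← Finset.sum_add_distrib]
  refine (Finset.abs_sum_le_sum_abs _ _).trans (Finset.sum_le_sum fun i _ => ?_)
  generalize tanDeriv (n := n) x a (stdVec i) p = A
  generalize tanDeriv (n := n) x b (stdVec i) p = B
  have e1 : t ^ 2 / ε * A ^ 2 + ε * s ^ 2 * B ^ 2 - 2 * t * s * (A * B) =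
      (t * A - ε * s * B) ^ 2 / ε := by field_simp; ring
  have e2 : t ^ 2 / ε * A ^ 2 + ε * s ^ 2 * B ^ 2 + 2 * t * s * (A * B) =
      (t * A + ε * s * B) ^ 2 / ε := by field_simp; ring
  have h1 : 0 ≤ (t * A - ε * s * B) ^ 2 / ε := by positivity
  have h2 : 0 ≤ (t * A + ε * s * B) ^ 2 / ε := by positivity
  rw [abs_le]
  constructor <;> linarith

theorem IsEigenfunction.integral_gradInner (hx : IsShrinker (n := n) x)
    [IsFiniteMeasure (gaussMeasure (n := n) x)] {ν : ℝ} {φ ψ : M → ℝ}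
    (hφ : IsEigenfunction (n := n) x ν φ) (hψ : Smooth n ψ) (hc : HasCompactSupport ψ) :
    ∫ p, gradInner (n := n) x ψ φ p ∂(gaussMeasure (n := n) x) =
      ν * ∫ p, ψ p * φ p ∂(gaussMeasure (n := n) x) := by
  have h1 := integral_mul_driftLaplacian hx hψ hc hφ.smooth
  have h2 : ∀ p, ψ p * driftLaplacian (n := n) x φ p = -ν * (ψ p * φ p) := fun p => by
    have := hφ.equation p
    linear_combination ψ p * this
  simp only [h2] at h1
  rw [integral_const_mul] at h1
  linarith

theorem IsEigenfunction.integrable_mul {ν μ : ℝ} {φ ψ : M → ℝ}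
    (hφ : IsEigenfunction (n := n) x ν φ) (hψ : IsEigenfunction (n := n) x μ ψ) :
    Integrable (fun p => φ p * ψ p) (gaussMeasure (n := n) x) :=
  hφ.memLp.integrable_mul hψ.memLp

theorem IsExhaustion.tendsto_integral {χ : ℕ → M → ℝ} (hχ : IsExhaustion (n := n) x χ) {g : M → ℝ}
    (hg : Integrable g (gaussMeasure (n := n) x)) :
    Filter.Tendsto (fun k => ∫ p, χ k p * χ k p * g p ∂(gaussMeasure (n := n) x)) Filter.atTop
      (𝓝 (∫ p, g p ∂(gaussMeasure (n := n) x))) := by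
  refine tendsto_integral_of_dominated_convergence (fun p => ‖g p‖) (fun k => ?_) hg.norm
    (fun k => Filter.Eventually.of_forall fun p => ?_) (Filter.Eventually.of_forall fun p => ?_)
  · exact ((hχ.smooth k).continuous.mul (hχ.smooth k).continuous).aestronglyMeasurable.mul
      hg.aestronglyMeasurable
  · rw [norm_mul, Real.norm_eq_abs, abs_of_nonneg (mul_nonneg (hχ.nonneg k p) (hχ.nonneg k p))]
    have h1 : χ k p * χ k p ≤ 1 := mul_le_one₀ (hχ.le_one k p) (hχ.nonneg k p) (hχ.le_one k p)
    exact mul_le_of_le_one_left (norm_nonneg _) h1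
  · refine tendsto_const_nhds.congr' ?_
    filter_upwards [hχ.eventually p] with k hk
    simp [hk]

/-- Caccioppoli's inequality for eigenfunctions. -/
theorem IsEigenfunction.integral_sq_mul_gradSq_le (hx : IsShrinker (n := n) x)
    [IsFiniteMeasure (gaussMeasure (n := n) x)] {χ : ℕ → M → ℝ} (hχ : IsExhaustion (n := n) x χ)
    {ν : ℝ} {φ : M → ℝ} (hφ : IsEigenfunction (n := n) x ν φ) (k : ℕ) :
    ∫ p, χ k p ^ 2 * gradSq (n := n) x φ p ∂(gaussMeasure (n := n) x) ≤
      (2 * |ν| + 4) * ∫ p, φ p * φ p ∂(gaussMeasure (n := n) x) := by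
  have hs := (hχ.smooth k)
  have hc := (hχ.compact k)
  have hφs : Smooth n φ := hφ.smooth
  have hψ : Smooth n (fun q => χ k q * χ k q * φ q) := (hs.mul hs).mul hφs
  have hψc : HasCompactSupport (fun q => χ k q * χ k q * φ q) := (hc.mul_right).mul_right
  have h1 := hφ.integral_gradInner hx hψ hψc
  have hi1 : Integrable (gradInner (n := n) x (fun q => χ k q * χ k q * φ q) φ)
      (gaussMeasure (n := n) x) :=
    integrable_of_compact (smooth_gradInner hx.isImm hψ hφs).continuous
      (hasCompactSupport_gradInner hψc φ)
  have hi2 : Integrable (fun p => χ k p ^ 2 * gradSq (n := n) x φ p) (gaussMeasure (n := n) x) :=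
    integrable_of_compact ((hs.continuous.pow 2).mul (continuous_gradSq hx.isImm hφs))
      ((hc.comp_left (g := fun t => t ^ 2) (by simp)).mul_right)
  have hi3 := hφ.integrable_mul hφ
  have hi4 : Integrable (fun p => χ k p * χ k p * φ p * φ p) (gaussMeasure (n := n) x) :=
    integrable_of_compact (((hs.mul hs).mul hφs).mul hφs).continuous hψc.mul_right
  have hpt : ∀ p, χ k p ^ 2 * gradSq (n := n) x φ p ≤
      2 * gradInner (n := n) x (fun q => χ k q * χ k q * φ q) φ p + 4 * (φ p * φ p) := by
    intro p
    have h2 := gradInner_sq_mul hx.isImm (ψ := φ) hs hφs p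
    -- With the parameter `1/2`, Young's inequality absorbs half of `χ² |∇φ|²` and leaves `2 φ²
    -- |∇χ|²`.
    have h3 := (abs_le.1 (abs_mul_gradInner_le (n := n) (x := x) (χ k) φ (χ k p) (φ p)
      (ε := 1 / 2) (by norm_num) p)).1
    have h4 : gradSq (n := n) x (χ k) p ≤ 1 := (hχ.grad k p).trans (by
      rw [one_div]
      exact pow_le_one₀ (by positivity) (inv_le_one_of_one_le₀ (by linarith [k.cast_nonneg (α := ℝ)])))
    rw [h2, ← gradSq_eq]
    have h5 := mul_le_mul_of_nonneg_left h4 (sq_nonneg (φ p))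
    linear_combination 2 * h3 + 4 * h5
  have h6 : ∫ p, χ k p ^ 2 * gradSq (n := n) x φ p ∂(gaussMeasure (n := n) x) ≤
      2 * (ν * ∫ p, χ k p * χ k p * φ p * φ p ∂(gaussMeasure (n := n) x)) +
        4 * ∫ p, φ p * φ p ∂(gaussMeasure (n := n) x) := by
    rw [← h1, ← integral_const_mul, ← integral_const_mul,
      ← integral_add (hi1.const_mul 2) (hi3.const_mul 4)]
    exact integral_mono hi2 ((hi1.const_mul 2).add (hi3.const_mul 4)) hpt
  have h7 : ∫ p, χ k p * χ k p * φ p * φ p ∂(gaussMeasure (n := n) x) ≤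
      ∫ p, φ p * φ p ∂(gaussMeasure (n := n) x) := by
    refine integral_mono hi4 hi3 fun p => ?_
    have h8 : χ k p * χ k p ≤ 1 := mul_le_one₀ (hχ.le_one k p) (hχ.nonneg k p) (hχ.le_one k p)
    have h9 := mul_le_mul_of_nonneg_right h8 (mul_self_nonneg (φ p))
    simp only
    linear_combination h9
  have h8 : 0 ≤ ∫ p, χ k p * χ k p * φ p * φ p ∂(gaussMeasure (n := n) x) :=
    integral_nonneg fun p => by
      simp only [mul_assoc (χ k p * χ k p)]
      exact mul_nonneg (mul_self_nonneg _) (mul_self_nonneg _)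
  have h9 : ν * ∫ p, χ k p * χ k p * φ p * φ p ∂(gaussMeasure (n := n) x) ≤
      |ν| * ∫ p, φ p * φ p ∂(gaussMeasure (n := n) x) :=
    (mul_le_mul_of_nonneg_right (le_abs_self ν) h8).trans
      (mul_le_mul_of_nonneg_left h7 (abs_nonneg ν))
  linarith

theorem tendsto_one_div_add_one_mul (C : ℝ) :
    Filter.Tendsto (fun k : ℕ => 1 / ((k : ℝ) + 1) * C) Filter.atTop (𝓝 0) := by
  simpa using (tendsto_one_div_add_atTop_nhds_zero_nat (𝕜 := ℝ)).mul_const C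

/-- Eigenfunctions with different eigenvalues are orthogonal. -/
theorem IsEigenfunction.integral_mul_eq_zero (hx : IsShrinker (n := n) x)
    [IsFiniteMeasure (gaussMeasure (n := n) x)] {χ : ℕ → M → ℝ} (hχ : IsExhaustion (n := n) x χ)
    {ν μ : ℝ} {φ ψ : M → ℝ} (hφ : IsEigenfunction (n := n) x ν φ)
    (hψ : IsEigenfunction (n := n) x μ ψ) (hne : ν ≠ μ) :
    ∫ p, φ p * ψ p ∂(gaussMeasure (n := n) x) = 0 := by
  have hφs : Smooth n φ := hφ.smooth
  have hψs : Smooth n ψ := hψ.smooth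
  set A := ∫ p, φ p * φ p ∂(gaussMeasure (n := n) x) with hA
  set B := ∫ p, ψ p * ψ p ∂(gaussMeasure (n := n) x) with hB
  set C := B + (2 * |ν| + 4) * A + (A + (2 * |μ| + 4) * B) with hC
  -- Each equation is tested with `χ²` times the other function. In the difference the symmetric
  -- gradient terms cancel, and every remaining term contains `∇χ`; Young's inequality with
  -- parameter `ε` and Caccioppoli's inequality bound it by `ε C`.
  have hbound : ∀ k : ℕ,
      |(ν - μ) * ∫ p, χ k p * χ k p * (φ p * ψ p) ∂(gaussMeasure (n := n) x)| ≤
        1 / ((k : ℝ) + 1) * C := by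
    intro k
    set ε := 1 / ((k : ℝ) + 1) with hε
    have hεpos : 0 < ε := by positivity
    have hs := hχ.smooth k
    have hc := hχ.compact k
    have hcsq : HasCompactSupport (fun p => χ k p ^ 2) :=
      hc.comp_left (g := fun t => t ^ 2) (by simp)
    have h1 := hφ.integral_gradInner hx ((hs.mul hs).mul hψs) (hc.mul_right.mul_right)
    have h2 := hψ.integral_gradInner hx ((hs.mul hs).mul hφs) (hc.mul_right.mul_right)
    have hi1 : Integrable (gradInner (n := n) x (fun q => χ k q * χ k q * ψ q) φ)
        (gaussMeasure (n := n) x) :=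
      integrable_of_compact (smooth_gradInner hx.isImm ((hs.mul hs).mul hψs) hφs).continuous
        (hasCompactSupport_gradInner hc.mul_right.mul_right φ)
    have hi2 : Integrable (gradInner (n := n) x (fun q => χ k q * χ k q * φ q) ψ)
        (gaussMeasure (n := n) x) :=
      integrable_of_compact (smooth_gradInner hx.isImm ((hs.mul hs).mul hφs) hψs).continuous
        (hasCompactSupport_gradInner hc.mul_right.mul_right ψ)
    have hi3 : Integrable (fun p => χ k p ^ 2 * gradSq (n := n) x φ p) (gaussMeasure (n := n) x) :=
      integrable_of_compact ((hs.continuous.pow 2).mul (continuous_gradSq hx.isImm hφs))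
        hcsq.mul_right
    have hi4 : Integrable (fun p => χ k p ^ 2 * gradSq (n := n) x ψ p) (gaussMeasure (n := n) x) :=
      integrable_of_compact ((hs.continuous.pow 2).mul (continuous_gradSq hx.isImm hψs))
        hcsq.mul_right
    have h3 : (ν - μ) * ∫ p, χ k p * χ k p * (φ p * ψ p) ∂(gaussMeasure (n := n) x) =
        ∫ p, (gradInner (n := n) x (fun q => χ k q * χ k q * ψ q) φ p -
          gradInner (n := n) x (fun q => χ k q * χ k q * φ q) ψ p) ∂(gaussMeasure (n := n) x) := by
      rw [integral_sub hi1 hi2, h1, h2, sub_mul]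
      congr 3
      · funext p; ring
      · funext p; ring
    have hpt : ∀ p, |gradInner (n := n) x (fun q => χ k q * χ k q * ψ q) φ p -
          gradInner (n := n) x (fun q => χ k q * χ k q * φ q) ψ p| ≤
        ε * ((ψ p * ψ p + χ k p ^ 2 * gradSq (n := n) x φ p) +
          (φ p * φ p + χ k p ^ 2 * gradSq (n := n) x ψ p)) := by
      intro p
      have e1 := gradInner_sq_mul hx.isImm (ψ := φ) hs hψs p
      have e2 := gradInner_sq_mul hx.isImm (ψ := ψ) hs hφs p
      have hY : ∀ a b : M → ℝ, |2 * a p * χ k p * gradInner (n := n) x (χ k) b p| ≤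
          ε * (a p * a p + χ k p ^ 2 * gradSq (n := n) x b p) := by
        intro a b
        refine (abs_mul_gradInner_le (χ k) b (χ k p) (a p) hεpos p).trans ?_
        have h5 := mul_le_mul_of_nonneg_left (hχ.grad k p)
          (show 0 ≤ a p ^ 2 / ε by positivity)
        have h6 : a p ^ 2 / ε * ε ^ 2 = ε * a p ^ 2 := by field_simp
        rw [← hε, h6] at h5
        linear_combination h5
      rw [e1, e2, gradInner_comm φ ψ]
      have e3 : χ k p ^ 2 * gradInner (n := n) x ψ φ p +
          2 * ψ p * χ k p * gradInner (n := n) x (χ k) φ p -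
          (χ k p ^ 2 * gradInner (n := n) x ψ φ p +
            2 * φ p * χ k p * gradInner (n := n) x (χ k) ψ p) =
          2 * ψ p * χ k p * gradInner (n := n) x (χ k) φ p -
            2 * φ p * χ k p * gradInner (n := n) x (χ k) ψ p := by ring
      rw [e3]
      refine (abs_sub _ _).trans ?_
      linarith [hY ψ φ, hY φ ψ]
    have hi5 := hψ.integrable_mul hψ
    have hi6 := hφ.integrable_mul hφ
    rw [h3]
    refine (abs_integral_le_integral_abs).trans ?_
    refine (integral_mono (hi1.sub hi2).abs
      (((hi5.add hi3).add (hi6.add hi4)).const_mul ε) hpt).trans ?_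
    rw [integral_const_mul]
    refine mul_le_mul_of_nonneg_left ?_ hεpos.le
    have e4 := integral_add (hi5.add hi3) (hi6.add hi4)
    have e5 := integral_add hi5 hi3
    have e6 := integral_add hi6 hi4
    simp only [Pi.add_apply] at e4 e5 e6 ⊢
    rw [e4, e5, e6]
    have := hφ.integral_sq_mul_gradSq_le hx hχ k
    have := hψ.integral_sq_mul_gradSq_le hx hχ k
    linarith
  have h1 := ((hχ.tendsto_integral (hφ.integrable_mul hψ)).const_mul (ν - μ)).abs
  have h2 := le_of_tendsto_of_tendsto' h1 (tendsto_one_div_add_one_mul C) hbound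
  have h3 := abs_eq_zero.1 (le_antisymm h2 (abs_nonneg _))
  exact (mul_eq_zero.1 h3).resolve_left (sub_ne_zero.2 hne)

theorem gradInner_sum_right (hx : IsImm (n := n) x) {ι : Type*} [Fintype ι] (ψ : M → ℝ)
    {φ : ι → M → ℝ} (hφ : ∀ i, Smooth n (φ i)) (a : ι → ℝ) (p : M) :
    gradInner (n := n) x ψ (fun q => ∑ i, a i • φ i q) p =
      ∑ i, a i * gradInner (n := n) x ψ (φ i) p := by
  have h1 : ∀ w, tanDeriv (n := n) x (fun q => ∑ i, a i • φ i q) w p =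
      ∑ i, a i * tanDeriv (n := n) x (φ i) w p := by
    intro w
    rw [tanDeriv_sum (u := fun i q => a i • φ i q) _
      (fun i _ => (hφ i).clm (a i • ContinuousLinearMap.id ℝ ℝ))]
    exact Finset.sum_congr rfl fun i _ => tanDeriv_const_smul hx (hφ i) (a i) w p
  unfold gradInner
  simp only [h1, Finset.mul_sum]
  rw [Finset.sum_comm]
  exact Finset.sum_congr rfl fun i _ => Finset.sum_congr rfl fun j _ => by ring

/-- The Rayleigh bound for truncated linear combinations of eigenfunctions. -/
theorem sum_mul_integral_le (hx : IsShrinker (n := n) x)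
    [IsFiniteMeasure (gaussMeasure (n := n) x)] {χ : ℕ → M → ℝ} (hχ : IsExhaustion (n := n) x χ)
    {ι : Type*} [Fintype ι] {ν : ι → ℝ} {φ : ι → M → ℝ}
    (hφ : ∀ i, IsEigenfunction (n := n) x (ν i) (φ i)) (a : ι → ℝ) (k : ℕ) {θ : ℝ}
    (h : θ * ∫ p, (χ k p * ∑ i, a i • φ i p) ^ 2 ∂(gaussMeasure (n := n) x) ≤
      ∫ p, gradSq (n := n) x (fun q => χ k q * ∑ i, a i • φ i q) p ∂(gaussMeasure (n := n) x)) :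
    ∑ i, ∑ j, a i * a j * ((θ - ν j) *
        ∫ p, χ k p * χ k p * (φ i p * φ j p) ∂(gaussMeasure (n := n) x)) ≤
      1 / ((k : ℝ) + 1) * (1 / ((k : ℝ) + 1) *
        ∑ i, ∑ j, a i * a j * ∫ p, φ i p * φ j p ∂(gaussMeasure (n := n) x)) := by
  have hs := hχ.smooth k
  have hc := hχ.compact k
  have hφs : ∀ i, Smooth n (φ i) := fun i => (hφ i).smooth
  set Φ : M → ℝ := fun p => ∑ i, a i • φ i p with hΦ
  have hΦs : Smooth n Φ :=
    Smooth.sum fun i _ => (hφs i).clm (a i • ContinuousLinearMap.id ℝ ℝ)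
  have hψs : Smooth n (fun q => χ k q * χ k q * Φ q) := (hs.mul hs).mul hΦs
  have hψc : HasCompactSupport (fun q => χ k q * χ k q * Φ q) := hc.mul_right.mul_right
  have hprod : ∀ p, Φ p * Φ p = ∑ i, ∑ j, a i * a j * (φ i p * φ j p) := by
    intro p
    simp only [hΦ, smul_eq_mul]
    rw [Finset.sum_mul_sum]
    exact Finset.sum_congr rfl fun i _ => Finset.sum_congr rfl fun j _ => by ring
  have hij : ∀ i j, Integrable (fun p => φ i p * φ j p) (gaussMeasure (n := n) x) :=
    fun i j => (hφ i).integrable_mul (hφ j)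
  have hij' : ∀ i j, Integrable (fun p => χ k p * χ k p * (φ i p * φ j p))
      (gaussMeasure (n := n) x) := fun i j =>
    integrable_of_compact ((hs.mul hs).mul ((hφs i).mul (hφs j))).continuous hc.mul_right.mul_right
  have hΦi : Integrable (fun p => Φ p * Φ p) (gaussMeasure (n := n) x) := by
    simp only [hprod]
    exact integrable_finsetSum _ fun i _ => integrable_finsetSum _ fun j _ =>
      (hij i j).const_mul _
  have e1 : ∫ p, Φ p * Φ p ∂(gaussMeasure (n := n) x) =
      ∑ i, ∑ j, a i * a j * ∫ p, φ i p * φ j p ∂(gaussMeasure (n := n) x) := by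
    simp only [hprod]
    rw [integral_finsetSum _ fun i _ => integrable_finsetSum _ fun j _ => (hij i j).const_mul _]
    refine Finset.sum_congr rfl fun i _ => ?_
    rw [integral_finsetSum _ fun j _ => (hij i j).const_mul _]
    exact Finset.sum_congr rfl fun j _ => integral_const_mul _ _
  have e2 : ∫ p, (χ k p * Φ p) ^ 2 ∂(gaussMeasure (n := n) x) =
      ∑ i, ∑ j, a i * a j *
        ∫ p, χ k p * χ k p * (φ i p * φ j p) ∂(gaussMeasure (n := n) x) := by
    have : ∀ p, (χ k p * Φ p) ^ 2 =
        ∑ i, ∑ j, a i * a j * (χ k p * χ k p * (φ i p * φ j p)) := by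
      intro p
      calc (χ k p * Φ p) ^ 2 = χ k p * χ k p * (Φ p * Φ p) := by ring
        _ = _ := by
          rw [hprod, Finset.mul_sum]
          refine Finset.sum_congr rfl fun i _ => ?_
          rw [Finset.mul_sum]
          exact Finset.sum_congr rfl fun j _ => by ring
    simp only [this]
    rw [integral_finsetSum _ fun i _ => integrable_finsetSum _ fun j _ => (hij' i j).const_mul _]
    refine Finset.sum_congr rfl fun i _ => ?_
    rw [integral_finsetSum _ fun j _ => (hij' i j).const_mul _]
    exact Finset.sum_congr rfl fun j _ => integral_const_mul _ _
  have e3 : ∫ p, gradInner (n := n) x (fun q => χ k q * χ k q * Φ q) Φ p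
        ∂(gaussMeasure (n := n) x) =
      ∑ i, ∑ j, a i * a j * (ν j *
        ∫ p, χ k p * χ k p * (φ i p * φ j p) ∂(gaussMeasure (n := n) x)) := by
    simp only [hΦ, gradInner_sum_right hx.isImm _ hφs a]
    rw [integral_finsetSum _ fun j _ => Integrable.const_mul (integrable_of_compact
      (smooth_gradInner hx.isImm hψs (hφs j)).continuous (hasCompactSupport_gradInner hψc _)) _,
      Finset.sum_comm]
    refine Finset.sum_congr rfl fun j _ => ?_
    rw [integral_const_mul, (hφ j).integral_gradInner hx hψs hψc]
    have : ∀ p, χ k p * χ k p * Φ p * φ j p =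
        ∑ i, a i * (χ k p * χ k p * (φ i p * φ j p)) := by
      intro p
      simp only [hΦ, smul_eq_mul, Finset.mul_sum, Finset.sum_mul]
      exact Finset.sum_congr rfl fun i _ => by ring
    simp only [this]
    rw [integral_finsetSum _ fun i _ => (hij' i j).const_mul _, Finset.mul_sum, Finset.mul_sum]
    refine Finset.sum_congr rfl fun i _ => ?_
    rw [integral_const_mul]
    ring
  have hi1 : Integrable (gradInner (n := n) x (fun q => χ k q * χ k q * Φ q) Φ)
      (gaussMeasure (n := n) x) :=
    integrable_of_compact (smooth_gradInner hx.isImm hψs hΦs).continuous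
      (hasCompactSupport_gradInner hψc _)
  have hi2 : Integrable (gradSq (n := n) x (fun q => χ k q * Φ q)) (gaussMeasure (n := n) x) := by
    have h1 : gradSq (n := n) x (fun q => χ k q * Φ q) =
      gradInner (n := n) x (fun q => χ k q * Φ q) (fun q => χ k q * Φ q) := funext (gradSq_eq _)
    rw [h1]
    exact integrable_of_compact (smooth_gradInner hx.isImm (hs.mul hΦs) (hs.mul hΦs)).continuous
      (hasCompactSupport_gradInner hc.mul_right _)
  -- Testing with `χ² Φ` reduces the energy of the truncation to the eigenvalue equations, which
  -- need compact support only in the test function.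
  have hle : ∫ p, gradSq (n := n) x (fun q => χ k q * Φ q) p ∂(gaussMeasure (n := n) x) ≤
      ∫ p, gradInner (n := n) x (fun q => χ k q * χ k q * Φ q) Φ p ∂(gaussMeasure (n := n) x) +
        (1 / ((k : ℝ) + 1)) ^ 2 * ∫ p, Φ p * Φ p ∂(gaussMeasure (n := n) x) := by
    rw [← integral_const_mul, ← integral_add hi1 (hΦi.const_mul _)]
    refine integral_mono hi2 (hi1.add (hΦi.const_mul _)) fun p => ?_
    rw [gradSq_mul hx.isImm hs hΦs p]
    have := mul_le_mul_of_nonneg_left (hχ.grad k p) (sq_nonneg (Φ p))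
    linear_combination this
  have hfin := h.trans hle
  rw [e2, e3, e1] at hfin
  have e4 : ∑ i, ∑ j, a i * a j * ((θ - ν j) *
        ∫ p, χ k p * χ k p * (φ i p * φ j p) ∂(gaussMeasure (n := n) x)) =
      θ * (∑ i, ∑ j, a i * a j *
        ∫ p, χ k p * χ k p * (φ i p * φ j p) ∂(gaussMeasure (n := n) x)) -
      ∑ i, ∑ j, a i * a j * (ν j *
        ∫ p, χ k p * χ k p * (φ i p * φ j p) ∂(gaussMeasure (n := n) x)) := by
    rw [Finset.mul_sum, ← Finset.sum_sub_distrib]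
    refine Finset.sum_congr rfl fun i _ => ?_
    rw [Finset.mul_sum, ← Finset.sum_sub_distrib]
    exact Finset.sum_congr rfl fun j _ => by ring
  rw [e4, ← mul_assoc, ← sq]
  linarith

/-- If `m + 1` independent eigenfunctions had eigenvalues below `θ`, some normalized combination of
their truncations would satisfy the conditions at every stage. In the limit the form with matrix `(θ
- ν_j) ∫ φ_i φ_j` would be nonpositive on a nonzero vector. It is positive definite, by
orthogonality of different eigenspaces and linear independence. -/
theorem le_driftEigenvalue (hx : IsShrinker (n := n) x)
    (hcomplete : IsCompleteImm (n := n) x)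
    [IsFiniteMeasure (gaussMeasure (n := n) x)] {ι : Type*} [Fintype ι]
    (ℓ : testSpace n M →ₗ[ℝ] (ι → ℝ)) {m : ℕ} (hι : Fintype.card ι ≤ m) {θ : ℝ}
    (hℓ : ∀ φ : testSpace n M, ℓ φ = 0 →
      θ * ∫ p, (φ : M → ℝ) p ^ 2 ∂(gaussMeasure (n := n) x) ≤
        ∫ p, gradSq (n := n) x φ p ∂(gaussMeasure (n := n) x)) :
    (θ : EReal) ≤ driftEigenvalue (n := n) x m := by
  unfold driftEigenvalue
  refine le_iInf₂ fun c hc => ?_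
  obtain ⟨ν, φ, hli, hφ'⟩ := hc
  rw [EReal.coe_le_coe_iff]
  by_contra hlt
  rw [not_le] at hlt
  have hφ : ∀ i, IsEigenfunction (n := n) x (ν i) (φ i) := fun i => (hφ' i).2
  have hφs : ∀ i, Smooth n (φ i) := fun i => (hφ i).smooth
  obtain ⟨χ, h1, h2, h3, h4, h5, h6⟩ := exists_cutoff_seq hx.isImm hcomplete
  have hχ : IsExhaustion (n := n) x χ := ⟨h1, h2, h3, h4, h5, h6⟩
  have hmem : ∀ k i, (fun p => χ k p * φ i p) ∈ testSpace n M := fun k i =>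
    ⟨(h1 k).mul (hφs i), (h2 k).mul_right⟩
  let T : ℕ → (Fin (m + 1) → ℝ) →ₗ[ℝ] testSpace n M := fun k =>
    Fintype.linearCombination ℝ fun i => (⟨_, hmem k i⟩ : testSpace n M)
  have hT : ∀ k a, (T k a : M → ℝ) = fun p => χ k p * ∑ i, a i • φ i p := by
    intro k a
    funext p
    simp only [T, Fintype.linearCombination_apply, Submodule.coe_sum, Submodule.coe_smul,
      Finset.sum_apply, Pi.smul_apply, smul_eq_mul, Finset.mul_sum]
    exact Finset.sum_congr rfl fun i _ => by ring
  -- There are `m + 1` coefficients and at most `m` conditions. Normalization keeps the limit of the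
  -- coefficients nonzero, even though the conditions themselves need not pass to the limit.
  have hexists : ∀ k, ∃ a : Fin (m + 1) → ℝ, ‖a‖ = 1 ∧ ℓ (T k a) = 0 := by
    intro k
    have hker := LinearMap.ker_ne_bot_of_finrank_lt (f := ℓ ∘ₗ T k)
      (by simp only [Module.finrank_fintype_fun_eq_card, Fintype.card_fin]; omega)
    obtain ⟨b, hb, hne⟩ := (Submodule.ne_bot_iff _).1 hker
    have hb' : ℓ (T k b) = 0 := hb
    have hnb : ‖b‖ ≠ 0 := norm_ne_zero_iff.2 hne
    exact ⟨‖b‖⁻¹ • b, by rw [norm_smul, norm_inv, norm_norm, inv_mul_cancel₀ hnb],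
      by rw [map_smul, map_smul, hb', smul_zero]⟩
  choose a ha1 ha2 using hexists
  obtain ⟨b, hb, σ, hσ, hlim⟩ := (isCompact_sphere (0 : Fin (m + 1) → ℝ) 1).tendsto_subseq
    (x := a) fun k => by simp [ha1 k]
  set G : Fin (m + 1) → Fin (m + 1) → ℝ := fun i j =>
    ∫ p, φ i p * φ j p ∂(gaussMeasure (n := n) x) with hG
  have hineq : ∀ k, ∑ i, ∑ j, a k i * a k j * ((θ - ν j) *
        ∫ p, χ k p * χ k p * (φ i p * φ j p) ∂(gaussMeasure (n := n) x)) ≤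
      1 / ((k : ℝ) + 1) * (1 / ((k : ℝ) + 1) * ∑ i, ∑ j, a k i * a k j * G i j) := by
    intro k
    refine sum_mul_integral_le hx hχ hφ (a k) k ?_
    have := hℓ (T k (a k)) (ha2 k)
    rw [hT] at this
    exact this
  have hai : ∀ i, Filter.Tendsto (fun k => a (σ k) i) Filter.atTop (𝓝 (b i)) := fun i =>
    (tendsto_pi_nhds.1 hlim) i
  have hL : Filter.Tendsto (fun k => ∑ i, ∑ j, a (σ k) i * a (σ k) j * ((θ - ν j) *
        ∫ p, χ (σ k) p * χ (σ k) p * (φ i p * φ j p) ∂(gaussMeasure (n := n) x))) Filter.atTop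
      (𝓝 (∑ i, ∑ j, b i * b j * ((θ - ν j) * G i j))) := by
    refine tendsto_finsetSum _ fun i _ => tendsto_finsetSum _ fun j _ => ?_
    exact ((hai i).mul (hai j)).mul
      (((hχ.tendsto_integral ((hφ i).integrable_mul (hφ j))).comp hσ.tendsto_atTop).const_mul _)
  have hε : Filter.Tendsto (fun k => 1 / ((σ k : ℝ) + 1)) Filter.atTop (𝓝 0) :=
    (tendsto_one_div_add_atTop_nhds_zero_nat (𝕜 := ℝ)).comp hσ.tendsto_atTop
  have hR : Filter.Tendsto (fun k => 1 / ((σ k : ℝ) + 1) * (1 / ((σ k : ℝ) + 1) *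
      ∑ i, ∑ j, a (σ k) i * a (σ k) j * G i j)) Filter.atTop
      (𝓝 (0 * (0 * ∑ i, ∑ j, b i * b j * G i j))) := by
    refine hε.mul (hε.mul (tendsto_finsetSum _ fun i _ => tendsto_finsetSum _ fun j _ => ?_))
    exact ((hai i).mul (hai j)).mul_const _
  have hfin := le_of_tendsto_of_tendsto' hL hR fun k => hineq (σ k)
  rw [zero_mul] at hfin
  have hpos : ∀ i, 0 < θ - ν i := fun i => by linarith [(hφ' i).1]
  set s : Fin (m + 1) → ℝ := fun i => Real.sqrt (θ - ν i) with hs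
  have hspos : ∀ i, 0 < s i := fun i => Real.sqrt_pos.2 (hpos i)
  -- Orthogonality makes the coefficient matter only when `ν i = ν j`, where it equals `s i * s j`.
  -- The limiting form is then the integral of the square of `∑ b_i s_i φ_i`.
  have hGs : ∀ i j, (θ - ν j) * G i j = s i * s j * G i j := by
    intro i j
    by_cases hij : ν i = ν j
    · have : s i * s j = θ - ν j := by
        rw [hs]
        simp only [hij]
        exact Real.mul_self_sqrt (hpos j).le
      rw [this]
    · have : G i j = 0 := (hφ i).integral_mul_eq_zero hx hχ (hφ j) hij
      rw [this, mul_zero, mul_zero]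
  set Ψ : M → ℝ := fun p => ∑ i, (b i * s i) • φ i p with hΨ
  have hprod : ∀ p, Ψ p ^ 2 = ∑ i, ∑ j, b i * b j * (s i * s j) * (φ i p * φ j p) := by
    intro p
    simp only [hΨ, smul_eq_mul, sq]
    rw [Finset.sum_mul_sum]
    exact Finset.sum_congr rfl fun i _ => Finset.sum_congr rfl fun j _ => by ring
  have hΨi : Integrable (fun p => Ψ p ^ 2) (gaussMeasure (n := n) x) := by
    simp only [hprod]
    exact integrable_finsetSum _ fun i _ => integrable_finsetSum _ fun j _ =>
      ((hφ i).integrable_mul (hφ j)).const_mul _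
  have hΨint : ∫ p, Ψ p ^ 2 ∂(gaussMeasure (n := n) x) ≤ 0 := by
    refine le_of_eq_of_le ?_ hfin
    simp only [hprod]
    rw [integral_finsetSum _ fun i _ => integrable_finsetSum _ fun j _ =>
      ((hφ i).integrable_mul (hφ j)).const_mul _]
    refine Finset.sum_congr rfl fun i _ => ?_
    rw [integral_finsetSum _ fun j _ => ((hφ i).integrable_mul (hφ j)).const_mul _]
    refine Finset.sum_congr rfl fun j _ => ?_
    rw [integral_const_mul, hGs]
    ring
  have hΨs : Smooth n Ψ :=
    Smooth.sum fun i _ => (hφs i).clm ((b i * s i) • ContinuousLinearMap.id ℝ ℝ)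
  have hΨ0 := eq_zero_of_integral_sq_nonpos hx.isImm hΨs.continuous hΨi hΨint
  have hzero : ∑ i, (b i * s i) • φ i = 0 := by
    rw [← hΨ0]
    funext p
    simp [hΨ, Finset.sum_apply]
  have hb0 : b = 0 := by
    funext i
    have := Fintype.linearIndependent_iff.1 hli _ hzero i
    exact (mul_eq_zero.1 this).resolve_right (hspos i).ne'
  rw [hb0] at hb
  simp at hb

end Core


/-! ### Index, linear conditions and their number -/

section Index

variable {n N : ℕ} {M : Type*} [TopologicalSpace M] [T2Space M] [SecondCountableTopology M]
  [ChartedSpace (Euc n) M] [MeasurableSpace M] [BorelSpace M] [IsManifold (𝓡 n) ∞ M]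
variable {x : M → Euc N}

theorem IsShrinker.smooth_meanCurv (hx : IsShrinker (n := n) x) :
    Smooth n (meanCurv (n := n) x) := by
  have h : meanCurv (n := n) x = fun p => (1 / 2 : ℝ) • norPart (n := n) x p (x p) :=
    funext hx.equation
  rw [h]
  exact (smooth_norPart hx.isImm hx.smooth).clm ((1 / 2 : ℝ) • ContinuousLinearMap.id ℝ (Euc N))

theorem integrable_inner_of_compact
    [IsFiniteMeasure (gaussMeasure (n := n) x)] {u w : M → Euc N} (hu : Smooth n u)
    (hc : HasCompactSupport u) (hw : Smooth n w) :
    Integrable (fun p => ⟪u p, w p⟫_ℝ) (gaussMeasure (n := n) x) :=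
  integrable_of_compact (hu.inner hw).continuous
    (HasCompactSupport.intro hc.isCompact fun p hp => by
      simp [image_eq_zero_of_notMem_tsupport hp])

theorem IsAllowable.add (hx : IsShrinker (n := n) x) [IsFiniteMeasure (gaussMeasure (n := n) x)]
    {u v : M → Euc N} (hu : IsAllowable (n := n) x u) (hv : IsAllowable (n := n) x v) :
    IsAllowable (n := n) x (u + v) where
  smooth := hu.smooth.add hv.smooth
  compact := hu.compact.add hv.compact
  normal p := by
    have h1 := hu.normal p
    have h2 := hv.normal p
    rw [tanPart_eq] at *
    rw [Pi.add_apply, map_add, h1, h2, add_zero]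
  orth_meanCurv := by
    simp only [Pi.add_apply, inner_add_left]
    rw [integral_add (integrable_inner_of_compact hu.smooth hu.compact hx.smooth_meanCurv)
      (integrable_inner_of_compact hv.smooth hv.compact hx.smooth_meanCurv),
      hu.orth_meanCurv, hv.orth_meanCurv, add_zero]
  orth_translation V := by
    simp only [Pi.add_apply, inner_add_left]
    have hV : Smooth n (fun p => norPart (n := n) x p V) := smooth_norPart hx.isImm contMDiff_const
    rw [integral_add (integrable_inner_of_compact hu.smooth hu.compact hV)
      (integrable_inner_of_compact hv.smooth hv.compact hV),
      hu.orth_translation, hv.orth_translation, add_zero]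

theorem IsAllowable.smul {u : M → Euc N} (hu : IsAllowable (n := n) x u) (c : ℝ) :
    IsAllowable (n := n) x (c • u) where
  smooth := Smooth.clm hu.smooth (c • ContinuousLinearMap.id ℝ (Euc N))
  compact := hu.compact.smul_left (f := fun _ => c)
  normal p := by
    have h1 := hu.normal p
    rw [tanPart_eq] at *
    rw [Pi.smul_apply, map_smul, h1, smul_zero]
  orth_meanCurv := by
    simp only [Pi.smul_apply, real_inner_smul_left]
    rw [integral_const_mul, hu.orth_meanCurv, mul_zero]
  orth_translation V := by
    simp only [Pi.smul_apply, real_inner_smul_left]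
    rw [integral_const_mul, hu.orth_translation, mul_zero]

/-- A negative space whose dimension is the index. -/
theorem exists_negativeSpace_of_FIndex_eq {I : ℕ} (h : FIndex (n := n) x = (I : ℕ∞)) :
    ∃ W : Submodule ℝ (M → Euc N), IsNegativeSpace (n := n) x W ∧ Module.finrank ℝ W = I := by
  by_contra! hcon
  have hle : ∀ W : Submodule ℝ (M → Euc N), IsNegativeSpace (n := n) x W →
      Module.finrank ℝ W ≤ I := by
    intro W hW
    have := le_iSup₂ (f := fun (W : Submodule ℝ (M → Euc N)) (_ : IsNegativeSpace (n := n) x W) =>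
      ((Module.finrank ℝ W : ℕ) : ℕ∞)) W hW
    change _ ≤ FIndex (n := n) x at this
    rw [h] at this
    exact_mod_cast this
  -- If the index were not attained, `I - 1` would be a smaller bound. The truncated subtraction
  -- does no harm, because the zero space excludes `I = 0`.
  have hlt : ∀ W : Submodule ℝ (M → Euc N), IsNegativeSpace (n := n) x W →
      Module.finrank ℝ W ≤ I - 1 := fun W hW => by
    have := hle W hW
    have := hcon W hW
    omega
  have hbot : IsNegativeSpace (n := n) x (⊥ : Submodule ℝ (M → Euc N)) := by
    refine ⟨inferInstance, fun u hu => ?_, fun u hu hne => (hne ((Submodule.mem_bot ℝ).1 hu)).elim⟩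
    rw [(Submodule.mem_bot ℝ).1 hu]
    exact ⟨contMDiff_const, HasCompactSupport.zero, fun p => by simp [tanPart_eq], by simp,
      by simp⟩
  have hI : I ≠ 0 := fun h0 => hcon ⊥ hbot (by simp [h0])
  have h1 : FIndex (n := n) x ≤ ((I - 1 : ℕ) : ℕ∞) :=
    iSup₂_le fun W hW => by exact_mod_cast hlt W hW
  rw [h] at h1
  have : I ≤ I - 1 := by exact_mod_cast h1
  omega

theorem IsAllowable.secondVariation_eq (hx : IsShrinker (n := n) x)
    [IsFiniteMeasure (gaussMeasure (n := n) x)] {u : M → Euc N} (hu : IsAllowable (n := n) x u) :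
    secondVariation (n := n) x u = secondForm (n := n) x u u :=
  secondVariation_eq_secondForm hx hu.smooth hu.compact hu.normal

/-- Finitely many linear conditions, as many as the index, force stability. -/
theorem exists_fields_of_FIndex_eq (hx : IsShrinker (n := n) x)
    [IsFiniteMeasure (gaussMeasure (n := n) x)] {I : ℕ} (h : FIndex (n := n) x = (I : ℕ∞)) :
    ∃ z : Fin I → M → Euc N, (∀ l, IsAllowable (n := n) x (z l)) ∧
      ∀ u, IsAllowable (n := n) x u → (∀ l, secondForm (n := n) x u (z l) = 0) →
        0 ≤ secondVariation (n := n) x u := by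
  obtain ⟨W, hW, hdim⟩ := exists_negativeSpace_of_FIndex_eq h
  have := hW.finite
  let b : Module.Basis (Fin I) ℝ W := Module.finBasisOfFinrankEq ℝ W hdim
  refine ⟨fun l => b l, fun l => hW.allowable _ (b l).2, fun u hu hz => ?_⟩
  by_contra hneg
  rw [not_le] at hneg
  let f : W →ₗ[ℝ] ℝ :=
    { toFun := fun w => secondForm (n := n) x w u
      map_add' := fun w w' => by
        have h1 := hW.allowable _ w.2
        have h2 := hW.allowable _ w'.2
        exact secondForm_add_left hx.isImm h1.smooth h2.smooth h1.compact h2.compact hu.smooth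
      map_smul' := fun c w => secondForm_smul_left hx.isImm (hW.allowable _ w.2).smooth c }
  have hf : f = 0 := b.ext fun l => by
    change secondForm (n := n) x (b l) u = 0
    rw [secondForm_comm]
    exact hz l
  have hWu : ∀ w ∈ W, secondForm (n := n) x w u = 0 := fun w hw =>
    LinearMap.congr_fun hf ⟨w, hw⟩
  have huW : u ∉ W := fun hmem => by
    rw [hu.secondVariation_eq hx, hWu u hmem] at hneg
    exact lt_irrefl _ hneg
  -- No cross term appears, since `u` is orthogonal to `W` for the form. A negative `u` would
  -- therefore extend `W` to a negative space of dimension `I + 1`.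
  have hexp : ∀ w ∈ W, ∀ c : ℝ, secondVariation (n := n) x (w + c • u) =
      secondVariation (n := n) x w + c ^ 2 * secondVariation (n := n) x u := by
    intro w hw c
    have hwa := hW.allowable w hw
    have hcu := hu.smul c
    rw [(hwa.add hx hcu).secondVariation_eq hx, hwa.secondVariation_eq hx,
      hu.secondVariation_eq hx,
      secondForm_add_left hx.isImm hwa.smooth hcu.smooth hwa.compact hcu.compact
        (hwa.add hx hcu).smooth, secondForm_comm w, secondForm_comm (c • u),
      secondForm_add_left hx.isImm hwa.smooth hcu.smooth hwa.compact hcu.compact hwa.smooth,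
      secondForm_add_left hx.isImm hwa.smooth hcu.smooth hwa.compact hcu.compact hcu.smooth,
      secondForm_smul_left hx.isImm hu.smooth, secondForm_smul_left hx.isImm hu.smooth,
      secondForm_comm w (c • u), secondForm_smul_left hx.isImm hu.smooth, secondForm_comm u w,
      secondForm_comm u (c • u), secondForm_smul_left hx.isImm hu.smooth, hWu w hw]
    ring
  have hneg' : IsNegativeSpace (n := n) x (W ⊔ Submodule.span ℝ {u}) := by
    refine ⟨inferInstance, fun v hv => ?_, fun v hv hne => ?_⟩
    · obtain ⟨w, hw, y, hy, rfl⟩ := Submodule.mem_sup.1 hv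
      obtain ⟨c, rfl⟩ := Submodule.mem_span_singleton.1 hy
      exact (hW.allowable w hw).add hx (hu.smul c)
    · obtain ⟨w, hw, y, hy, rfl⟩ := Submodule.mem_sup.1 hv
      obtain ⟨c, rfl⟩ := Submodule.mem_span_singleton.1 hy
      rw [hexp w hw c]
      by_cases hw0 : w = 0
      · have hc : c ≠ 0 := by
          rintro rfl
          exact hne (by simp [hw0])
        have h0 : secondVariation (n := n) x (0 : M → Euc N) = 0 := by
          simp [secondVariation]
        rw [hw0, h0, zero_add]
        exact mul_neg_of_pos_of_neg (by positivity) hneg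
      · exact add_neg_of_neg_of_nonpos (hW.negative w hw hw0)
          (mul_nonpos_of_nonneg_of_nonpos (sq_nonneg c) hneg.le)
  have hle := le_iSup₂ (f := fun (W : Submodule ℝ (M → Euc N))
    (_ : IsNegativeSpace (n := n) x W) => ((Module.finrank ℝ W : ℕ) : ℕ∞)) _ hneg'
  change _ ≤ FIndex (n := n) x at hle
  have hu0 : u ≠ 0 := by
    rintro rfl
    exact huW W.zero_mem
  have hdim' := Submodule.finrank_sup_add_finrank_inf_eq W (Submodule.span ℝ {u})
  rw [(Submodule.disjoint_span_singleton_of_notMem huW).eq_bot, finrank_bot, add_zero, hdim,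
    finrank_span_singleton hu0] at hdim'
  rw [h, hdim'] at hle
  have : I + 1 ≤ I := by exact_mod_cast hle
  omega

/-- Integration of test functions against a continuous weight. -/
def testIntegral (x : M → Euc N) [IsFiniteMeasure (gaussMeasure (n := n) x)] (g : M → ℝ)
    (hg : Continuous g) : testSpace n M →ₗ[ℝ] ℝ where
  toFun φ := ∫ p, (φ : M → ℝ) p * g p ∂(gaussMeasure (n := n) x)
  map_add' φ ψ := by
    simp only [Submodule.coe_add, Pi.add_apply, add_mul]
    exact integral_add
      (integrable_of_compact (φ.2.1.continuous.mul hg) φ.2.2.mul_right)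
      (integrable_of_compact (ψ.2.1.continuous.mul hg) ψ.2.2.mul_right)
  map_smul' c φ := by
    simp only [Submodule.coe_smul, Pi.smul_apply, smul_eq_mul, mul_assoc, RingHom.id_apply]
    exact integral_const_mul _ _

/-- The second variation form paired with multiples of a field, as a linear form. -/
def testSecondForm (hx : IsImm (n := n) x) [IsFiniteMeasure (gaussMeasure (n := n) x)]
    {w z : M → Euc N} (hw : Smooth n w) (hz : Smooth n z) : testSpace n M →ₗ[ℝ] ℝ where
  toFun φ := secondForm (n := n) x (fun p => (φ : M → ℝ) p • w p) z
  map_add' φ ψ := by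
    have h1 : (fun p => ((φ + ψ : testSpace n M) : M → ℝ) p • w p) =
        (fun p => (φ : M → ℝ) p • w p) + fun p => (ψ : M → ℝ) p • w p := by
      funext p
      simp [add_smul]
    rw [h1]
    exact secondForm_add_left hx (Smooth.smul φ.2.1 hw) (Smooth.smul ψ.2.1 hw)
      φ.2.2.smul_right ψ.2.2.smul_right hz
  map_smul' c φ := by
    have h1 : (fun p => ((c • φ : testSpace n M) : M → ℝ) p • w p) =
        c • fun p => (φ : M → ℝ) p • w p := by
      funext p
      simp [mul_smul]
    rw [h1]
    exact secondForm_smul_left hx (Smooth.smul φ.2.1 hw) c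

/-- As `w` is normal, pairing it with `V^⊥` is the same as pairing it with `V`, so the basis vectors
suffice for all translations. -/
theorem isAllowable_smul
    [IsFiniteMeasure (gaussMeasure (n := n) x)] {φ : M → ℝ} (hφ : φ ∈ testSpace n M)
    {w : M → Euc N} (hw : Smooth n w) (hn : ∀ p, proj (n := n) x p (w p) = 0)
    (hH : ∫ p, φ p * ⟪w p, meanCurv (n := n) x p⟫_ℝ ∂(gaussMeasure (n := n) x) = 0)
    (hE : ∀ i, ∫ p, φ p * ⟪w p, stdVec i⟫_ℝ ∂(gaussMeasure (n := n) x) = 0) :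
    IsAllowable (n := n) x (fun p => φ p • w p) where
  smooth := Smooth.smul hφ.1 hw
  compact := hφ.2.smul_right
  normal p := by rw [tanPart_eq, map_smul, hn, smul_zero]
  orth_meanCurv := by
    simp only [real_inner_smul_left]
    exact hH
  orth_translation V := by
    have h1 : ∀ p, ⟪φ p • w p, norPart (n := n) x p V⟫_ℝ =
        ∑ i, V i * (φ p * ⟪w p, stdVec i⟫_ℝ) := by
      intro p
      rw [← inner_norPart, norPart_smul, norPart_of_normal (hn p), real_inner_smul_left]
      nth_rewrite 1 [← stdVec_sum V]
      rw [inner_sum, Finset.mul_sum]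
      refine Finset.sum_congr rfl fun i _ => ?_
      rw [real_inner_smul_right]
      ring
    simp only [h1]
    rw [integral_finsetSum]
    · simp only [integral_const_mul, hE, mul_zero, Finset.sum_const_zero]
    · intro i _
      refine Integrable.const_mul (integrable_of_compact ?_ hφ.2.mul_right) _
      exact (Smooth.mul hφ.1 (hw.inner contMDiff_const)).continuous

/-- The linear conditions under which all fields `φ E_j^⊥`, `j < K`, have nonnegative second
variation. -/
theorem exists_constraints (hx : IsShrinker (n := n) x)
    [IsFiniteMeasure (gaussMeasure (n := n) x)] {I K : ℕ} (h : FIndex (n := n) x = (I : ℕ∞))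
    (hK : K ≤ N) :
    ∃ ℓ : testSpace n M →ₗ[ℝ]
        ((Σ j : Fin K, Fin (N - j)) ⊕ (Fin K ⊕ (Fin K × Fin I)) → ℝ),
      ∀ φ : testSpace n M, ℓ φ = 0 → ∀ j : Fin K,
        0 ≤ ∫ p, (gradSq (n := n) x φ p - (1 / 2 : ℝ) * (φ : M → ℝ) p ^ 2) *
          ‖norPart (n := n) x p (stdVec (Fin.castLE hK j))‖ ^ 2 ∂(gaussMeasure (n := n) x) := by
  obtain ⟨z, hz, hstab⟩ := exists_fields_of_FIndex_eq hx h
  let w : Fin K → M → Euc N := fun j p => norPart (n := n) x p (stdVec (Fin.castLE hK j))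
  have hw : ∀ j, Smooth n (w j) := fun j => smooth_norPart hx.isImm contMDiff_const
  have hc1 : ∀ j (i : Fin N), Continuous fun p => ⟪w j p, stdVec i⟫_ℝ := fun j i =>
    ((hw j).inner contMDiff_const).continuous
  have hc2 : ∀ j, Continuous fun p => ⟪w j p, meanCurv (n := n) x p⟫_ℝ := fun j =>
    ((hw j).inner hx.smooth_meanCurv).continuous
  -- In the first summand the second index stores `i - j`, so translation conditions are imposed
  -- only for pairs with `i ≥ j`. The other two summands are the conditions for `H` and for a basis
  -- of a maximal negative space.
  refine ⟨LinearMap.pi (Sum.elim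
    (fun a => testIntegral x _ (hc1 a.1 ⟨a.1 + a.2, by omega⟩))
    (Sum.elim (fun j => testIntegral x _ (hc2 j))
      (fun a => testSecondForm hx.isImm (hw a.1) (hz a.2).smooth))), fun φ hφ j => ?_⟩
  have h1 : ∀ (j : Fin K) (i : Fin N), (j : ℕ) ≤ i →
      ∫ p, (φ : M → ℝ) p * ⟪w j p, stdVec i⟫_ℝ ∂(gaussMeasure (n := n) x) = 0 := by
    intro j i hji
    have h2 := congrFun hφ (Sum.inl ⟨j, ⟨i - j, by omega⟩⟩)
    have h3 : (⟨(j : ℕ) + (i - j), by omega⟩ : Fin N) = i := Fin.ext (by simp; omega)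
    have h4 : testIntegral x _ (hc1 j ⟨(j : ℕ) + (i - j), by omega⟩) φ = 0 := h2
    rw [h3] at h4
    exact h4
  have h2 : ∀ i : Fin N,
      ∫ p, (φ : M → ℝ) p * ⟪w j p, stdVec i⟫_ℝ ∂(gaussMeasure (n := n) x) = 0 := by
    intro i
    rcases le_or_gt (j : ℕ) i with hji | hji
    · exact h1 j i hji
    -- For `i < j` also `i < K`, and `⟪E_j^⊥, E_i⟫ = ⟪E_i^⊥, E_j⟫`: the condition was imposed for
    -- the exchanged pair.
    · have h3 := h1 ⟨i, by omega⟩ (Fin.castLE hK j) (by simpa using hji.le)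
      have h4 : ∀ p, ⟪w ⟨i, by omega⟩ p, stdVec (Fin.castLE hK j)⟫_ℝ = ⟪w j p, stdVec i⟫_ℝ := by
        intro p
        simp only [w]
        rw [inner_norPart, real_inner_comm]
        rfl
      simpa only [h4] using h3
  have h3 : ∫ p, (φ : M → ℝ) p * ⟪w j p, meanCurv (n := n) x p⟫_ℝ
      ∂(gaussMeasure (n := n) x) = 0 := congrFun hφ (Sum.inr (Sum.inl j))
  have h4 : IsAllowable (n := n) x (fun p => (φ : M → ℝ) p • w j p) :=
    isAllowable_smul φ.2 (hw j) (fun p => proj_norPart p _) h3 h2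
  have h5 := hstab _ h4 fun l => congrFun hφ (Sum.inr (Sum.inr (j, l)))
  rw [← secondVariation_smul_norPart hx φ.2.1 φ.2.2]
  exact h5

/-- The sum is the trace of the projection, that is, the dimension of the tangent plane. -/
theorem sum_norm_proj_stdVec_sq (hx : IsImm (n := n) x) (p : M) :
    ∑ i : Fin N, ‖proj (n := n) x p (stdVec i)‖ ^ 2 = n := by
  have hproj : LinearMap.IsProj (tangentPlane (n := n) x p)
      (proj (n := n) x p : Euc N →ₗ[ℝ] Euc N) :=
    ⟨fun v => Submodule.starProjection_apply_mem _ v,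
      fun v hv => Submodule.starProjection_eq_self_iff.2 hv⟩
  have h1 := hproj.trace
  rw [LinearMap.trace_eq_sum_inner _ (EuclideanSpace.basisFun (Fin N) ℝ)] at h1
  have h2 : Module.finrank ℝ (tangentPlane (n := n) x p) = n := by
    rw [tangentPlane, LinearMap.finrank_range_of_inj (hx.immersive p)]
    exact finrank_euclideanSpace_fin
  rw [h2] at h1
  rw [← h1]
  refine Finset.sum_congr rfl fun i _ => ?_
  rw [← real_inner_self_eq_norm_sq, inner_proj, proj_proj]
  simp [stdVec]

theorem norm_norPart_sq (p : M) (v : Euc N) :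
    ‖norPart (n := n) x p v‖ ^ 2 = ‖v‖ ^ 2 - ‖proj (n := n) x p v‖ ^ 2 := by
  rw [← real_inner_self_eq_norm_sq, ← real_inner_self_eq_norm_sq, ← real_inner_self_eq_norm_sq,
    inner_proj, proj_proj, inner_norPart, norPart_norPart, norPart_eq, inner_sub_right]

theorem norm_stdVec (i : Fin N) : ‖stdVec i‖ = 1 := by simp [stdVec]

/-- The tangential parts of all basis vectors have total square length `n`, so those of any `n + k`
of them have between `0` and `n`. The normal parts take up the rest of `n + k`. -/
theorem sum_norm_norPart_bounds (hx : IsImm (n := n) x) {k : ℕ} (hK : n + k ≤ N) (p : M) :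
    (k : ℝ) ≤ ∑ j : Fin (n + k), ‖norPart (n := n) x p (stdVec (Fin.castLE hK j))‖ ^ 2 ∧
      ∑ j : Fin (n + k), ‖norPart (n := n) x p (stdVec (Fin.castLE hK j))‖ ^ 2 ≤ n + k := by
  simp only [norm_norPart_sq, norm_stdVec, Finset.sum_sub_distrib]
  have h1 : ∑ j : Fin (n + k), ‖proj (n := n) x p (stdVec (Fin.castLE hK j))‖ ^ 2 ≤ n := by
    rw [← sum_norm_proj_stdVec_sq hx p]
    refine le_of_eq_of_le (Finset.sum_map Finset.univ ⟨Fin.castLE hK, Fin.castLE_injective hK⟩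
      (fun i => ‖proj (n := n) x p (stdVec i)‖ ^ 2)).symm ?_
    exact Finset.sum_le_sum_of_subset_of_nonneg (Finset.subset_univ _) fun _ _ _ => by positivity
  have h2 : 0 ≤ ∑ j : Fin (n + k), ‖proj (n := n) x p (stdVec (Fin.castLE hK j))‖ ^ 2 :=
    Finset.sum_nonneg fun _ _ => by positivity
  simp only [one_pow, Finset.sum_const, Finset.card_univ, Fintype.card_fin, nsmul_eq_mul, mul_one]
  push_cast
  constructor <;> linarith

theorem cast_sum_sub_eq {K : ℕ} (hK : K ≤ N) :
    ((∑ j : Fin K, (N - j) : ℕ) : ℝ) = K * N - K * ((K : ℝ) - 1) / 2 := by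
  rw [Fin.sum_univ_eq_sum_range fun j => N - j]
  induction K with
  | zero => simp
  | succ K ih =>
    rw [Finset.sum_range_succ, Nat.cast_add, ih (by omega), Nat.cast_sub (by omega)]
    push_cast
    ring

/-- Eigenvalue bounds for shrinkers of finite index. -/
theorem eigenvalue_bound_of_FIndex_eq (hx : IsShrinker (n := n) x)
    (hcomplete : IsCompleteImm (n := n) x) [IsFiniteMeasure (gaussMeasure (n := n) x)]
    {I k m : ℕ} (h : FIndex (n := n) x = (I : ℕ∞)) (hk : 1 ≤ k) (hK : n + k ≤ N)
    (hm : ((n : ℝ) + k) * ((N : ℝ) + I - ((n : ℝ) + k - 3) / 2) ≤ m) :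
    (((k : ℝ) / (2 * ((n : ℝ) + k)) : ℝ) : EReal) ≤ driftEigenvalue (n := n) x m ∧
      (((k : ℝ) / (2 * ((n : ℝ) + k)) : ℝ) : EReal) ≤ driftMinMax (n := n) x m := by
  obtain ⟨ℓ, hℓ⟩ := exists_constraints hx h hK
  -- With `K = n + k` the count is `K N - K (K - 1) / 2 + K + K I`, which is the expression in `hm`.
  have hcard : Fintype.card ((Σ j : Fin (n + k), Fin (N - j)) ⊕
      (Fin (n + k) ⊕ (Fin (n + k) × Fin I))) ≤ m := by
    simp only [Fintype.card_sum, Fintype.card_sigma, Fintype.card_fin, Fintype.card_prod]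
    rify
    have := cast_sum_sub_eq hK
    push_cast at this ⊢
    rw [this]
    linarith
  have key : ∀ φ : testSpace n M, ℓ φ = 0 → (k : ℝ) / (2 * ((n : ℝ) + k)) *
      ∫ p, (φ : M → ℝ) p ^ 2 ∂(gaussMeasure (n := n) x) ≤
        ∫ p, gradSq (n := n) x φ p ∂(gaussMeasure (n := n) x) := by
    intro φ hφ
    have hs : Smooth n (φ : M → ℝ) := φ.2.1
    have hc : HasCompactSupport (φ : M → ℝ) := φ.2.2
    have hgi : Integrable (gradSq (n := n) x (φ : M → ℝ)) (gaussMeasure (n := n) x) := by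
      have h1 : gradSq (n := n) x (φ : M → ℝ) = gradInner (n := n) x φ φ := funext (gradSq_eq _)
      rw [h1]
      exact integrable_of_compact (smooth_gradInner hx.isImm hs hs).continuous
        (hasCompactSupport_gradInner hc _)
    have hgc : HasCompactSupport (gradSq (n := n) x (φ : M → ℝ)) := by
      have h1 : gradSq (n := n) x (φ : M → ℝ) = gradInner (n := n) x φ φ := funext (gradSq_eq _)
      rw [h1]
      exact hasCompactSupport_gradInner hc _
    have hc2 : HasCompactSupport (fun p => (φ : M → ℝ) p ^ 2) :=
      hc.comp_left (g := fun t => t ^ 2) (by simp)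
    have hsi : Integrable (fun p => (φ : M → ℝ) p ^ 2) (gaussMeasure (n := n) x) :=
      integrable_of_compact (hs.continuous.pow 2) hc2
    have hji : ∀ j : Fin (n + k), Integrable (fun p => (gradSq (n := n) x φ p -
        (1 / 2 : ℝ) * (φ : M → ℝ) p ^ 2) * ‖norPart (n := n) x p (stdVec (Fin.castLE hK j))‖ ^ 2)
        (gaussMeasure (n := n) x) := fun j =>
      integrable_of_compact (((continuous_gradSq hx.isImm hs).sub
        (continuous_const.mul (hs.continuous.pow 2))).mul
          (smooth_norm_norPart_sq hx.isImm _).continuous)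
        (HasCompactSupport.mul_right (hgc.sub hc2.mul_left))
    -- The `K` inequalities are added. The upper bound for the total weight goes with the gradient
    -- term and the lower bound with the zero-order term.
    have hsum := Finset.sum_nonneg fun (j : Fin (n + k)) (_ : j ∈ Finset.univ) => hℓ φ hφ j
    rw [← integral_finsetSum _ fun j _ => hji j] at hsum
    have hle : ∫ p, ∑ j : Fin (n + k), (gradSq (n := n) x φ p -
        (1 / 2 : ℝ) * (φ : M → ℝ) p ^ 2) * ‖norPart (n := n) x p (stdVec (Fin.castLE hK j))‖ ^ 2
          ∂(gaussMeasure (n := n) x) ≤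
        ∫ p, (((n : ℝ) + k) * gradSq (n := n) x φ p - (k : ℝ) / 2 * (φ : M → ℝ) p ^ 2)
          ∂(gaussMeasure (n := n) x) := by
      refine integral_mono (integrable_finsetSum _ fun j _ => hji j)
        ((hgi.const_mul _).sub (hsi.const_mul _)) fun p => ?_
      simp only
      rw [← Finset.mul_sum]
      obtain ⟨hb1, hb2⟩ := sum_norm_norPart_bounds hx.isImm hK p
      have e1 := mul_le_mul_of_nonneg_left hb2 (gradSq_nonneg (n := n) (x := x) (φ : M → ℝ) p)
      have e2 := mul_le_mul_of_nonneg_left hb1 (sq_nonneg ((φ : M → ℝ) p))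
      linear_combination e1 + (1 / 2 : ℝ) * e2
    rw [integral_sub (hgi.const_mul _) (hsi.const_mul _), integral_const_mul,
      integral_const_mul] at hle
    have hpos : (0 : ℝ) < (n : ℝ) + k := by positivity
    rw [div_mul_eq_mul_div, div_le_iff₀ (by positivity)]
    linarith
  exact ⟨le_driftEigenvalue hx hcomplete ℓ hcard key, le_driftMinMax hx ℓ hcard key⟩

theorem FStable.FIndex_eq (h : FStable (n := n) x) : FIndex (n := n) x = ((0 : ℕ) : ℕ∞) := by
  refine le_antisymm (iSup₂_le fun W hW => ?_) bot_le
  have : W = ⊥ := by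
    rw [Submodule.eq_bot_iff]
    intro u hu
    by_contra hne
    exact absurd (h u (hW.allowable u hu)) (not_le.2 (hW.negative u hu hne))
  subst this
  simp

end Index


/-! ### Unique continuation for first-order systems -/

section Continuation

variable {n N : ℕ} {M : Type*} [TopologicalSpace M] [ChartedSpace (Euc n) M]
  [IsManifold (𝓡 n) ∞ M]
variable {F : Type*} [NormedAddCommGroup F] [NormedSpace ℝ F] {x : M → Euc N}

theorem norm_tanDeriv_le (Y : M → F) (w : Euc N) (p : M) {c : ℝ}
    (h : ∀ i, ‖tanDeriv (n := n) x Y (stdVec i) p‖ ≤ c) :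
    ‖tanDeriv (n := n) x Y w p‖ ≤ N * ‖w‖ * c := by
  rw [tanDeriv_eq_sum]
  calc ‖∑ i, w i • tanDeriv (n := n) x Y (stdVec i) p‖
      ≤ ∑ i : Fin N, ‖w‖ * c := by
        refine (norm_sum_le _ _).trans (Finset.sum_le_sum fun i _ => ?_)
        rw [norm_smul]
        exact mul_le_mul (PiLp.norm_apply_le w i) (h i) (norm_nonneg _) (norm_nonneg _)
    _ = N * ‖w‖ * c := by
        rw [Finset.sum_const, Finset.card_univ, Fintype.card_fin, nsmul_eq_mul, mul_assoc]

theorem fderiv_chartRep_apply (hx : IsImm (n := n) x) {Y : M → F} (hY : Smooth n Y) (q : M)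
    {y : Euc n} (hy : y ∈ (chartAt (Euc n) q).target) (v : Euc n) :
    fderiv ℝ (chartRep (n := n) Y q) y v =
      tanDeriv (n := n) x Y (fderiv ℝ (chartRep (n := n) x q) y v)
        ((chartAt (Euc n) q).symm y) := by
  have h := hx.tanDeriv_chartRep hY q (fderiv ℝ (chartRep (n := n) x q) y v) hy
  rw [pinv_apply_self _ (hx.injective_chart' q hy)] at h
  exact h.symm

/-- Unique continuation for solutions of linear first order equations. -/
theorem eq_zero_of_norm_tanDeriv_le [ConnectedSpace M] (hx : IsImm (n := n) x) {Y : M → F}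
    (hY : Smooth n Y) {C : M → ℝ} (hC : Continuous C)
    (h : ∀ i p, ‖tanDeriv (n := n) x Y (stdVec i) p‖ ≤ C p * ‖Y p‖) {p₀ : M} (hp₀ : Y p₀ = 0)
    (p : M) : Y p = 0 := by
  have hclosed : IsClosed {q | Y q = 0} := isClosed_eq hY.continuous continuous_const
  have hopen : IsOpen {q | Y q = 0} := by
    rw [isOpen_iff_mem_nhds]
    intro q hq
    set e := chartAt (Euc n) q with he
    have hqs : q ∈ e.source := mem_chart_source _ q
    have hqt : e q ∈ e.target := mem_chart_target _ q
    obtain ⟨r, hr, hball⟩ := Metric.isOpen_iff.1 e.open_target _ hqt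
    have hev : ∀ᶠ q' in 𝓝 q, q' ∈ e.source := e.open_source.mem_nhds hqs
    filter_upwards [hev, (e.continuousAt hqs).eventually_mem (Metric.ball_mem_nhds _ hr)]
      with q' hq's hq'b
    set y₀ := e q with hy₀
    set v := e q' - y₀ with hv
    have hmem : ∀ t ∈ Set.Icc (0 : ℝ) 1, y₀ + t • v ∈ e.target := by
      intro t ht
      apply hball
      have h1 : ‖v‖ < r := by rw [hv, ← dist_eq_norm]; exact hq'b
      rw [Metric.mem_ball, dist_eq_norm, add_sub_cancel_left, norm_smul, Real.norm_eq_abs,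
        abs_of_nonneg ht.1]
      nlinarith [ht.1, ht.2, norm_nonneg v]
    have hline : Continuous fun t : ℝ => y₀ + t • v := by fun_prop
    have hmaps : Set.MapsTo (fun t : ℝ => y₀ + t • v) (Set.Icc 0 1) e.target := hmem
    have hd : ∀ t ∈ Set.Icc (0 : ℝ) 1, HasDerivAt (fun t : ℝ => chartRep (n := n) Y q (y₀ + t • v))
        (fderiv ℝ (chartRep (n := n) Y q) (y₀ + t • v) v) t := by
      intro t ht
      have e2 : HasDerivAt (fun t : ℝ => y₀ + t • v) v t := by
        simpa using ((hasDerivAt_id t).smul_const v).const_add y₀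
      exact (differentiableAt_chartRep hY q (hmem t ht)).hasFDerivAt.comp_hasDerivAt t e2
    have hKc : ContinuousOn (fun t : ℝ => N * ‖fderiv ℝ (chartRep (n := n) x q) (y₀ + t • v) v‖ *
        C (e.symm (y₀ + t • v))) (Set.Icc 0 1) := by
      refine ContinuousOn.mul (continuousOn_const.mul (ContinuousOn.norm ?_)) ?_
      · intro t ht
        have h1 := ((contDiffAt_fderiv_chartRep hx.smooth q (hmem t ht)).continuousAt).clm_apply
          (continuousAt_const (y := v))
        exact (ContinuousAt.comp (f := fun t : ℝ => y₀ + t • v) h1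
          hline.continuousAt).continuousWithinAt
      · exact hC.comp_continuousOn (e.continuousOn_symm.comp hline.continuousOn hmaps)
    obtain ⟨K, hK⟩ := isCompact_Icc.exists_bound_of_continuousOn hKc
    -- Grönwall's inequality on a radial coordinate segment shows that the zero set is open. It is
    -- also closed, and `M` is connected.
    have hz := eq_zero_of_abs_deriv_le_mul_abs_self_of_eq_zero_right (K := K)
      (fun t ht => (hd t ht).continuousAt.continuousWithinAt)
      (fun t ht => (hd t ⟨ht.1, ht.2.le⟩).hasDerivWithinAt)
      (by
        simp only [zero_smul, add_zero, Function.comp_apply, hy₀, ← he, e.left_inv hqs]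
        exact hq)
      (fun t ht => by
        have ht' : t ∈ Set.Icc (0 : ℝ) 1 := ⟨ht.1, ht.2.le⟩
        rw [fderiv_chartRep_apply hx hY q (hmem t ht')]
        refine (norm_tanDeriv_le Y _ _ fun i => h i _).trans ?_
        have h2 := (le_abs_self _).trans (hK t ht')
        have h3 := mul_le_mul_of_nonneg_right h2 (norm_nonneg (Y (e.symm (y₀ + t • v))))
        rw [mul_assoc] at h3
        exact h3) 1 (by simp)
    simpa [hv, ← he, e.left_inv hq's] using hz
  have huniv := IsClopen.eq_univ ⟨hclosed, hopen⟩ ⟨p₀, hp₀⟩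
  have : p ∈ {q | Y q = 0} := by rw [huniv]; trivial
  exact this

end Continuation

/-! ### One-dimensional shrinkers and parallel normals -/

section Curve

variable {N : ℕ} {M : Type*} [TopologicalSpace M] [ChartedSpace (Euc 1) M]
  [IsManifold (𝓡 1) ∞ M] {x : M → Euc N}

theorem exists_unit_tangent (hx : IsImm (n := 1) x) (p : M) :
    ∃ e : Euc N, ‖e‖ = 1 ∧ ∀ w, proj (n := 1) x p w = ⟪e, w⟫_ℝ • e := by
  have hdim : Module.finrank ℝ (tangentPlane (n := 1) x p) = 1 := by
    rw [tangentPlane, LinearMap.finrank_range_of_inj (hx.immersive p)]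
    exact finrank_euclideanSpace_fin
  obtain ⟨⟨v, hv⟩, hv0, hspan⟩ := finrank_eq_one_iff'.1 hdim
  have hvn : ‖v‖ ≠ 0 := norm_ne_zero_iff.2 fun h => hv0 (Subtype.ext h)
  have hPv : proj (n := 1) x p v = v := Submodule.starProjection_eq_self_iff.2 hv
  refine ⟨‖v‖⁻¹ • v, by rw [norm_smul, norm_inv, norm_norm, inv_mul_cancel₀ hvn], fun w => ?_⟩
  obtain ⟨c, hc⟩ := hspan ⟨proj (n := 1) x p w, Submodule.starProjection_apply_mem _ w⟩
  have hc : c • v = proj (n := 1) x p w := congrArg Subtype.val hc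
  have h1 : ⟪v, w⟫_ℝ = c * ‖v‖ ^ 2 := by
    rw [← hPv, inner_proj, ← hc, real_inner_smul_right, hPv, real_inner_self_eq_norm_sq]
  rw [← hc, real_inner_smul_left, h1, smul_smul]
  congr 1
  field_simp

/-- The tangent plane is a line spanned by a unit vector `e`, so `A` is determined by `A(e, e)`,
which is its trace `-H`. -/
theorem secondFF_eq_meanCurv (hx : IsImm (n := 1) x) (p : M) (v w : Euc N) :
    secondFF (n := 1) x p v w = -(⟪proj (n := 1) x p v, w⟫_ℝ • meanCurv (n := 1) x p) := by
  obtain ⟨e, he, hP⟩ := exists_unit_tangent hx p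
  have h1 : ∀ v w, norPart (n := 1) x p (dproj (n := 1) x v p w) =
      ⟪e, v⟫_ℝ • norPart (n := 1) x p (dproj (n := 1) x e p w) := by
    intro v w
    rw [← dproj_proj_dir hx v, hP v]
    have : dproj (n := 1) x (⟪e, v⟫_ℝ • e) p = ⟪e, v⟫_ℝ • dproj (n := 1) x e p :=
      tanDeriv_smul_right _ _ _ _
    rw [this]
    exact norPart_smul p _ _
  have h2 : ∀ v w, secondFF (n := 1) x p v w =
      (⟪e, v⟫_ℝ * ⟪e, w⟫_ℝ) • norPart (n := 1) x p (dproj (n := 1) x e p e) := by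
    intro v w
    rw [secondFF_eq hx, h1, norPart_dproj_comm hx, h1, smul_smul]
  have h3 : meanCurv (n := 1) x p = -norPart (n := 1) x p (dproj (n := 1) x e p e) := by
    unfold meanCurv
    simp only [h2]
    rw [← Finset.sum_smul]
    have : ∑ i : Fin N, ⟪e, stdVec i⟫_ℝ * ⟪e, stdVec i⟫_ℝ = 1 := by
      simp only [inner_stdVec_right, ← sq]
      rw [← EuclideanSpace.real_norm_sq_eq, he, one_pow]
    rw [this, one_smul]
  rw [h2, h3, smul_neg, neg_neg, hP, real_inner_smul_left]

/-- On normal vectors `dproj w` is dual to `A`, which for a curve is `-⟪·, ·⟫ x^⊥ / 2`. The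
derivative of `V^T` is thus linear in `V^T` and `⟪V, x⟫`, which closes the system used in
`proj_eq_zero_of_curve`. -/
theorem dproj_eq_of_curve (hx : IsShrinker (n := 1) x) (p : M) (w V : Euc N) :
    dproj (n := 1) x w p V = dproj (n := 1) x w p (proj (n := 1) x p V) -
      ((1 / 2 : ℝ) * (⟪V, x p⟫_ℝ - ⟪proj (n := 1) x p V, x p⟫_ℝ)) • proj (n := 1) x p w := by
  have hi := hx.isImm
  set b := norPart (n := 1) x p V with hb
  have hV : V = proj (n := 1) x p V + b := (proj_add_norPart p V).symm
  have h1 : dproj (n := 1) x w p b =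
      -(((1 / 2 : ℝ) * ⟪b, x p⟫_ℝ) • proj (n := 1) x p w) := by
    refine ext_inner_right ℝ fun v => ?_
    rw [← proj_dproj_of_normal hi w (proj_norPart p V), inner_proj, inner_dproj hi]
    have h2 : ⟪b, dproj (n := 1) x w p (proj (n := 1) x p v)⟫_ℝ =
        ⟪b, secondFF (n := 1) x p w (proj (n := 1) x p v)⟫_ℝ := by
      rw [secondFF_eq hi, ← inner_norPart, norPart_of_normal (proj_norPart p V)]
    rw [← hb, h2, secondFF_eq_meanCurv hi, hx.equation, inner_neg_right, real_inner_smul_right,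
      real_inner_smul_right, ← inner_norPart, norPart_of_normal (proj_norPart p V), inner_neg_left,
      real_inner_smul_left, ← inner_proj, proj_proj]
    ring
  have h2 : ⟪b, x p⟫_ℝ = ⟪V, x p⟫_ℝ - ⟪proj (n := 1) x p V, x p⟫_ℝ := by
    rw [hb, norPart_eq, inner_sub_left]
  conv_lhs => rw [hV, map_add, h1, h2]
  exact (sub_eq_add_neg _ _).symm

/-- A vector that is orthogonal to the position and to the tangent line at one point of a
one-dimensional shrinker is orthogonal to both at every point. -/
theorem proj_eq_zero_of_curve [ConnectedSpace M] (hx : IsShrinker (n := 1) x) {p₀ : M} {V : Euc N}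
    (h1 : proj (n := 1) x p₀ V = 0) (h2 : ⟪V, x p₀⟫_ℝ = 0) (p : M) :
    proj (n := 1) x p V = 0 := by
  have hi := hx.isImm
  -- The derivative of the first entry is `⟪V^T, w⟫`, and that of the second is given by
  -- `dproj_eq_of_curve`. The pair solves a homogeneous linear system with continuous coefficients.
  set Y : M → ℝ × Euc N := fun q => (⟪V, x q⟫_ℝ, proj (n := 1) x q V) with hY
  have hs1 : Smooth 1 (fun q => ⟪V, x q⟫_ℝ) := Smooth.inner contMDiff_const hx.smooth
  have hYs : Smooth 1 Y := hs1.prodMk_space (smooth_proj_apply hi V)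
  set C : M → ℝ := fun q => 1 + ∑ i : Fin N, ‖dproj (n := 1) x (stdVec i) q‖ +
    (1 / 2 : ℝ) * (1 + ‖x q‖) with hC
  have hCc : Continuous C := by
    refine (continuous_const.add (continuous_finsetSum _ fun i _ => ?_)).add
      (continuous_const.mul (continuous_const.add hx.smooth.continuous.norm))
    exact (smooth_dproj hi (stdVec i)).continuous.norm
  have hbound : ∀ i q, ‖tanDeriv (n := 1) x Y (stdVec i) q‖ ≤ C q * ‖Y q‖ := by
    intro i q
    have hE : ‖(stdVec i : Euc N)‖ = 1 := norm_stdVec i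
    have hfst : (tanDeriv (n := 1) x Y (stdVec i) q).1 =
        ⟪proj (n := 1) x q V, stdVec i⟫_ℝ := by
      have := tanDeriv_clm hi hYs (ContinuousLinearMap.fst ℝ ℝ (Euc N)) (stdVec i) q
      rw [inner_proj, ← tanDeriv_self hi]
      have h3 := tanDeriv_inner hi (contMDiff_const (c := V)) hx.smooth (stdVec i) q
      rw [tanDeriv_const, inner_zero_left, zero_add] at h3
      exact this.symm.trans h3
    have hsnd : (tanDeriv (n := 1) x Y (stdVec i) q).2 = dproj (n := 1) x (stdVec i) q V := by
      have := tanDeriv_clm hi hYs (ContinuousLinearMap.snd ℝ ℝ (Euc N)) (stdVec i) q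
      exact this.symm.trans (tanDeriv_proj_apply hi _ _ _)
    have n1 : |⟪V, x q⟫_ℝ| ≤ ‖Y q‖ := norm_fst_le (Y q)
    have n2 : ‖proj (n := 1) x q V‖ ≤ ‖Y q‖ := norm_snd_le (Y q)
    have n3 : ‖dproj (n := 1) x (stdVec i) q‖ ≤ ∑ i : Fin N, ‖dproj (n := 1) x (stdVec i) q‖ :=
      Finset.single_le_sum (f := fun i => ‖dproj (n := 1) x (stdVec i) q‖)
        (fun _ _ => norm_nonneg _) (Finset.mem_univ i)
    have n4 : 0 ≤ ∑ i : Fin N, ‖dproj (n := 1) x (stdVec i) q‖ :=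
      Finset.sum_nonneg fun _ _ => norm_nonneg _
    have hYn := norm_nonneg (Y q)
    have hxn := norm_nonneg (x q)
    rw [Prod.norm_def, max_le_iff, hfst, hsnd]
    constructor
    · refine (abs_real_inner_le_norm _ _).trans ?_
      rw [hE, mul_one]
      refine n2.trans (le_mul_of_one_le_left hYn ?_)
      simp only [hC]
      linarith
    · rw [dproj_eq_of_curve hx]
      refine (norm_sub_le _ _).trans ?_
      have m1 : ‖dproj (n := 1) x (stdVec i) q (proj (n := 1) x q V)‖ ≤
          (∑ i : Fin N, ‖dproj (n := 1) x (stdVec i) q‖) * ‖Y q‖ :=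
        ((dproj (n := 1) x (stdVec i) q).le_opNorm _).trans
          (mul_le_mul n3 n2 (norm_nonneg _) n4)
      have m2 : |⟪V, x q⟫_ℝ - ⟪proj (n := 1) x q V, x q⟫_ℝ| ≤ (1 + ‖x q‖) * ‖Y q‖ := by
        refine (abs_sub _ _).trans ?_
        have := (abs_real_inner_le_norm (proj (n := 1) x q V) (x q)).trans
          (mul_le_mul_of_nonneg_right n2 hxn)
        linarith
      have m3 : ‖((1 / 2 : ℝ) * (⟪V, x q⟫_ℝ - ⟪proj (n := 1) x q V, x q⟫_ℝ)) •
          proj (n := 1) x q (stdVec i)‖ ≤ (1 / 2 : ℝ) * ((1 + ‖x q‖) * ‖Y q‖) := by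
        rw [norm_smul, Real.norm_eq_abs, abs_mul, abs_of_pos (by norm_num : (0 : ℝ) < 1 / 2)]
        have h5 : ‖proj (n := 1) x q (stdVec i)‖ ≤ 1 := (norm_proj_le q _).trans hE.le
        refine (mul_le_of_le_one_right (by positivity) h5).trans ?_
        gcongr
      simp only [hC]
      linarith
  have h0 := eq_zero_of_norm_tanDeriv_le hi hYs hCc hbound (p₀ := p₀)
    (by simp only [hY, h1, h2]; rfl) p
  exact congrArg Prod.snd h0

theorem exists_unit_normal (hx : IsImm (n := 1) x) (hN : 2 ≤ N) (p : M) :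
    ∃ V : Euc N, V ≠ 0 ∧ proj (n := 1) x p V = 0 := by
  have hdim : Module.finrank ℝ (tangentPlane (n := 1) x p) = 1 := by
    rw [tangentPlane, LinearMap.finrank_range_of_inj (hx.immersive p)]
    exact finrank_euclideanSpace_fin
  have h1 := Submodule.finrank_add_finrank_orthogonal (tangentPlane (n := 1) x p)
  rw [hdim, finrank_euclideanSpace_fin] at h1
  have h2 : (tangentPlane (n := 1) x p)ᗮ ≠ ⊥ := by
    intro h
    rw [h, finrank_bot] at h1
    omega
  obtain ⟨V, hV, hV0⟩ := (Submodule.ne_bot_iff _).1 h2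
  exact ⟨V, hV0, (Submodule.starProjection_apply_eq_zero_iff _).2 hV⟩

/-- One-dimensional shrinkers have a parallel unit normal field. -/
theorem exists_parallel_normal [ConnectedSpace M] (hx : IsShrinker (n := 1) x) (hN : 2 ≤ N) :
    ∃ ν : M → Euc N, Smooth 1 ν ∧ (∀ p, ‖ν p‖ = 1) ∧ (∀ p, proj (n := 1) x p (ν p) = 0) ∧
      ∀ w p, norDeriv (n := 1) x ν w p = 0 := by
  have hi := hx.isImm
  -- In the first case a constant field stays normal everywhere, hence is parallel. In the second
  -- case no nonzero normal vector is orthogonal to `x` at any point, so `x^⊥` never vanishes and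
  -- can be normalized.
  by_cases hA : ∃ p₀ V, V ≠ 0 ∧ proj (n := 1) x p₀ V = 0 ∧ ⟪V, x p₀⟫_ℝ = 0
  · obtain ⟨p₀, V, hV0, h1, h2⟩ := hA
    have hVn : ‖V‖ ≠ 0 := norm_ne_zero_iff.2 hV0
    refine ⟨fun _ => ‖V‖⁻¹ • V, contMDiff_const, fun p => ?_, fun p => ?_, fun w p => ?_⟩
    · rw [norm_smul, norm_inv, norm_norm, inv_mul_cancel₀ hVn]
    · rw [map_smul, proj_eq_zero_of_curve hx h1 h2, smul_zero]
    · unfold norDeriv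
      rw [tanDeriv_const]
      exact map_zero (norProj (n := 1) x p)
  · push Not at hA
    have hA' : ∀ p V, proj (n := 1) x p V = 0 → ⟪V, x p⟫_ℝ = 0 → V = 0 := fun p V h1 h2 => by
      by_contra h
      exact hA p V h h1 h2
    set u : M → Euc N := fun q => norPart (n := 1) x q (x q) with hu
    have hus : Smooth 1 u := smooth_norPart hi hx.smooth
    have hin : ∀ p V, proj (n := 1) x p V = 0 → ⟪V, x p⟫_ℝ = ⟪V, u p⟫_ℝ := fun p V h => by
      rw [hu, ← inner_norPart, norPart_of_normal h]
    have hu0 : ∀ p, u p ≠ 0 := by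
      intro p h0
      obtain ⟨V, hV0, hV⟩ := exists_unit_normal hi hN p
      exact hV0 (hA' p V hV (by rw [hin p V hV, h0, inner_zero_right]))
    have hnorm : Smooth 1 (fun q => ‖u q‖⁻¹) := by
      intro q
      have h1 : ContDiffAt ℝ ∞ (fun v : Euc N => ‖v‖⁻¹) (u q) :=
        (contDiffAt_norm ℝ (hu0 q)).inv (norm_ne_zero_iff.2 (hu0 q))
      exact ContMDiffAt.comp (I' := 𝓘(ℝ, Euc N)) (g := fun v : Euc N => ‖v‖⁻¹) q h1.contMDiffAt
        (hus q)
    set ν : M → Euc N := fun q => ‖u q‖⁻¹ • u q with hν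
    have hνs : Smooth 1 ν := hnorm.smul hus
    have hν1 : ∀ p, ‖ν p‖ = 1 := fun p => by
      rw [hν, norm_smul, norm_inv, norm_norm, inv_mul_cancel₀ (norm_ne_zero_iff.2 (hu0 p))]
    refine ⟨ν, hνs, hν1, fun p => ?_, fun w p => ?_⟩
    · simp only [hν]
      rw [map_smul, hu, proj_norPart, smul_zero]
    -- The derivative of a unit field is orthogonal to it, hence to `x^⊥` and, being normal after
    -- projection, to `x`. The case assumption makes it zero.
    · have hPn : proj (n := 1) x p (norDeriv (n := 1) x ν w p) = 0 := proj_norPart p _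
      refine hA' p _ hPn ?_
      rw [hin p _ hPn]
      have h1 : u p = ‖u p‖ • ν p := by
        rw [hν, smul_smul, mul_inv_cancel₀ (norm_ne_zero_iff.2 (hu0 p)), one_smul]
      have h2 := tanDeriv_inner hi hνs hνs w p
      have h3 : (fun q => ⟪ν q, ν q⟫_ℝ) = fun _ => (1 : ℝ) := by
        funext q
        rw [real_inner_self_eq_norm_sq, hν1, one_pow]
      rw [h3, tanDeriv_const, real_inner_comm] at h2
      have h4 : ⟪norDeriv (n := 1) x ν w p, ν p⟫_ℝ = ⟪tanDeriv (n := 1) x ν w p, ν p⟫_ℝ := by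
        rw [norDeriv, inner_norPart, norPart_of_normal]
        simp only [hν]
        rw [map_smul, hu, proj_norPart, smul_zero]
      rw [h1, real_inner_smul_right, h4]
      have : ⟪tanDeriv (n := 1) x ν w p, ν p⟫_ℝ = 0 := by
        rw [real_inner_comm]
        linarith
      rw [this, mul_zero]

end Curve

/-! ### Bounds for stable shrinkers -/

section Parallel

variable {n N : ℕ} {M : Type*} [TopologicalSpace M] [T2Space M] [SecondCountableTopology M]
  [ChartedSpace (Euc n) M] [MeasurableSpace M] [BorelSpace M] [IsManifold (𝓡 n) ∞ M]
variable {x : M → Euc N}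

/-- A parallel `ν` lets only `φ` be differentiated, and the curvature term enters with a negative
sign, so it may be dropped. -/
theorem secondFormDensity_smul_parallel_le (hx : IsImm (n := n) x) {φ : M → ℝ} (hφ : Smooth n φ)
    {ν : M → Euc N} (hν : Smooth n ν) (hν1 : ∀ p, ‖ν p‖ = 1)
    (hνn : ∀ p, proj (n := n) x p (ν p) = 0) (hνd : ∀ w p, norDeriv (n := n) x ν w p = 0) (p : M) :
    secondFormDensity (n := n) x (fun q => φ q • ν q) (fun q => φ q • ν q) p ≤
      gradSq (n := n) x φ p - (1 / 2 : ℝ) * φ p ^ 2 := by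
  have h1 : ∀ w, norDeriv (n := n) x (fun q => φ q • ν q) w p =
      tanDeriv (n := n) x φ w p • ν p := by
    intro w
    unfold norDeriv
    rw [tanDeriv_smul hx hφ hν, norPart_add, norPart_smul, norPart_smul,
      norPart_of_normal (hνn p)]
    have := hνd w p
    unfold norDeriv at this
    rw [this, smul_zero, add_zero]
  have h2 : 0 ≤ ∑ i : Fin N, ∑ j : Fin N,
      ⟪φ p • ν p, secondFF (n := n) x p (stdVec i) (stdVec j)⟫_ℝ *
        ⟪φ p • ν p, secondFF (n := n) x p (stdVec i) (stdVec j)⟫_ℝ :=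
    Finset.sum_nonneg fun _ _ => Finset.sum_nonneg fun _ _ => mul_self_nonneg _
  unfold secondFormDensity gradSq
  simp only [h1]
  have h3 : ∀ a : ℝ, ⟪a • ν p, a • ν p⟫_ℝ = a ^ 2 := by
    intro a
    rw [real_inner_self_eq_norm_sq, norm_smul, hν1, mul_one, Real.norm_eq_abs, sq_abs]
  simp only [h3]
  linarith

/-- Eigenvalue bounds for stable shrinkers with a parallel unit normal field. -/
theorem eigenvalue_bound_of_parallel (hx : IsShrinker (n := n) x)
    (hcomplete : IsCompleteImm (n := n) x) [IsFiniteMeasure (gaussMeasure (n := n) x)]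
    (hstab : FStable (n := n) x) {ν : M → Euc N} (hν : Smooth n ν) (hν1 : ∀ p, ‖ν p‖ = 1)
    (hνn : ∀ p, proj (n := n) x p (ν p) = 0) (hνd : ∀ w p, norDeriv (n := n) x ν w p = 0)
    {m : ℕ} (hm : N + 1 ≤ m) :
    ((1 / 2 : ℝ) : EReal) ≤ driftEigenvalue (n := n) x m ∧
      ((1 / 2 : ℝ) : EReal) ≤ driftMinMax (n := n) x m := by
  have hc1 : ∀ i : Fin N, Continuous fun p => ⟪ν p, stdVec i⟫_ℝ := fun i =>
    (hν.inner contMDiff_const).continuous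
  have hc2 : Continuous fun p => ⟪ν p, meanCurv (n := n) x p⟫_ℝ :=
    (hν.inner hx.smooth_meanCurv).continuous
  -- One field `φ ν` is tested instead of `n + k` fields: `N` conditions for translations and one
  -- for `H`.
  let ℓ : testSpace n M →ₗ[ℝ] (Fin N ⊕ Unit → ℝ) := LinearMap.pi (Sum.elim
    (fun i => testIntegral x _ (hc1 i)) (fun _ => testIntegral x _ hc2))
  have hcard : Fintype.card (Fin N ⊕ Unit) ≤ m := by simpa using hm
  have key : ∀ φ : testSpace n M, ℓ φ = 0 → (1 / 2 : ℝ) *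
      ∫ p, (φ : M → ℝ) p ^ 2 ∂(gaussMeasure (n := n) x) ≤
        ∫ p, gradSq (n := n) x φ p ∂(gaussMeasure (n := n) x) := by
    intro φ hφ
    have hs : Smooth n (φ : M → ℝ) := φ.2.1
    have hc : HasCompactSupport (φ : M → ℝ) := φ.2.2
    have hall : IsAllowable (n := n) x (fun p => (φ : M → ℝ) p • ν p) :=
      isAllowable_smul φ.2 hν hνn (congrFun hφ (Sum.inr ()))
        fun i => congrFun hφ (Sum.inl i)
    have h1 := hstab _ hall
    rw [hall.secondVariation_eq hx] at h1
    have hgi : Integrable (gradSq (n := n) x (φ : M → ℝ)) (gaussMeasure (n := n) x) := by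
      have h1 : gradSq (n := n) x (φ : M → ℝ) = gradInner (n := n) x φ φ := funext (gradSq_eq _)
      rw [h1]
      exact integrable_of_compact (smooth_gradInner hx.isImm hs hs).continuous
        (hasCompactSupport_gradInner hc _)
    have hsi : Integrable (fun p => (φ : M → ℝ) p ^ 2) (gaussMeasure (n := n) x) :=
      integrable_of_compact (hs.continuous.pow 2) (hc.comp_left (g := fun t => t ^ 2) (by simp))
    have h2 := integral_mono (integrable_secondFormDensity hx.isImm hall.smooth hall.compact
      hall.smooth) (hgi.sub (hsi.const_mul (1 / 2)))
      fun p => secondFormDensity_smul_parallel_le hx.isImm hs hν hν1 hνn hνd p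
    rw [secondForm] at h1
    have h3 := integral_sub hgi (hsi.const_mul (1 / 2))
    rw [integral_const_mul] at h3
    have h4 := h1.trans (h2.trans_eq h3)
    linarith
  exact ⟨le_driftEigenvalue hx hcomplete ℓ hcard key, le_driftMinMax hx ℓ hcard key⟩

/-- Eigenvalue bounds for stable shrinkers. -/
theorem eigenvalue_bound_of_FStable [ConnectedSpace M] (hn : 1 ≤ n) (hx : IsShrinker (n := n) x)
    (hcomplete : IsCompleteImm (n := n) x) [IsFiniteMeasure (gaussMeasure (n := n) x)]
    (hstab : FStable (n := n) x) (hN : 2 * n ≤ N) :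
    ((1 / 4 : ℝ) : EReal) ≤ driftEigenvalue (n := n) x (2 * n * N) ∧
      ((1 / 4 : ℝ) : EReal) ≤ driftMinMax (n := n) x (2 * n * N) := by
  -- With `k = n` and `I = 0` the general count is `2nN - n(2n - 3)`, which is at most `2nN` exactly
  -- when `n ≥ 2`. For `n = 1` the parallel normal needs `N + 1 ≤ 2N` conditions.
  rcases hn.eq_or_lt with rfl | hn2
  · obtain ⟨ν, hν, hν1, hνn, hνd⟩ := exists_parallel_normal hx (by omega)
    have h := eigenvalue_bound_of_parallel hx hcomplete hstab hν hν1 hνn hνd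
      (m := 2 * 1 * N) (by omega)
    have hle : ((1 / 4 : ℝ) : EReal) ≤ ((1 / 2 : ℝ) : EReal) :=
      EReal.coe_le_coe_iff.2 (by norm_num)
    exact ⟨hle.trans h.1, hle.trans h.2⟩
  · have hn' : (2 : ℝ) ≤ n := by exact_mod_cast hn2
    have h := eigenvalue_bound_of_FIndex_eq hx hcomplete hstab.FIndex_eq (k := n)
      (m := 2 * n * N) hn (by omega) (by push_cast; nlinarith)
    have he : (n : ℝ) / (2 * ((n : ℝ) + n)) = 1 / 4 := by
      field_simp
      norm_num
    rwa [he] at h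

end Parallel

end GaussianShrinker

end

open GaussianShrinker in
theorem mainTheorem5 {n N : ℕ} (hn : 1 ≤ n)
    {M : Type*} [TopologicalSpace M] [T2Space M] [SecondCountableTopology M] [ConnectedSpace M]
    [ChartedSpace (Euc n) M] [IsManifold (𝓡 n) ∞ M] [MeasurableSpace M] [BorelSpace M]
    (x : M → Euc N)
    (hx : IsShrinker (n := n) x) (hcomplete : IsCompleteImm (n := n) x)
    (hentropy : entropy (n := n) x < ⊤) :
    (FStable (n := n) x → 2 * n ≤ N →
      ((1 / 4 : ℝ) : EReal) ≤ driftEigenvalue (n := n) x (2 * n * N) ∧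
      ((1 / 4 : ℝ) : EReal) ≤ driftMinMax (n := n) x (2 * n * N)) ∧
    (∀ I k m : ℕ, FIndex (n := n) x = (I : ℕ∞) → 1 ≤ k → n + k ≤ N →
      (m : ℝ) = ((n : ℝ) + k) * ((N : ℝ) + I - ((n : ℝ) + k - 3) / 2) →
      (((k : ℝ) / (2 * ((n : ℝ) + k)) : ℝ) : EReal) ≤ driftEigenvalue (n := n) x m ∧
      (((k : ℝ) / (2 * ((n : ℝ) + k)) : ℝ) : EReal) ≤ driftMinMax (n := n) x m) := by
  have := isFiniteMeasure_gaussMeasure hentropy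
  refine ⟨fun hstab hN => eigenvalue_bound_of_FStable hn hx hcomplete hstab hN,
    fun I k m hI hk hK hm => ?_⟩
  exact eigenvalue_bound_of_FIndex_eq hx hcomplete hI hk hK hm.ge
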